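/- Write $d_{\mathrm{TV}}(P,Q)=\sup_A|P(A)-Q(A)|$ for the total variation distance. Work in the real-RAM model: memory cells hold real numbers, indirect addressing is through natural-number index registers, and each of $+,-,\times,/$, logarithm, square root and comparison on reals (as well as each elementary operation on indices and each memory access) costs one unit. There exist a deterministic real-RAM algorithm and an absolute constant $C>0$ such that the following holds for every $n\ge 1$, every $\mu\in\mathbb R^n$, every diagonal $n\times n$ matrix $\Sigma$ with positive diagonal entries, and every real $\epsilon\in(0,1)$. Let $$D=d_{\mathrm{TV}}\bigl(\mathcal N(\mu,\Sigma),\mathcal N(0,I_n)\bigr)$$ and suppose that $D>0$ (that is, $(\mu,\Sigma)\neq(0,I_n)$). On input $n$, $\mu$, the diagonal of $\Sigma$, and $\epsilon$, the algorithm halts after at most $$C\cdot\frac{n^2}{\epsilon}\,\log^3\frac{2n}{\epsilon D}$$ operations and outputs a number $M$ and (the probability tables of) $2n$ probability distributions $\tilde P_1,\tilde Q_1,\dots,\tilde P_n,\tilde Q_n$ on $[M]=\{1,\dots,M\}$, where $$M\le C\cdot\frac n\epsilon\,\log\frac{2n}{\epsilon D},$$ such that the product distributions $\tilde P=\tilde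 P_1\times\dots\times\tilde P_n$ and $\tilde Q=\tilde Q_1\times\dots\times\tilde Q_n$ on $[M]^n$ satisfy $$\bigl|d_{\mathrm{TV}}(\tilde P,\tilde Q)-D\bigr|\le\frac{\epsilon}{3}\,D .$$ -/

import Mathlib

open MeasureTheory ProbabilityTheory

/-- The total variation distance `sup_A |P(A) - Q(A)|`, over all measurable sets `A`. -/
noncomputable def tvDist {Ω : Type*} [MeasurableSpace Ω] (P Q : Measure Ω) : ℝ :=
  ⨆ A : {A : Set Ω // MeasurableSet A}, |P.real A.1 - Q.real A.1|

namespace RealRAM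

/-- A configuration of the real-RAM: index registers holding natural numbers (used for
counting and for addressing), real registers, and real memory. The memory is organised in
arrays; `mem a k` is the cell number `k` of the array `a`. A program can name finitely many
registers and arrays only, as the names are constants in its text. -/
structure State where
  idx : ℕ → ℕ
  reg : ℕ → ℝ
  mem : ℕ → ℕ → ℝ

/-- The unit-cost instructions. The first argument is the target (for `store`, the array).
The only constants are natural numbers. -/
inductive Instr where
  /-- `idx x := k` -/
  | idxConst (x k : ℕ)
  /-- `idx x := idx y` -/
  | idxCopy (x y : ℕ)
  /-- `idx x := idx y + idx z` -/
  | idxAdd (x y z : ℕ)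
  /-- `idx x := max (idx y - idx z) 0` -/
  | idxSub (x y z : ℕ)
  /-- `reg r := k` -/
  | const (r k : ℕ)
  /-- `reg r := idx x` -/
  | ofIdx (r x : ℕ)
  /-- `reg r := reg s` -/
  | copy (r s : ℕ)
  /-- `reg r := reg s + reg t` -/
  | add (r s t : ℕ)
  /-- `reg r := reg s - reg t` -/
  | sub (r s t : ℕ)
  /-- `reg r := reg s * reg t` -/
  | mul (r s t : ℕ)
  /-- `reg r := reg s / reg t`, defined when `reg t ≠ 0` -/
  | div (r s t : ℕ)
  /-- `reg r := log (reg s)`, defined when `reg s > 0` -/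
  | log (r s : ℕ)
  /-- `reg r := sqrt (reg s)`, defined when `reg s ≥ 0` -/
  | sqrt (r s : ℕ)
  /-- `reg r := mem a (idx x)` -/
  | load (r a x : ℕ)
  /-- `mem a (idx x) := reg r` -/
  | store (a x r : ℕ)

/-- The operands of the instruction are in the domain of its operation. -/
def Instr.Defined : Instr → State → Prop
  | .div _ _ t, σ => σ.reg t ≠ 0
  | .log _ s, σ => 0 < σ.reg s
  | .sqrt _ s, σ => 0 ≤ σ.reg s
  | _, _ => True

def State.setIdx (σ : State) (x k : ℕ) : State :=
  { σ with idx := Function.update σ.idx x k }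

def State.setReg (σ : State) (r : ℕ) (v : ℝ) : State :=
  { σ with reg := Function.update σ.reg r v }

def State.setMem (σ : State) (a k : ℕ) (v : ℝ) : State :=
  { σ with mem := Function.update σ.mem a (Function.update (σ.mem a) k v) }

/-- The configuration after the instruction. -/
noncomputable def Instr.next : Instr → State → State
  | .idxConst x k, σ => σ.setIdx x k
  | .idxCopy x y, σ => σ.setIdx x (σ.idx y)
  | .idxAdd x y z, σ => σ.setIdx x (σ.idx y + σ.idx z)
  | .idxSub x y z, σ => σ.setIdx x (σ.idx y - σ.idx z)
  | .const r k, σ => σ.setReg r (k : ℝ)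
  | .ofIdx r x, σ => σ.setReg r (σ.idx x : ℝ)
  | .copy r s, σ => σ.setReg r (σ.reg s)
  | .add r s t, σ => σ.setReg r (σ.reg s + σ.reg t)
  | .sub r s t, σ => σ.setReg r (σ.reg s - σ.reg t)
  | .mul r s t, σ => σ.setReg r (σ.reg s * σ.reg t)
  | .div r s t, σ => σ.setReg r (σ.reg s / σ.reg t)
  | .log r s, σ => σ.setReg r (Real.log (σ.reg s))
  | .sqrt r s, σ => σ.setReg r (Real.sqrt (σ.reg s))
  | .load r a x, σ => σ.setReg r (σ.mem a (σ.idx x))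
  | .store a x r, σ => σ.setMem a (σ.idx x) (σ.reg r)

/-- The unit-cost comparisons. -/
inductive Test where
  /-- `idx x < idx y` -/
  | idxLt (x y : ℕ)
  /-- `reg r < reg s` -/
  | lt (r s : ℕ)
  /-- `reg r ≤ reg s` -/
  | le (r s : ℕ)

def Test.Holds : Test → State → Prop
  | .idxLt x y, σ => σ.idx x < σ.idx y
  | .lt r s, σ => σ.reg r < σ.reg s
  | .le r s, σ => σ.reg r ≤ σ.reg s

/-- Programs: finite texts, independent of the input. -/
inductive Prog where
  | skip
  | instr (i : Instr)
  | seq (p q : Prog)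
  | ite (b : Test) (p q : Prog)
  | while (b : Test) (p : Prog)

/-- `p.Runs σ τ T`: started in the configuration `σ`, the program `p` halts in the
configuration `τ` after exactly `T` operations. Every instruction and every evaluation of a
comparison counts as one operation. There is no run through an undefined instruction. -/
inductive Prog.Runs : Prog → State → State → ℕ → Prop where
  | skip (σ : State) : Prog.Runs .skip σ σ 1
  | instr (i : Instr) (σ : State) (h : i.Defined σ) : Prog.Runs (.instr i) σ (i.next σ) 1
  | seq {p q : Prog} {σ σ' σ'' : State} {T T' : ℕ} (hp : Prog.Runs p σ σ' T)
      (hq : Prog.Runs q σ' σ'' T') : Prog.Runs (.seq p q) σ σ'' (T + T')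
  | ite_true {b : Test} {p q : Prog} {σ σ' : State} {T : ℕ} (hb : b.Holds σ)
      (hp : Prog.Runs p σ σ' T) : Prog.Runs (.ite b p q) σ σ' (T + 1)
  | ite_false {b : Test} {p q : Prog} {σ σ' : State} {T : ℕ} (hb : ¬ b.Holds σ)
      (hq : Prog.Runs q σ σ' T) : Prog.Runs (.ite b p q) σ σ' (T + 1)
  | while_true {b : Test} {p : Prog} {σ σ' σ'' : State} {T T' : ℕ} (hb : b.Holds σ)
      (hp : Prog.Runs p σ σ' T) (hw : Prog.Runs (.while b p) σ' σ'' T') :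
      Prog.Runs (.while b p) σ σ'' (T + T' + 1)
  | while_false {b : Test} {p : Prog} {σ : State} (hb : ¬ b.Holds σ) :
      Prog.Runs (.while b p) σ σ 1

/-- The machine is deterministic: result and number of operations are functions of the
program and of the initial configuration. -/
theorem Prog.Runs.deterministic {p : Prog} {σ τ : State} {T : ℕ} (h : p.Runs σ τ T) :
    ∀ {τ' : State} {T' : ℕ}, p.Runs σ τ' T' → τ = τ' ∧ T = T' := by
  induction h with
  | skip σ => intro τ' T' h'; cases h'; exact ⟨rfl, rfl⟩
  | instr i σ h => intro τ' T' h'; cases h'; exact ⟨rfl, rfl⟩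
  | seq hp hq ihp ihq =>
    intro τ' T' h'
    cases h' with
    | seq hp' hq' =>
      obtain ⟨rfl, rfl⟩ := ihp hp'
      obtain ⟨rfl, rfl⟩ := ihq hq'
      exact ⟨rfl, rfl⟩
  | ite_true hb hp ih =>
    intro τ' T' h'
    cases h' with
    | ite_true hb' hp' => obtain ⟨rfl, rfl⟩ := ih hp'; exact ⟨rfl, rfl⟩
    | ite_false hb' hp' => exact absurd hb hb'
  | ite_false hb hp ih =>
    intro τ' T' h'
    cases h' with
    | ite_true hb' hp' => exact absurd hb' hb
    | ite_false hb' hp' => obtain ⟨rfl, rfl⟩ := ih hp'; exact ⟨rfl, rfl⟩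
  | while_true hb hp hw ihp ihw =>
    intro τ' T' h'
    cases h' with
    | while_true hb' hp' hw' =>
      obtain ⟨rfl, rfl⟩ := ihp hp'
      obtain ⟨rfl, rfl⟩ := ihw hw'
      exact ⟨rfl, rfl⟩
    | while_false hb' => exact absurd hb hb'
  | while_false hb =>
    intro τ' T' h'
    cases h' with
    | while_true hb' hp' hw' => exact absurd hb' hb
    | while_false hb' => exact ⟨rfl, rfl⟩

/-- The input: the dimension `n` is in the index register `0`, the accuracy `ε` in the real
register `0`, the mean `μ` in the array `0`, the diagonal `d` of the covariance matrix in the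
array `1`. Everything else is zero. -/
noncomputable def inputState (n : ℕ) (μ : EuclideanSpace ℝ (Fin n)) (d : Fin n → ℝ) (ε : ℝ) :
    State where
  idx x := if x = 0 then n else 0
  reg r := if r = 0 then ε else 0
  mem a k := if h : k < n then
      (if a = 0 then μ ⟨k, h⟩ else if a = 1 then d ⟨k, h⟩ else 0)
    else 0

/-- The output convention: the index register `0` holds the size `M` of the domain, the array
`2` holds the probability tables of `P 0, …, P (n-1)` one after the other, and the array `3`
those of `Q 0, …, Q (n-1)`. -/
structure State.Outputs (τ : State) {n M : ℕ} (P Q : Fin n → PMF (Fin M)) : Prop where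
  size : τ.idx 0 = M
  left : ∀ (i : Fin n) (j : Fin M), τ.mem 2 (i * M + j) = (P i j).toReal
  right : ∀ (i : Fin n) (j : Fin M), τ.mem 3 (i * M + j) = (Q i j).toReal

end RealRAM

/-! ### Total variation: subadditivity over products and data processing. -/

section TotalVariation

variable {Ω Ω' : Type*} [MeasurableSpace Ω] [MeasurableSpace Ω']

/-! Replacing a point by the cell of its likelihood ratio loses little total variation if the cells
are fine compared with the distance of the ratio from 1. In each coordinate, the logarithm of the
density of `P = N(m, v)` with respect to `Q = N(0, 1)` is cut at the levels ±(1/η)(1+η)^(-k), where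
k runs until the level drops below δ. On a cell where `P` is the smaller law, `P` conditioned on the
cell may be replaced by `Q` conditioned on it; where `Q` is smaller, the roles are exchanged. The
error on a cell is at most η(Q(cell) - P(cell)) + O(δ)Q(cell) for the first kind. It thus sums to η
times the distance of the coordinate laws plus O(δ): a relative error, up to δ
(`tvDist_mixture_cellLaw_le`, `level_cells_pinched`). After the replacement both laws are mixtures
of the same kernels, so by data processing their distance is at most that of the cell tables.
Coarsening never increases the distance, so the product of the tables has distance D up to 2n(ηD +
10δ) (`tvDist_pi_le_tvDist_pi_map_add`). With η = ε/(24n) there are O((n/ε) log(1/(ηδ))) cells.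

The tables must be computed exactly as probability distributions, without the Gaussian distribution
function. The standard normal law is replaced by the law on [-√K/2, √K/2] with density proportional
to the Taylor polynomial of exp(-t²/2) with K terms. Its distribution function is a polynomial
inside the interval, and its distance from the normal law is at most 6exp(-K/16)
(`tvDist_truncNormal_le`), so K = O(log(1/δ)) is enough. Sublevel sets of the log-ratio are given by
quadratic inequalities, hence their measures come from two values of this distribution function
(`measureReal_quadratic_le_zero`). Variance 1 is moved to 1 + δ to keep the quadratic nondegenerate.

The algorithm does not know D, so δ is derived from `gaussGap`, a rational function of mean and
variance. Up to constants it lies between the square of the distance and the distance, in each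
coordinate. Hence δ can be made small against εD/n and still polynomially large in εD/n, so that
log(1/δ) = O(log(2n/(εD))) (`tol_le`, `le_tol`). The cost is dominated by K operations for each of
the n·O(J) table entries, where 2J is the number of levels. This is O((n²/ε) log²), within the
claimed bound. -/

theorem tvDist_bddAbove (P Q : Measure Ω) [IsProbabilityMeasure P] [IsProbabilityMeasure Q] :
    BddAbove (Set.range fun A : {A : Set Ω // MeasurableSet A} => |P.real A.1 - Q.real A.1|) := by
  refine ⟨1, ?_⟩
  rintro _ ⟨A, rfl⟩
  have h1 := measureReal_nonneg (μ := P) (s := A.1)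
  have h2 := measureReal_nonneg (μ := Q) (s := A.1)
  have h3 := measureReal_le_one (μ := P) (s := A.1)
  have h4 := measureReal_le_one (μ := Q) (s := A.1)
  exact abs_le.2 ⟨by linarith, by linarith⟩

theorem abs_measureReal_sub_le_tvDist (P Q : Measure Ω) [IsProbabilityMeasure P]
    [IsProbabilityMeasure Q] {A : Set Ω} (hA : MeasurableSet A) :
    |P.real A - Q.real A| ≤ tvDist P Q :=
  le_ciSup (tvDist_bddAbove P Q) (⟨A, hA⟩ : {A : Set Ω // MeasurableSet A})

theorem measureReal_sub_le_tvDist (P Q : Measure Ω) [IsProbabilityMeasure P]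
    [IsProbabilityMeasure Q] {A : Set Ω} (hA : MeasurableSet A) :
    P.real A - Q.real A ≤ tvDist P Q :=
  (le_abs_self _).trans (abs_measureReal_sub_le_tvDist P Q hA)

theorem tvDist_le_of_abs {P Q : Measure Ω} {c : ℝ}
    (h : ∀ A, MeasurableSet A → |P.real A - Q.real A| ≤ c) : tvDist P Q ≤ c := by
  have : Nonempty {A : Set Ω // MeasurableSet A} := ⟨⟨∅, MeasurableSet.empty⟩⟩
  exact ciSup_le fun A => h A.1 A.2

/-- Passing to the complement changes the sign of the difference, so one-sided bounds are enough. -/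
theorem tvDist_le {P Q : Measure Ω} [IsProbabilityMeasure P] [IsProbabilityMeasure Q] {c : ℝ}
    (h : ∀ A, MeasurableSet A → P.real A - Q.real A ≤ c) : tvDist P Q ≤ c := by
  refine tvDist_le_of_abs fun A hA => abs_le.2 ⟨?_, h A hA⟩
  have := h Aᶜ hA.compl
  rw [probReal_compl_eq_one_sub hA, probReal_compl_eq_one_sub hA] at this
  linarith

theorem tvDist_comm (P Q : Measure Ω) : tvDist P Q = tvDist Q P := by
  unfold tvDist
  simp_rw [abs_sub_comm]

theorem tvDist_nonneg (P Q : Measure Ω) : 0 ≤ tvDist P Q :=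
  Real.iSup_nonneg fun _ => abs_nonneg _

theorem tvDist_self (P : Measure Ω) : tvDist P P = 0 :=
  le_antisymm (tvDist_le_of_abs fun A _ => by simp) (tvDist_nonneg _ _)

theorem tvDist_le_one (P Q : Measure Ω) [IsProbabilityMeasure P] [IsProbabilityMeasure Q] :
    tvDist P Q ≤ 1 :=
  tvDist_le fun A _ => by
    have h2 := measureReal_nonneg (μ := Q) (s := A)
    have h3 := measureReal_le_one (μ := P) (s := A)
    linarith

theorem tvDist_triangle (P Q R : Measure Ω) [IsProbabilityMeasure P] [IsProbabilityMeasure Q]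
    [IsProbabilityMeasure R] : tvDist P R ≤ tvDist P Q + tvDist Q R :=
  tvDist_le fun A hA => by
    have h1 := measureReal_sub_le_tvDist P Q hA
    have h2 := measureReal_sub_le_tvDist Q R hA
    linarith

theorem tvDist_map_le (P Q : Measure Ω) [IsProbabilityMeasure P] [IsProbabilityMeasure Q]
    {f : Ω → Ω'} (hf : Measurable f) : tvDist (P.map f) (Q.map f) ≤ tvDist P Q :=
  tvDist_le_of_abs fun A hA => by
    rw [map_measureReal_apply hf hA, map_measureReal_apply hf hA]
    exact abs_measureReal_sub_le_tvDist P Q (hf hA)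

theorem tvDist_map_equiv (P Q : Measure Ω) [IsProbabilityMeasure P] [IsProbabilityMeasure Q]
    (e : Ω ≃ᵐ Ω') : tvDist (P.map e) (Q.map e) = tvDist P Q := by
  have : IsProbabilityMeasure (P.map e) := Measure.isProbabilityMeasure_map e.measurable.aemeasurable
  have : IsProbabilityMeasure (Q.map e) := Measure.isProbabilityMeasure_map e.measurable.aemeasurable
  refine le_antisymm (tvDist_map_le P Q e.measurable) ?_
  have := tvDist_map_le (P.map e) (Q.map e) e.symm.measurable
  simpa using this

/-- By the layer-cake formula each integral is the average over t in (0, 1] of the measure of {f ≥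
t}, and the bound holds for every t. -/
theorem integral_sub_le_tvDist (P Q : Measure Ω) [IsProbabilityMeasure P]
    [IsProbabilityMeasure Q] {f : Ω → ℝ} (hf : Measurable f) (h0 : ∀ x, 0 ≤ f x)
    (h1 : ∀ x, f x ≤ 1) : ∫ x, f x ∂P - ∫ x, f x ∂Q ≤ tvDist P Q := by
  have int : ∀ ν : Measure Ω, IsProbabilityMeasure ν → Integrable f ν := fun ν _ =>
    Integrable.of_bound hf.aestronglyMeasurable 1
      (Filter.Eventually.of_forall fun x => by rw [Real.norm_of_nonneg (h0 x)]; exact h1 x)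
  have layer : ∀ ν : Measure Ω, IsProbabilityMeasure ν →
      ∫ x, f x ∂ν = ∫ t in Set.Ioc 0 1, ν.real {a | t ≤ f a} := fun ν hR =>
    (int ν hR).integral_eq_integral_Ioc_meas_le (Filter.Eventually.of_forall h0)
      (Filter.Eventually.of_forall h1)
  have meas : ∀ ν : Measure Ω, IsProbabilityMeasure ν →
      Integrable (fun t => ν.real {a | t ≤ f a}) (volume.restrict (Set.Ioc (0 : ℝ) 1)) := by
    intro ν _
    have anti : Antitone fun t => ν.real {a | t ≤ f a} := fun s t hst =>
      measureReal_mono fun a (ha : t ≤ f a) => hst.trans ha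
    exact Integrable.of_bound anti.measurable.aestronglyMeasurable 1
      (Filter.Eventually.of_forall fun x => by
        rw [Real.norm_of_nonneg measureReal_nonneg]; exact measureReal_le_one)
  rw [layer P inferInstance, layer Q inferInstance,
    ← integral_sub (meas P inferInstance) (meas Q inferInstance)]
  calc ∫ t in Set.Ioc (0 : ℝ) 1, (P.real {a | t ≤ f a} - Q.real {a | t ≤ f a})
      ≤ ∫ _ in Set.Ioc (0 : ℝ) 1, tvDist P Q :=
        integral_mono ((meas P inferInstance).sub (meas Q inferInstance)) (integrable_const _)
          fun t => measureReal_sub_le_tvDist P Q (measurableSet_le measurable_const hf)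
    _ = tvDist P Q := by simp

/-- Change one factor at a time, through `P₁.prod Q₂`. By Fubini the first change costs an average
of differences of `Q₁` and `Q₂` over sections; the second compares `P₁` and `P₂` on a function with
values in [0, 1]. -/
theorem tvDist_prod_le (P₁ P₂ : Measure Ω) (Q₁ Q₂ : Measure Ω') [IsProbabilityMeasure P₁]
    [IsProbabilityMeasure P₂] [IsProbabilityMeasure Q₁] [IsProbabilityMeasure Q₂] :
    tvDist (P₁.prod Q₁) (P₂.prod Q₂) ≤ tvDist P₁ P₂ + tvDist Q₁ Q₂ := by
  have key : ∀ (P : Measure Ω) (Q : Measure Ω') [IsProbabilityMeasure P] [IsProbabilityMeasure Q]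
      {A : Set (Ω × Ω')}, MeasurableSet A →
      (P.prod Q).real A = ∫ x, Q.real (Prod.mk x ⁻¹' A) ∂P := by
    intro P Q _ _ A hA
    rw [measureReal_def, Measure.prod_apply hA, integral_eq_lintegral_of_nonneg_ae
      (Filter.Eventually.of_forall fun _ => measureReal_nonneg)
      (measurable_measure_prodMk_left hA).ennreal_toReal.aestronglyMeasurable]
    congr 1
    exact lintegral_congr fun x => (ofReal_measureReal).symm
  refine tvDist_le fun A hA => ?_
  have m : ∀ (Q : Measure Ω') [IsProbabilityMeasure Q],
      Measurable fun x => Q.real (Prod.mk x ⁻¹' A) := fun Q _ =>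
    (measurable_measure_prodMk_left hA).ennreal_toReal
  have int : ∀ (Q : Measure Ω') [IsProbabilityMeasure Q],
      Integrable (fun x => Q.real (Prod.mk x ⁻¹' A)) P₁ := fun Q _ =>
    Integrable.of_bound (m Q).aestronglyMeasurable 1
      (Filter.Eventually.of_forall fun x => by
        rw [Real.norm_of_nonneg measureReal_nonneg]; exact measureReal_le_one)
  have h1 : (P₁.prod Q₁).real A - (P₁.prod Q₂).real A ≤ tvDist Q₁ Q₂ := by
    rw [key P₁ Q₁ hA, key P₁ Q₂ hA, ← integral_sub (int Q₁) (int Q₂)]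
    calc ∫ x, (Q₁.real (Prod.mk x ⁻¹' A) - Q₂.real (Prod.mk x ⁻¹' A)) ∂P₁
        ≤ ∫ _, tvDist Q₁ Q₂ ∂P₁ :=
          integral_mono ((int Q₁).sub (int Q₂)) (integrable_const _) fun x =>
            measureReal_sub_le_tvDist Q₁ Q₂ (measurable_prodMk_left hA)
      _ = tvDist Q₁ Q₂ := by simp
  have h2 : (P₁.prod Q₂).real A - (P₂.prod Q₂).real A ≤ tvDist P₁ P₂ := by
    rw [key P₁ Q₂ hA, key P₂ Q₂ hA]
    exact integral_sub_le_tvDist P₁ P₂ (m Q₂) (fun _ => measureReal_nonneg)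
      fun _ => measureReal_le_one
  linarith

theorem tvDist_pi_le : ∀ {n : ℕ} (P Q : Fin n → Measure Ω) [∀ i, IsProbabilityMeasure (P i)]
    [∀ i, IsProbabilityMeasure (Q i)],
    tvDist (Measure.pi P) (Measure.pi Q) ≤ ∑ i, tvDist (P i) (Q i)
  | 0, P, Q, _, _ => by
    have : Measure.pi P = Measure.pi Q := by
      congr 1
      exact Subsingleton.elim _ _
    rw [this, tvDist_self]
    simp
  | n + 1, P, Q, _, _ => by
    have hP := (measurePreserving_piFinSuccAbove P 0).map_eq
    have hQ := (measurePreserving_piFinSuccAbove Q 0).map_eq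
    rw [← tvDist_map_equiv (Measure.pi P) (Measure.pi Q)
      (MeasurableEquiv.piFinSuccAbove (fun _ => Ω) 0), hP, hQ, Fin.sum_univ_succ]
    exact (tvDist_prod_le _ _ _ _).trans (add_le_add le_rfl (tvDist_pi_le _ _))

theorem tvDist_le_tvDist_pi {n : ℕ} (P Q : Fin n → Measure Ω) [∀ i, IsProbabilityMeasure (P i)]
    [∀ i, IsProbabilityMeasure (Q i)] (i : Fin n) :
    tvDist (P i) (Q i) ≤ tvDist (Measure.pi P) (Measure.pi Q) := by
  have := tvDist_map_le (Measure.pi P) (Measure.pi Q) (measurable_pi_apply i)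
  have e : ∀ R : Fin n → Measure Ω, (∀ i, IsProbabilityMeasure (R i)) →
      (Measure.pi R).map (fun x => x i) = R i := by
    intro R _
    have := Measure.pi_map_eval R i
    simpa using this
  rwa [e P inferInstance, e Q inferInstance] at this

/-- The law obtained by drawing `j` from `p` and then a point from `K j`. -/
noncomputable def mixture {ι : Type*} [Fintype ι] (p : ι → ENNReal) (K : ι → Measure Ω) :
    Measure Ω :=
  ∑ j, p j • K j

theorem mixture_apply {ι : Type*} [Fintype ι] (p : ι → ENNReal) (K : ι → Measure Ω) (A : Set Ω) :
    mixture p K A = ∑ j, p j * K j A := by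
  simp [mixture]

/-- On boxes this is the expansion of a product of sums: drawing all labels first gives a mixture of
products. -/
theorem pi_mixture {n : ℕ} {ι : Type*} [Fintype ι] (p : Fin n → ι → ENNReal)
    (K : Fin n → ι → Measure Ω) [∀ i, IsProbabilityMeasure (mixture (p i) (K i))]
    [∀ i j, IsFiniteMeasure (K i j)] :
    Measure.pi (fun i => mixture (p i) (K i)) =
      mixture (fun x : Fin n → ι => ∏ i, p i (x i)) (fun x => Measure.pi fun i => K i (x i)) := by
  classical
  refine Measure.pi_eq fun s hs => ?_
  rw [mixture_apply]
  simp_rw [mixture_apply, Measure.pi_pi, ← Finset.prod_mul_distrib]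
  rw [Finset.prod_univ_sum, Fintype.piFinset_univ]

/-- Data processing for finite mixtures: mixing products of two families of laws on a finite set
through the same kernels does not increase the distance. -/
theorem tvDist_pi_mixture_le {n : ℕ} {ι : Type*} [Fintype ι] [MeasurableSpace ι]
    [MeasurableSingletonClass ι] (P Q : Fin n → Measure ι) [∀ i, IsProbabilityMeasure (P i)]
    [∀ i, IsProbabilityMeasure (Q i)] (K : Fin n → ι → Measure Ω)
    [∀ i, IsProbabilityMeasure (mixture (fun j => P i {j}) (K i))]
    [∀ i, IsProbabilityMeasure (mixture (fun j => Q i {j}) (K i))]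
    [∀ i j, IsFiniteMeasure (K i j)] (hK : ∀ i j, K i j Set.univ ≤ 1) :
    tvDist (Measure.pi fun i => mixture (fun j => P i {j}) (K i))
      (Measure.pi fun i => mixture (fun j => Q i {j}) (K i)) ≤
      tvDist (Measure.pi P) (Measure.pi Q) := by
  classical
  refine tvDist_le fun A hA => ?_
  -- Given the labels, the probability of `A` no longer depends on the law of the labels. Both sides
  -- are integrals of one function with values in [0, 1].
  have e : ∀ R : Fin n → Measure ι, (∀ i, IsProbabilityMeasure (R i)) →
      (∀ i, IsProbabilityMeasure (mixture (fun j => R i {j}) (K i))) →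
      (Measure.pi fun i => mixture (fun j => R i {j}) (K i)).real A =
        ∫ x, (Measure.pi fun i => K i (x i)).real A ∂(Measure.pi R) := by
    intro R _ _
    rw [pi_mixture, measureReal_def, mixture_apply, ENNReal.toReal_sum]
    · rw [integral_fintype (Integrable.of_finite)]
      refine Finset.sum_congr rfl fun x _ => ?_
      rw [ENNReal.toReal_mul, smul_eq_mul, measureReal_def, measureReal_def]
      congr 2
      rw [← Set.univ_pi_singleton, Measure.pi_pi]
    · intro x _
      exact ENNReal.mul_ne_top (ENNReal.prod_ne_top fun i _ => measure_ne_top _ _)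
        (measure_ne_top _ _)
  rw [e P inferInstance inferInstance, e Q inferInstance inferInstance]
  refine integral_sub_le_tvDist _ _ (measurable_of_finite _) (fun _ => measureReal_nonneg) fun x => ?_
  refine ENNReal.toReal_le_of_le_ofReal zero_le_one ?_
  calc Measure.pi (fun i => K i (x i)) A ≤ Measure.pi (fun i => K i (x i)) Set.univ :=
        measure_mono (Set.subset_univ _)
    _ = ∏ i, K i (x i) Set.univ := Measure.pi_univ _
    _ ≤ ENNReal.ofReal 1 := by
        rw [ENNReal.ofReal_one]
        exact Finset.prod_le_one' fun i _ => hK i (x i)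

end TotalVariation

set_option linter.unusedSectionVars false

/-! ### Discretization along cells that pin down the likelihood ratio. -/

section Discretization

variable {Ω : Type*} [MeasurableSpace Ω] {ι : Type*} [Fintype ι] [DecidableEq ι]
  [MeasurableSpace ι] [MeasurableSingletonClass ι]

theorem measureReal_eq_sum_inter_fiber (P : Measure Ω) [IsFiniteMeasure P] {c : Ω → ι}
    (hc : Measurable c) {A : Set Ω} (hA : MeasurableSet A) (s : Finset ι) :
    P.real (A ∩ c ⁻¹' s) = ∑ j ∈ s, P.real (A ∩ c ⁻¹' {j}) := by
  have : A ∩ c ⁻¹' s = ⋃ j ∈ s, A ∩ c ⁻¹' {j} := by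
    ext x; simp
  rw [this, measureReal_biUnion_finset]
  · intro i _ j _ hij
    refine Set.disjoint_left.2 fun x hx hx' => hij ?_
    rw [← (hx.2 : c x = i), ← (hx'.2 : c x = j)]
  · exact fun j _ => hA.inter (hc (measurableSet_singleton j))

/-- On the cell `c = j`, the ratio of `P` to `Q` lies between `lo` and `hi`, where `hi - lo` is
small compared with the distance of the ratio to `1`. -/
def RatioPinched (P Q : Measure Ω) (c : Ω → ι) (η δ : ℝ) (j : ι) : Prop :=
  ∃ lo hi : ℝ, 0 ≤ lo ∧ lo ≤ hi ∧ hi - lo ≤ η * (1 - hi) + δ ∧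
    ∀ E, MeasurableSet E → E ⊆ c ⁻¹' {j} → lo * Q.real E ≤ P.real E ∧ P.real E ≤ hi * Q.real E

theorem cond_real_mul {P : Measure Ω} [IsFiniteMeasure P] {B A : Set Ω} (hB : MeasurableSet B) :
    P.real B * (P[|B]).real A = P.real (A ∩ B) := by
  rw [measureReal_def (P[|B]), cond_apply hB, ENNReal.toReal_mul, ENNReal.toReal_inv,
    ← measureReal_def, ← measureReal_def, Set.inter_comm A]
  -- When `B` is null both sides vanish, whatever the conditional measure is.
  by_cases h : P.real B = 0
  · have : P.real (B ∩ A) ≤ 0 := h ▸ measureReal_mono Set.inter_subset_left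
    rw [h, zero_mul, le_antisymm this measureReal_nonneg]
  · field_simp

theorem mixture_real (P : Measure ι) [IsFiniteMeasure P] (K : ι → Measure Ω)
    [∀ j, IsFiniteMeasure (K j)] (A : Set Ω) :
    (mixture (fun j => P {j}) K).real A = ∑ j, P.real {j} * (K j).real A := by
  rw [measureReal_def, mixture_apply, ENNReal.toReal_sum]
  · simp [measureReal_def]
  · exact fun j _ => ENNReal.mul_ne_top (measure_ne_top _ _) (measure_ne_top _ _)

/-- Condition `Q` on the cells in `s` and `P` on the other cells. -/
noncomputable def cellLaw (P Q : Measure Ω) (c : Ω → ι) (s : Finset ι) (j : ι) : Measure Ω :=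
  if j ∈ s then Q[|c ⁻¹' {j}] else P[|c ⁻¹' {j}]

instance isFiniteMeasure_cellLaw (P Q : Measure Ω) [IsProbabilityMeasure P]
    [IsProbabilityMeasure Q] (c : Ω → ι) (s : Finset ι) (j : ι) :
    IsFiniteMeasure (cellLaw P Q c s j) := by
  unfold cellLaw
  split_ifs
  · refine ⟨lt_of_le_of_lt (prob_le_one (μ := Q[|c ⁻¹' {j}])) ENNReal.one_lt_top⟩
  · refine ⟨lt_of_le_of_lt (prob_le_one (μ := P[|c ⁻¹' {j}])) ENNReal.one_lt_top⟩

/-- This symmetry makes the replacements for `P` and for `Q` mixtures of the same kernels, as data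
processing requires. -/
theorem cellLaw_compl (P Q : Measure Ω) (c : Ω → ι) (s : Finset ι) :
    cellLaw Q P c sᶜ = cellLaw P Q c s := by
  funext j
  by_cases h : j ∈ s <;> simp [cellLaw, h]

theorem cellLaw_univ_le (P Q : Measure Ω) [IsProbabilityMeasure P] [IsProbabilityMeasure Q]
    (c : Ω → ι) (s : Finset ι) (j : ι) : cellLaw P Q c s j Set.univ ≤ 1 := by
  unfold cellLaw
  split_ifs <;> exact prob_le_one

/-- Conditioning on a null set gives the zero measure, so mass could be lost on a cell in `s` that
is null for `Q`. The upper bound on the ratio makes such a cell null for `P` too, so its weight is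
zero. -/
theorem isProbabilityMeasure_mixture_cellLaw (P Q : Measure Ω) [IsProbabilityMeasure P]
    [IsProbabilityMeasure Q] {c : Ω → ι} (hc : Measurable c) {s : Finset ι} {η δ : ℝ}
    (h : ∀ j ∈ s, RatioPinched P Q c η δ j) :
    IsProbabilityMeasure (mixture (fun j => P.map c {j}) (cellLaw P Q c s)) := by
  refine ⟨?_⟩
  rw [mixture_apply]
  have hm : ∀ j, MeasurableSet (c ⁻¹' {j}) := fun j => hc (measurableSet_singleton j)
  have e : ∀ j, P.map c {j} * cellLaw P Q c s j Set.univ = P.map c {j} := by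
    intro j
    rw [Measure.map_apply hc (measurableSet_singleton j)]
    by_cases h0 : P (c ⁻¹' {j}) = 0
    · rw [h0, zero_mul]
    have hl : cellLaw P Q c s j Set.univ = 1 := by
      unfold cellLaw
      split_ifs with hj
      · obtain ⟨lo, hi, -, -, -, hE⟩ := h j hj
        have hQ : Q (c ⁻¹' {j}) ≠ 0 := fun hQ => h0 <| by
          have := (hE _ (hm j) subset_rfl).2
          rw [measureReal_def Q, hQ, ENNReal.toReal_zero, mul_zero] at this
          exact (measureReal_eq_zero_iff).1 (le_antisymm this measureReal_nonneg)
        have := cond_isProbabilityMeasure hQ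
        exact measure_univ
      · have := cond_isProbabilityMeasure h0
        exact measure_univ
    rw [hl, mul_one]
  simp_rw [e]
  have := Measure.isProbabilityMeasure_map (μ := P) hc.aemeasurable
  rw [sum_measure_singleton, Finset.coe_univ, measure_univ]

/-- Only cells in `s` contribute. There P(A ∩ cell) ≤ hi·Q(A ∩ cell), while the mixture gives `A` at
least lo·Q(A ∩ cell). The defect is at most (hi - lo)Q(cell) ≤ η(1 - hi)Q(cell) + δQ(cell), and
hi·Q(cell) ≥ P(cell) turns this into η(Q(cell) - P(cell)) + δQ(cell). Summed over `s`, the first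
term is η times a difference of probabilities of one event. -/
theorem tvDist_mixture_cellLaw_le (P Q : Measure Ω) [IsProbabilityMeasure P]
    [IsProbabilityMeasure Q] {c : Ω → ι} (hc : Measurable c) {s : Finset ι} {η δ : ℝ}
    (hη : 0 ≤ η) (hδ : 0 ≤ δ) (h : ∀ j ∈ s, RatioPinched P Q c η δ j) :
    tvDist P (mixture (fun j => P.map c {j}) (cellLaw P Q c s)) ≤ η * tvDist P Q + δ := by
  have := isProbabilityMeasure_mixture_cellLaw P Q hc h
  have := Measure.isProbabilityMeasure_map (μ := P) hc.aemeasurable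
  have hm : ∀ j, MeasurableSet (c ⁻¹' {j}) := fun j => hc (measurableSet_singleton j)
  refine tvDist_le fun A hA => ?_
  have hP := measureReal_eq_sum_inter_fiber P hc hA Finset.univ
  rw [Finset.coe_univ, Set.preimage_univ, Set.inter_univ] at hP
  rw [mixture_real, hP, ← Finset.sum_sub_distrib]
  have cell : ∀ j, P.real (A ∩ c ⁻¹' {j}) - (P.map c).real {j} * (cellLaw P Q c s j).real A ≤
      if j ∈ s then η * (Q.real (c ⁻¹' {j}) - P.real (c ⁻¹' {j})) + δ * Q.real (c ⁻¹' {j})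
        else 0 := by
    intro j
    rw [map_measureReal_apply hc (measurableSet_singleton j), cellLaw]
    split_ifs with hj
    · obtain ⟨lo, hi, h0, hlh, hd, hE⟩ := h j hj
      have e1 := (hE (A ∩ c ⁻¹' {j}) (hA.inter (hm j)) Set.inter_subset_right).2
      have e2 := hE (c ⁻¹' {j}) (hm j) subset_rfl
      have e3 := cond_real_mul (P := Q) (A := A) (hm j)
      have e4 : Q.real (A ∩ c ⁻¹' {j}) ≤ Q.real (c ⁻¹' {j}) :=
        measureReal_mono Set.inter_subset_right
      have e5 : lo * Q.real (A ∩ c ⁻¹' {j}) ≤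
          P.real (c ⁻¹' {j}) * (Q[|c ⁻¹' {j}]).real A := by
        rw [← e3, ← mul_assoc]
        exact mul_le_mul_of_nonneg_right e2.1 measureReal_nonneg
      have e6 : (hi - lo) * Q.real (A ∩ c ⁻¹' {j}) ≤ (hi - lo) * Q.real (c ⁻¹' {j}) :=
        mul_le_mul_of_nonneg_left e4 (sub_nonneg.2 hlh)
      have e7 := mul_le_mul_of_nonneg_right hd (measureReal_nonneg (μ := Q) (s := c ⁻¹' {j}))
      have e8 := mul_le_mul_of_nonneg_left e2.2 hη
      nlinarith
    · rw [cond_real_mul (hm j), sub_self]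
  refine (Finset.sum_le_sum fun j _ => cell j).trans ?_
  rw [← Finset.sum_filter, Finset.filter_mem_eq_inter, Finset.univ_inter, Finset.sum_add_distrib,
    ← Finset.mul_sum, ← Finset.mul_sum, Finset.sum_sub_distrib]
  have f : ∀ R : Measure Ω, IsProbabilityMeasure R →
      ∑ j ∈ s, R.real (c ⁻¹' {j}) = R.real (c ⁻¹' s) := by
    intro R _
    have := measureReal_eq_sum_inter_fiber R hc MeasurableSet.univ s
    simpa using this.symm
  rw [f P inferInstance, f Q inferInstance]
  have hs : MeasurableSet (c ⁻¹' (s : Set ι)) := hc s.measurableSet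
  have g1 := measureReal_sub_le_tvDist Q P hs
  rw [tvDist_comm] at g1
  have g2 := measureReal_le_one (μ := Q) (s := c ⁻¹' (s : Set ι))
  exact add_le_add (mul_le_mul_of_nonneg_left g1 hη) (mul_le_of_le_one_right hδ g2)

/-- Replacing points by their cells loses little total variation when each cell pins down the
likelihood ratio. -/
theorem tvDist_pi_le_tvDist_pi_map_add {n : ℕ} (P Q : Fin n → Measure Ω)
    [∀ i, IsProbabilityMeasure (P i)] [∀ i, IsProbabilityMeasure (Q i)] {c : Fin n → Ω → ι}
    (hc : ∀ i, Measurable (c i)) (s : Fin n → Finset ι) {η δ : ℝ} (hη : 0 ≤ η) (hδ : 0 ≤ δ)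
    (h : ∀ i, ∀ j ∈ s i, RatioPinched (P i) (Q i) (c i) η δ j)
    (h' : ∀ i, ∀ j ∉ s i, RatioPinched (Q i) (P i) (c i) η δ j) :
    tvDist (Measure.pi P) (Measure.pi Q) ≤
      tvDist (Measure.pi fun i => (P i).map (c i)) (Measure.pi fun i => (Q i).map (c i)) +
        2 * n * (η * tvDist (Measure.pi P) (Measure.pi Q) + δ) := by
  have h'' : ∀ i, ∀ j ∈ (s i)ᶜ, RatioPinched (Q i) (P i) (c i) η δ j := fun i j hj =>
    h' i j (Finset.mem_compl.1 hj)
  have iP := fun i => isProbabilityMeasure_mixture_cellLaw (P i) (Q i) (hc i) (h i)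
  have iQ := fun i => isProbabilityMeasure_mixture_cellLaw (Q i) (P i) (hc i) (h'' i)
  have tP := fun i => tvDist_mixture_cellLaw_le (P i) (Q i) (hc i) hη hδ (h i)
  have tQ := fun i => tvDist_mixture_cellLaw_le (Q i) (P i) (hc i) hη hδ (h'' i)
  simp_rw [cellLaw_compl] at iQ tQ
  have mP := fun i => Measure.isProbabilityMeasure_map (μ := P i) (hc i).aemeasurable
  have mQ := fun i => Measure.isProbabilityMeasure_map (μ := Q i) (hc i).aemeasurable
  -- The two mixtures share their kernels, so their distance is at most that of the tables. What
  -- remains are n coordinate errors on each side, with each coordinate distance bounded by the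
  -- distance of the products.
  have main := tvDist_pi_mixture_le (fun i => (P i).map (c i)) (fun i => (Q i).map (c i))
    (fun i => cellLaw (P i) (Q i) (c i) (s i)) fun i j => cellLaw_univ_le _ _ _ _ _
  have b : ∀ i, tvDist (P i) (Q i) ≤ tvDist (Measure.pi P) (Measure.pi Q) :=
    fun i => tvDist_le_tvDist_pi P Q i
  have sP := (tvDist_pi_le P
    fun i => mixture (fun j => (P i).map (c i) {j}) (cellLaw (P i) (Q i) (c i) (s i))).trans
    (Finset.sum_le_card_nsmul Finset.univ _ (η * tvDist (Measure.pi P) (Measure.pi Q) + δ)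
      fun i _ => (tP i).trans (add_le_add (mul_le_mul_of_nonneg_left (b i) hη) le_rfl))
  have sQ := (tvDist_pi_le Q
    fun i => mixture (fun j => (Q i).map (c i) {j}) (cellLaw (P i) (Q i) (c i) (s i))).trans
    (Finset.sum_le_card_nsmul Finset.univ _ (η * tvDist (Measure.pi P) (Measure.pi Q) + δ)
      fun i _ => (tQ i).trans (add_le_add (mul_le_mul_of_nonneg_left
        ((tvDist_comm _ _).trans_le (b i)) hη) le_rfl))
  simp only [Finset.card_univ, Fintype.card_fin, nsmul_eq_mul] at sP sQ
  have t1 := tvDist_triangle (Measure.pi P) (Measure.pi fun i =>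
    mixture (fun j => (P i).map (c i) {j}) (cellLaw (P i) (Q i) (c i) (s i))) (Measure.pi Q)
  have t2 := tvDist_triangle (Measure.pi fun i =>
    mixture (fun j => (P i).map (c i) {j}) (cellLaw (P i) (Q i) (c i) (s i))) (Measure.pi fun i =>
    mixture (fun j => (Q i).map (c i) {j}) (cellLaw (P i) (Q i) (c i) (s i))) (Measure.pi Q)
  rw [tvDist_comm (Measure.pi Q)] at sQ
  linarith

theorem tvDist_pi_map_le {n : ℕ} (P Q : Fin n → Measure Ω)
    [∀ i, IsProbabilityMeasure (P i)] [∀ i, IsProbabilityMeasure (Q i)] {c : Fin n → Ω → ι}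
    (hc : ∀ i, Measurable (c i)) :
    tvDist (Measure.pi fun i => (P i).map (c i)) (Measure.pi fun i => (Q i).map (c i)) ≤
      tvDist (Measure.pi P) (Measure.pi Q) := by
  have mP := fun i => Measure.isProbabilityMeasure_map (μ := P i) (hc i).aemeasurable
  have mQ := fun i => Measure.isProbabilityMeasure_map (μ := Q i) (hc i).aemeasurable
  rw [← Measure.pi_map_pi fun i => (hc i).aemeasurable,
    ← Measure.pi_map_pi fun i => (hc i).aemeasurable]
  exact tvDist_map_le _ _ (measurable_pi_lambda _ fun i => (hc i).comp (measurable_pi_apply i))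

end Discretization

/-! ### Gaussian laws: reduction to products and a computable proxy for the distance. -/

section Gaussian

/-- For a diagonal covariance the characteristic function factors over the coordinates. -/
theorem multivariateGaussian_diagonal {n : ℕ} (μ : EuclideanSpace ℝ (Fin n)) {d : Fin n → ℝ}
    (hd : ∀ i, 0 < d i) :
    multivariateGaussian μ (Matrix.diagonal d) =
      (Measure.pi fun i => gaussianReal (μ i) (d i).toNNReal).map
        (MeasurableEquiv.toLp 2 (Fin n → ℝ)) := by
  have := Measure.isProbabilityMeasure_map
    (μ := Measure.pi fun i => gaussianReal (μ i) (d i).toNNReal)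
    (MeasurableEquiv.toLp 2 (Fin n → ℝ)).measurable.aemeasurable
  refine Measure.ext_of_charFun ?_
  funext t
  rw [charFun_multivariateGaussian (Matrix.posSemidef_diagonal_iff.2 fun i => (hd i).le),
    MeasurableEquiv.coe_toLp, charFun_pi]
  simp_rw [charFun_gaussianReal, ← Complex.exp_sum]
  congr 1
  simp only [PiLp.inner_apply, dotProduct, Matrix.mulVec_diagonal]
  push_cast
  rw [Finset.sum_mul, Finset.sum_div, ← Finset.sum_sub_distrib]
  refine Finset.sum_congr rfl fun i _ => ?_
  rw [Real.coe_toNNReal _ (hd i).le]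
  simp
  ring

theorem tvDist_multivariateGaussian {n : ℕ} (μ : EuclideanSpace ℝ (Fin n)) {d : Fin n → ℝ}
    (hd : ∀ i, 0 < d i) :
    tvDist (multivariateGaussian μ (Matrix.diagonal d))
        (multivariateGaussian 0 (1 : Matrix (Fin n) (Fin n) ℝ)) =
      tvDist (Measure.pi fun i => gaussianReal (μ i) (d i).toNNReal)
        (Measure.pi fun _ : Fin n => gaussianReal 0 1) := by
  have h1 : (1 : Matrix (Fin n) (Fin n) ℝ) = Matrix.diagonal fun _ => 1 := Matrix.diagonal_one.symm
  rw [h1, multivariateGaussian_diagonal μ hd, multivariateGaussian_diagonal 0 fun _ => one_pos,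
    tvDist_map_equiv]
  simp

/-- The constant is the minimum over x of the wider density divided by the narrower one. Completing
the square, the exponents differ from it by a perfect square with positive coefficient. -/
theorem gaussianPDFReal_le_mul {m₁ m₂ v₁ v₂ : ℝ} (h1 : 0 < v₁) (h12 : v₁ < v₂) (x : ℝ) :
    (√(v₁ / v₂) * Real.exp (-((m₁ - m₂) ^ 2 / (2 * (v₂ - v₁))))) *
      gaussianPDFReal m₁ v₁.toNNReal x ≤ gaussianPDFReal m₂ v₂.toNNReal x := by
  have h2 : 0 < v₂ := h1.trans h12
  have h3 : 0 < v₂ - v₁ := sub_pos.2 h12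
  rw [gaussianPDFReal, gaussianPDFReal, Real.coe_toNNReal _ h1.le, Real.coe_toNNReal _ h2.le]
  have e : √(v₁ / v₂) * (√(2 * Real.pi * v₁))⁻¹ = (√(2 * Real.pi * v₂))⁻¹ := by
    rw [← Real.sqrt_inv, ← Real.sqrt_inv, ← Real.sqrt_mul (by positivity)]
    congr 1
    field_simp
  calc _ = (√(v₁ / v₂) * (√(2 * Real.pi * v₁))⁻¹) *
        Real.exp (-((m₁ - m₂) ^ 2 / (2 * (v₂ - v₁))) + -(x - m₁) ^ 2 / (2 * v₁)) := by
        rw [Real.exp_add]; ring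
    _ ≤ _ := by
      rw [e]
      refine mul_le_mul_of_nonneg_left (Real.exp_le_exp.2 ?_) (by positivity)
      rw [← sub_nonneg]
      have : -(x - m₂) ^ 2 / (2 * v₂) - (-((m₁ - m₂) ^ 2 / (2 * (v₂ - v₁))) +
          -(x - m₁) ^ 2 / (2 * v₁)) =
          ((m₁ - m₂) * v₁ - (x - m₁) * (v₂ - v₁)) ^ 2 / (2 * v₁ * v₂ * (v₂ - v₁)) := by
        field_simp
        ring
      rw [this]
      positivity

theorem measureReal_gaussianReal {m v : ℝ} (hv : 0 < v) {A : Set ℝ} :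
    (gaussianReal m v.toNNReal).real A = ∫ x in A, gaussianPDFReal m v.toNNReal x := by
  rw [measureReal_def, gaussianReal_apply_eq_integral _ (by simpa using hv),
    ENNReal.toReal_ofReal]
  exact integral_nonneg fun x => gaussianPDFReal_nonneg _ _ _

theorem mul_measureReal_gaussianReal_le {m₁ m₂ v₁ v₂ a : ℝ} (h1 : 0 < v₁) (h2 : 0 < v₂)
    {A : Set ℝ} (hA : MeasurableSet A)
    (h : ∀ x ∈ A, a * gaussianPDFReal m₁ v₁.toNNReal x ≤ gaussianPDFReal m₂ v₂.toNNReal x) :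
    a * (gaussianReal m₁ v₁.toNNReal).real A ≤ (gaussianReal m₂ v₂.toNNReal).real A := by
  rw [measureReal_gaussianReal h1, measureReal_gaussianReal h2, ← integral_const_mul]
  exact setIntegral_mono_on ((integrable_gaussianPDFReal _ _).const_mul _).integrableOn
    (integrable_gaussianPDFReal _ _).integrableOn hA h

/-- If `Q ≥ c P` then P(A) - Q(A) ≤ (1 - c)P(A) ≤ 1 - c. -/
theorem tvDist_gaussianReal_le {m₁ m₂ v₁ v₂ : ℝ} (h1 : 0 < v₁) (h12 : v₁ < v₂) :
    tvDist (gaussianReal m₁ v₁.toNNReal) (gaussianReal m₂ v₂.toNNReal) ≤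
      1 - √(v₁ / v₂) * Real.exp (-((m₁ - m₂) ^ 2 / (2 * (v₂ - v₁)))) := by
  refine tvDist_le fun A hA => ?_
  have h := mul_measureReal_gaussianReal_le h1 (h1.trans h12) hA
    fun x _ => gaussianPDFReal_le_mul (m₁ := m₁) (m₂ := m₂) h1 h12 x
  set c := √(v₁ / v₂) * Real.exp (-((m₁ - m₂) ^ 2 / (2 * (v₂ - v₁))))
  have hc : c ≤ 1 := by
    refine mul_le_one₀ (Real.sqrt_le_one.2 ?_) (Real.exp_pos _).le (Real.exp_le_one_iff.2 ?_)
    · exact (div_le_one (h1.trans h12)).2 h12.le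
    · have := sub_pos.2 h12
      exact neg_nonpos.2 (by positivity)
  have h3 := measureReal_le_one (μ := gaussianReal m₁ v₁.toNNReal) (s := A)
  nlinarith

theorem tvDist_gaussianReal_same_mean_le {m v₁ v₂ : ℝ} (h1 : 0 < v₁) (h12 : v₁ ≤ v₂) :
    tvDist (gaussianReal m v₁.toNNReal) (gaussianReal m v₂.toNNReal) ≤ 1 - v₁ / v₂ := by
  rcases h12.eq_or_lt with rfl | h12
  · rw [tvDist_self, div_self h1.ne', sub_self]
  have h := tvDist_gaussianReal_le (m₁ := m) (m₂ := m) h1 h12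
  have h2 : 0 < v₂ := h1.trans h12
  simp only [sub_self, ne_eq, OfNat.ofNat_ne_zero, not_false_eq_true, zero_pow, zero_div, neg_zero,
    Real.exp_zero, mul_one] at h
  have : v₁ / v₂ ≤ √(v₁ / v₂) := Real.le_sqrt_of_sq_le (by
    have : v₁ / v₂ ≤ 1 := (div_le_one h2).2 h12.le
    have : 0 ≤ v₁ / v₂ := by positivity
    nlinarith)
  linarith

/-- For equal variances the previous bound is not available, so the comparison passes through N(0, 1
+ |m|). The variance gap |m| balances the two costs: the exponent m²/(2|m|) and the change of
variance are both linear in |m|. -/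
theorem tvDist_gaussianReal_shift_le (m : ℝ) :
    tvDist (gaussianReal m (1 : ℝ).toNNReal) (gaussianReal 0 (1 : ℝ).toNNReal) ≤ 2 * |m| := by
  rcases eq_or_ne m 0 with rfl | hm
  · rw [tvDist_self]; simp
  have ha : 0 < |m| := abs_pos.2 hm
  have h1 := tvDist_gaussianReal_le (m₁ := m) (m₂ := 0) one_pos (lt_add_of_pos_right 1 ha)
  have h2 := tvDist_gaussianReal_same_mean_le (m := 0) one_pos (le_add_of_nonneg_right (a := 1) ha.le)
  have h3 := tvDist_triangle (gaussianReal m (1 : ℝ).toNNReal)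
    (gaussianReal 0 (1 + |m|).toNNReal) (gaussianReal 0 (1 : ℝ).toNNReal)
  rw [tvDist_comm (gaussianReal 0 (1 + |m|).toNNReal)] at h3
  have e1 : (m - 0) ^ 2 / (2 * (1 + |m| - 1)) = |m| / 2 := by
    rw [sub_zero, add_sub_cancel_left, ← sq_abs]
    field_simp
  have e2 : 1 - 1 / (1 + |m|) ≤ |m| := by
    rw [one_sub_div (by positivity), div_le_iff₀ (by positivity)]
    nlinarith
  have e3 : 1 - |m| / 2 ≤ √(1 / (1 + |m|)) := by
    by_cases hl : 1 - |m| / 2 ≤ 0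
    · exact hl.trans (Real.sqrt_nonneg _)
    push Not at hl
    refine Real.le_sqrt_of_sq_le ?_
    rw [le_div_iff₀ (by positivity)]
    nlinarith [sq_nonneg (|m|), mul_pos ha ha, mul_pos ha hl]
  have e4 : 1 - |m| / 2 ≤ Real.exp (-(|m| / 2)) := by
    have := Real.add_one_le_exp (-(|m| / 2))
    linarith
  have e5 : √(1 / (1 + |m|)) ≤ 1 := Real.sqrt_le_one.2
    ((div_le_one (by positivity)).2 (by linarith))
  have e6 : Real.exp (-(|m| / 2)) ≤ 1 := Real.exp_le_one_iff.2 (by linarith)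
  rw [e1] at h1
  nlinarith [mul_nonneg (sub_nonneg.2 e5) (sub_nonneg.2 e6)]

theorem tvDist_gaussianReal_std_le {m v : ℝ} (hv : 0 < v) :
    tvDist (gaussianReal m v.toNNReal) (gaussianReal 0 (1 : ℝ).toNNReal) ≤
      |1 - v| + 2 * |m| := by
  refine (tvDist_triangle _ (gaussianReal m (1 : ℝ).toNNReal) _).trans
    (add_le_add ?_ (tvDist_gaussianReal_shift_le m))
  rcases le_total v 1 with h | h
  · refine (tvDist_gaussianReal_same_mean_le hv h).trans ?_
    rw [div_one]
    exact le_abs_self _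
  · rw [tvDist_comm]
    refine (tvDist_gaussianReal_same_mean_le one_pos h).trans ?_
    rw [abs_sub_comm, one_sub_div hv.ne', div_le_iff₀ hv]
    nlinarith [le_abs_self (v - 1), abs_nonneg (v - 1)]

/-- A rational proxy for the squared distance of `N(m, v)` from `N(0, 1)`. -/
noncomputable def gaussGap (m v : ℝ) : ℝ := m ^ 2 / (v + m ^ 2) + ((v - 1) / (v + 1)) ^ 2

/-- If the gap is at least 1/9 the trivial bound 1 suffices. Otherwise v ≤ 2 and m² ≤ v, so the
denominators in `gaussGap` are bounded, and the bound |1 - v| + 2|m| can be squared. -/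
theorem sq_tvDist_gaussianReal_std_le {m v : ℝ} (hv : 0 < v) :
    tvDist (gaussianReal m v.toNNReal) (gaussianReal 0 (1 : ℝ).toNNReal) ^ 2 ≤
      49 * gaussGap m v := by
  have h0 := tvDist_nonneg (gaussianReal m v.toNNReal) (gaussianReal 0 (1 : ℝ).toNNReal)
  have h1 := tvDist_le_one (gaussianReal m v.toNNReal) (gaussianReal 0 (1 : ℝ).toNNReal)
  have h2 := tvDist_gaussianReal_std_le (m := m) hv
  have a0 : 0 ≤ m ^ 2 / (v + m ^ 2) := by positivity
  have b0 : 0 ≤ ((v - 1) / (v + 1)) ^ 2 := by positivity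
  by_cases hg : 1 / 9 ≤ gaussGap m v
  · nlinarith
  push Not at hg
  unfold gaussGap at *
  set D := tvDist (gaussianReal m v.toNNReal) (gaussianReal 0 (1 : ℝ).toNNReal)
  have hb : ((v - 1) / (v + 1)) ^ 2 ≤ (1 / 3) ^ 2 := by linarith
  have hb' := abs_le_of_sq_le_sq' hb (by norm_num)
  have hv2 : v ≤ 2 := by
    have := hb'.2
    rw [div_le_iff₀ (by positivity)] at this
    linarith
  have c1 : (1 - v) ^ 2 ≤ 9 * ((v - 1) / (v + 1)) ^ 2 := by
    rw [div_pow, ← mul_div_assoc, le_div_iff₀ (by positivity)]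
    have : (v + 1) ^ 2 ≤ 9 := by nlinarith
    nlinarith [sq_nonneg (1 - v)]
  have c2 : m ^ 2 ≤ 4 * (m ^ 2 / (v + m ^ 2)) := by
    have : m ^ 2 / (v + m ^ 2) ≤ 1 / 2 := by linarith
    rw [div_le_iff₀ (by positivity)] at this
    rw [← mul_div_assoc, le_div_iff₀ (by positivity)]
    nlinarith [sq_nonneg m]
  rw [← sq_abs] at c1 c2
  have : D ^ 2 ≤ (|1 - v| + 2 * |m|) ^ 2 := by
    exact pow_le_pow_left₀ h0 h2 2
  rw [sq_abs m] at c2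
  nlinarith [sq_nonneg (2 * |1 - v| - 3 / 2 * |m|), sq_abs m, sq_abs (1 - v)]

theorem map_std_gaussianReal {m v : ℝ} (hv : 0 ≤ v) :
    (gaussianReal 0 (1 : ℝ).toNNReal).map (fun z => m + √v * z) = gaussianReal m v.toNNReal := by
  have : (fun z => m + √v * z) = (fun z => m + z) ∘ (fun z => √v * z) := rfl
  rw [this, ← Measure.map_map (by fun_prop) (by fun_prop), gaussianReal_map_const_mul,
    gaussianReal_map_const_add]
  congr 1
  · simp
  · ext
    simp [Real.sq_sqrt hv, Real.coe_toNNReal _ hv]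

/-- The standard normal distribution function. -/
noncomputable def stdCdf (y : ℝ) : ℝ := (gaussianReal 0 (1 : ℝ).toNNReal).real (Set.Iic y)

theorem stdCdf_mono : Monotone stdCdf := fun _ _ h => measureReal_mono (Set.Iic_subset_Iic.2 h)

theorem gaussianReal_real_Iic {m v : ℝ} (hv : 0 < v) (y : ℝ) :
    (gaussianReal m v.toNNReal).real (Set.Iic y) = stdCdf ((y - m) / √v) := by
  rw [← map_std_gaussianReal hv.le, map_measureReal_apply (by fun_prop) measurableSet_Iic, stdCdf]
  congr 1
  ext z
  rw [Set.mem_preimage, Set.mem_Iic, Set.mem_Iic, le_div_iff₀ (Real.sqrt_pos.2 hv)]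
  constructor <;> intro h <;> linarith

/-- On [-1, 1] the standard density is at least exp(-1/2)/√(2π) > 1/5. -/
theorem div_five_le_stdCdf_sub {a b : ℝ} (ha : -1 ≤ a) (hab : a ≤ b) (hb : b ≤ 1) :
    (b - a) / 5 ≤ stdCdf b - stdCdf a := by
  have e : stdCdf b - stdCdf a = (gaussianReal 0 (1 : ℝ).toNNReal).real (Set.Ioc a b) := by
    have h : Set.Ioc a b = Set.Iic b \ Set.Iic a := by
      ext
      simp [and_comm]
    rw [stdCdf, stdCdf, h, measureReal_sdiff (Set.Iic_subset_Iic.2 hab)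
      measurableSet_Iic]
  rw [e, measureReal_gaussianReal one_pos]
  have low : ∀ x ∈ Set.Ioc a b, (1 / 5 : ℝ) ≤ gaussianPDFReal 0 (1 : ℝ).toNNReal x := by
    intro x hx
    rw [gaussianPDFReal, Real.coe_toNNReal _ zero_le_one]
    have h1 : √(2 * Real.pi * 1) ≤ 2.55 := by
      refine Real.sqrt_le_iff.2 ⟨by norm_num, ?_⟩
      have := Real.pi_lt_d2
      norm_num at this ⊢
      linarith
    have h2 : (1 / 1.7 : ℝ) ≤ Real.exp (-(1 / 2)) := by
      rw [Real.exp_neg, ← one_div]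
      refine one_div_le_one_div_of_le (Real.exp_pos _) ?_
      have h3 : Real.exp (1 / 2) ^ 2 ≤ 1.7 ^ 2 := by
        rw [← Real.exp_nat_mul]
        have := Real.exp_one_lt_d9
        norm_num at this ⊢
        linarith
      exact le_of_sq_le_sq h3 (by norm_num)
    have h4 : Real.exp (-(1 / 2)) ≤ Real.exp (-(x - 0) ^ 2 / (2 * 1)) := by
      refine Real.exp_le_exp.2 ?_
      nlinarith [hx.1, hx.2]
    have h5 : (1 / 2.55 : ℝ) ≤ (√(2 * Real.pi * 1))⁻¹ := by
      rw [← one_div]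
      exact one_div_le_one_div_of_le (by positivity) h1
    calc (1 / 5 : ℝ) ≤ 1 / 2.55 * (1 / 1.7) := by norm_num
      _ ≤ _ := mul_le_mul h5 (h2.trans h4) (by norm_num) (by positivity)
  calc (b - a) / 5 = ∫ _ in Set.Ioc a b, (1 / 5 : ℝ) := by
        rw [setIntegral_const, Real.volume_real_Ioc_of_le hab, smul_eq_mul]; ring
    _ ≤ _ := setIntegral_mono_on (integrable_const _)
        (integrable_gaussianPDFReal _ _).integrableOn measurableSet_Ioc low

theorem abs_stdCdf_sub_le_tvDist {m v : ℝ} (hv : 0 < v) (y : ℝ) :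
    |stdCdf ((y - m) / √v) - stdCdf y| ≤
      tvDist (gaussianReal m v.toNNReal) (gaussianReal 0 (1 : ℝ).toNNReal) := by
  have := abs_measureReal_sub_le_tvDist (gaussianReal m v.toNNReal)
    (gaussianReal 0 (1 : ℝ).toNNReal) (measurableSet_Iic (a := y))
  rwa [gaussianReal_real_Iic hv] at this

/-- Test with the half-line ending at 0. With t = -m/√v the gap is t²/(1 + t²) ≤ min(1, |t|), and
the distribution function moves by at least min(1, |t|)/5 between 0 and t. -/
theorem mean_gap_le_tvDist {m v : ℝ} (hv : 0 < v) :
    m ^ 2 / (v + m ^ 2) ≤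
      5 * tvDist (gaussianReal m v.toNNReal) (gaussianReal 0 (1 : ℝ).toNNReal) := by
  have h := abs_stdCdf_sub_le_tvDist (m := m) hv 0
  have hs : 0 < √v := Real.sqrt_pos.2 hv
  set t := (0 - m) / √v with ht
  have e : m ^ 2 / (v + m ^ 2) = t ^ 2 / (1 + t ^ 2) := by
    rw [ht, div_pow, Real.sq_sqrt hv.le]
    field_simp
    ring
  have hb : t ^ 2 / (1 + t ^ 2) ≤ min 1 |t| := by
    rw [div_le_iff₀ (by positivity)]
    rcases le_total 1 |t| with h1 | h1
    · rw [min_eq_left h1]; linarith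
    · rw [min_eq_right h1, ← sq_abs]
      nlinarith [abs_nonneg t, mul_nonneg (abs_nonneg t) (sq_nonneg (|t|))]
  have hm : min 1 |t| / 5 ≤ |stdCdf t - stdCdf 0| := by
    rcases le_total 0 t with h0 | h0
    · rw [abs_of_nonneg h0, abs_of_nonneg (sub_nonneg.2 (stdCdf_mono h0))]
      have h1 := div_five_le_stdCdf_sub (a := 0) (b := min 1 t) (by norm_num)
        (le_min zero_le_one h0) (min_le_left _ _)
      have h2 := stdCdf_mono (min_le_right 1 t)
      rw [sub_zero] at h1
      linarith
    · rw [abs_of_nonpos h0, abs_of_nonpos (sub_nonpos.2 (stdCdf_mono h0))]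
      have h1 := div_five_le_stdCdf_sub (a := -min 1 (-t)) (b := 0)
        (neg_le_neg (min_le_left _ _)) (neg_nonpos.2 (le_min zero_le_one (neg_nonneg.2 h0)))
        zero_le_one
      have h2 : stdCdf t ≤ stdCdf (-min 1 (-t)) :=
        stdCdf_mono (by linarith [min_le_right 1 (-t)])
      linarith
  rw [e]
  linarith

/-- Test with a half-line ending one standard deviation of the narrower law from its mean: at m ± σ
if σ ≤ 1, at ±1 otherwise. The sign is chosen by the sign of m so that the shift of the mean can
only increase the difference. -/
theorem variance_gap_le_tvDist {m v : ℝ} (hv : 0 < v) :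
    ((v - 1) / (v + 1)) ^ 2 ≤
      10 * tvDist (gaussianReal m v.toNNReal) (gaussianReal 0 (1 : ℝ).toNNReal) := by
  have H := fun y => (abs_le.1 (abs_stdCdf_sub_le_tvDist (m := m) hv y))
  have hs : 0 < √v := Real.sqrt_pos.2 hv
  have hsq : √v ^ 2 = v := Real.sq_sqrt hv.le
  set D := tvDist (gaussianReal m v.toNNReal) (gaussianReal 0 (1 : ℝ).toNNReal)
  set σ := √v
  rw [div_pow, div_le_iff₀ (by positivity)]
  rcases le_total σ 1 with h1 | h1
  · have key : (1 - σ) / 5 ≤ D := by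
      rcases le_total m 0 with hm | hm
      · have h2 := (H (m + σ)).2
        rw [add_sub_cancel_left, div_self hs.ne'] at h2
        have h3 := div_five_le_stdCdf_sub (a := σ) (b := 1) (by linarith) h1 le_rfl
        have h4 : stdCdf (m + σ) ≤ stdCdf σ := stdCdf_mono (by linarith)
        linarith
      · have h2 := (H (m - σ)).1
        rw [show (m - σ - m) / σ = -1 by field_simp; ring] at h2
        have h3 := div_five_le_stdCdf_sub (a := -1) (b := -σ) le_rfl (by linarith) (by linarith)
        have h4 : stdCdf (-σ) ≤ stdCdf (m - σ) := stdCdf_mono (by linarith)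
        linarith
    have hv1 : v ≤ 1 := by nlinarith
    have h5 : (1 - v) / 10 ≤ D := by nlinarith
    nlinarith [mul_nonneg hv.le (sub_nonneg.2 hv1)]
  · have hi : 1 / σ ≤ 1 := (div_le_one hs).2 h1
    have hi0 : 0 < 1 / σ := by positivity
    have key : (1 - 1 / σ) / 5 ≤ D := by
      rcases le_total 0 m with hm | hm
      · have h2 := (H 1).1
        have h3 := div_five_le_stdCdf_sub (a := 1 / σ) (b := 1) (by linarith) hi le_rfl
        have h4 : stdCdf ((1 - m) / σ) ≤ stdCdf (1 / σ) :=
          stdCdf_mono (div_le_div_of_nonneg_right (by linarith) hs.le)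
        linarith
      · have h2 := (H (-1)).2
        have h3 := div_five_le_stdCdf_sub (a := -1) (b := -(1 / σ)) le_rfl (by linarith)
          (by linarith)
        have h4 : stdCdf (-(1 / σ)) ≤ stdCdf ((-1 - m) / σ) := by
          refine stdCdf_mono ?_
          rw [← neg_div]
          exact div_le_div_of_nonneg_right (by linarith) hs.le
        linarith
    have hv1 : 1 ≤ v := by nlinarith
    have h5 : (v - 1) / v / 10 ≤ D := by
      have : (v - 1) / v = (1 - 1 / σ) * (1 + 1 / σ) := by
        rw [← hsq]; field_simp; ring
      rw [this]
      nlinarith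
    rw [div_div, div_le_iff₀ (by positivity)] at h5
    have hD : 0 ≤ D := tvDist_nonneg _ _
    nlinarith [mul_nonneg hD hv.le]

/-- Together with `sq_tvDist_gaussianReal_std_le` this confines the distance between the gap and its
square root, up to constants. The loss of a square is harmless, as the tolerance affects the cost
only through its logarithm. -/
theorem gaussGap_le_tvDist {m v : ℝ} (hv : 0 < v) :
    gaussGap m v ≤
      15 * tvDist (gaussianReal m v.toNNReal) (gaussianReal 0 (1 : ℝ).toNNReal) := by
  have h1 := mean_gap_le_tvDist (m := m) hv
  have h2 := variance_gap_le_tvDist (m := m) hv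
  unfold gaussGap
  linarith

end Gaussian

/-! ### Geometric levels of the log-likelihood ratio. -/

section Levels

/-- The logarithm of the density of `N(m, v)` with respect to `N(0, 1)`. -/
noncomputable def logRatio (m v x : ℝ) : ℝ := x ^ 2 / 2 - (x - m) ^ 2 / (2 * v) - Real.log v / 2

theorem measurable_logRatio (m v : ℝ) : Measurable (logRatio m v) := by
  unfold logRatio
  fun_prop

theorem gaussianPDFReal_eq_exp_logRatio_mul {m v : ℝ} (hv : 0 < v) (x : ℝ) :
    gaussianPDFReal m v.toNNReal x =
      Real.exp (logRatio m v x) * gaussianPDFReal 0 (1 : ℝ).toNNReal x := by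
  rw [gaussianPDFReal, gaussianPDFReal, Real.coe_toNNReal _ hv.le, Real.coe_toNNReal _ zero_le_one,
    logRatio]
  have h1 : √(2 * Real.pi * v) = √(2 * Real.pi * 1) * √v := by
    rw [mul_one, Real.sqrt_mul (by positivity)]
  have h2 : (√v)⁻¹ = Real.exp (-(Real.log v / 2)) := by
    rw [Real.exp_neg, Real.sqrt_eq_rpow, Real.rpow_def_of_pos hv]
    congr 2
    ring
  rw [h1, mul_inv, h2, mul_left_comm, mul_assoc, ← Real.exp_add, mul_assoc, ← Real.exp_add]
  congr 2
  ring

/-- `Z` is the logarithm of the density of `P` with respect to `Q`, in the form of bounds. -/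
def IsLogRatio {Ω : Type*} [MeasurableSpace Ω] (P Q : Measure Ω) (Z : Ω → ℝ) : Prop :=
  ∀ E, MeasurableSet E → ∀ t : ℝ,
    ((∀ x ∈ E, Z x ≤ t) → P.real E ≤ Real.exp t * Q.real E) ∧
    ((∀ x ∈ E, t ≤ Z x) → Real.exp t * Q.real E ≤ P.real E)

theorem IsLogRatio.symm {Ω : Type*} [MeasurableSpace Ω] {P Q : Measure Ω} {Z : Ω → ℝ}
    (h : IsLogRatio P Q Z) : IsLogRatio Q P (fun x => -Z x) := by
  intro E hE t
  have e : Real.exp t * Real.exp (-t) = 1 := by rw [← Real.exp_add, add_neg_cancel, Real.exp_zero]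
  refine ⟨fun hx => ?_, fun hx => ?_⟩
  · have := mul_le_mul_of_nonneg_left ((h E hE (-t)).2 fun x hxE => by linarith [hx x hxE])
      (Real.exp_pos t).le
    rwa [← mul_assoc, e, one_mul] at this
  · have := mul_le_mul_of_nonneg_left ((h E hE (-t)).1 fun x hxE => by linarith [hx x hxE])
      (Real.exp_pos t).le
    rwa [← mul_assoc, e, one_mul] at this

theorem isLogRatio_gaussianReal {m v : ℝ} (hv : 0 < v) :
    IsLogRatio (gaussianReal m v.toNNReal) (gaussianReal 0 (1 : ℝ).toNNReal) (logRatio m v) := by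
  intro E hE t
  refine ⟨fun hx => ?_, fun hx => ?_⟩
  · have h := mul_measureReal_gaussianReal_le (a := Real.exp (-t)) (m₁ := m) (m₂ := 0) hv one_pos hE
      fun x hxE => by
        rw [gaussianPDFReal_eq_exp_logRatio_mul hv, ← mul_assoc, ← Real.exp_add]
        exact mul_le_of_le_one_left (gaussianPDFReal_nonneg _ _ _)
          (Real.exp_le_one_iff.2 (by linarith [hx x hxE]))
    rw [Real.exp_neg, inv_mul_le_iff₀ (Real.exp_pos t)] at h
    exact h
  · exact mul_measureReal_gaussianReal_le one_pos hv hE fun x hxE => by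
      rw [gaussianPDFReal_eq_exp_logRatio_mul hv]
      exact mul_le_mul_of_nonneg_right (Real.exp_le_exp.2 (hx x hxE))
        (gaussianPDFReal_nonneg _ _ _)

section Pinched

variable {Ω ι : Type*} [MeasurableSpace Ω] {P Q : Measure Ω} {Z : Ω → ℝ} {c : Ω → ι} {η δ a : ℝ}
  {j : ι}

/-- Here hi - lo = e^(-a)(1 - e^(-aη)) ≤ η·a·e^(-a), and a·e^(-a) ≤ 1 - e^(-a) because 1 + a ≤ e^a.
-/
theorem IsLogRatio.pinched_band (h : IsLogRatio P Q Z) (hη : 0 ≤ η) (hδ : 0 ≤ δ) (ha : 0 ≤ a)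
    (hc : ∀ x, c x = j → -(a * (1 + η)) ≤ Z x ∧ Z x ≤ -a) : RatioPinched P Q c η δ j := by
  refine ⟨Real.exp (-(a * (1 + η))), Real.exp (-a), (Real.exp_pos _).le,
    Real.exp_le_exp.2 (by nlinarith), ?_, fun E hE hEc =>
    ⟨(h E hE _).2 fun x hx => (hc x (hEc hx)).1, (h E hE _).1 fun x hx => (hc x (hEc hx)).2⟩⟩
  have e : Real.exp (-(a * (1 + η))) = Real.exp (-a) * Real.exp (-(a * η)) := by
    rw [← Real.exp_add]; congr 1; ring
  have h1 := Real.add_one_le_exp (-(a * η))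
  have h2 : Real.exp (-a) * (a + 1) ≤ 1 := by
    calc Real.exp (-a) * (a + 1) ≤ Real.exp (-a) * Real.exp a :=
          mul_le_mul_of_nonneg_left (Real.add_one_le_exp a) (Real.exp_pos _).le
      _ = 1 := by rw [← Real.exp_add, neg_add_cancel, Real.exp_zero]
  rw [e]
  nlinarith [mul_le_mul_of_nonneg_left h1 (Real.exp_pos (-a)).le,
    mul_le_mul_of_nonneg_left h2 hη]

/-- Take lo = 0. Multiplying e^(-1/η)(1/η + 1) ≤ 1 by η gives hi ≤ η(1 - hi); this is why 1/η can be
the outermost level. -/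
theorem IsLogRatio.pinched_tail (h : IsLogRatio P Q Z) (hη : 0 < η) (hδ : 0 ≤ δ)
    (hc : ∀ x, c x = j → Z x ≤ -(1 / η)) : RatioPinched P Q c η δ j := by
  refine ⟨0, Real.exp (-(1 / η)), le_rfl, (Real.exp_pos _).le, ?_, fun E hE hEc =>
    ⟨by rw [zero_mul]; exact measureReal_nonneg, (h E hE _).1 fun x hx => hc x (hEc hx)⟩⟩
  have h2 : Real.exp (-(1 / η)) * (1 / η + 1) ≤ 1 := by
    calc Real.exp (-(1 / η)) * (1 / η + 1) ≤ Real.exp (-(1 / η)) * Real.exp (1 / η) :=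
          mul_le_mul_of_nonneg_left (Real.add_one_le_exp _) (Real.exp_pos _).le
      _ = 1 := by rw [← Real.exp_add, neg_add_cancel, Real.exp_zero]
  have h3 := mul_le_mul_of_nonneg_left h2 hη.le
  have h4 : η * (Real.exp (-(1 / η)) * (1 / η + 1)) =
      Real.exp (-(1 / η)) + η * Real.exp (-(1 / η)) := by
    field_simp
  linarith

/-- The ratio may exceed 1 here, so η(1 - hi) is no help and can even be negative. With η ≤ 1
everything is bounded by 3a + 2a², which 10δ absorbs. -/
theorem IsLogRatio.pinched_middle (h : IsLogRatio P Q Z) (hη1 : η ≤ 1)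
    (ha : 0 ≤ a) (haδ : a ≤ 2 * δ) (hδ : δ ≤ 1 / 20)
    (hc : ∀ x, c x = j → -a ≤ Z x ∧ Z x ≤ a) : RatioPinched P Q c η (10 * δ) j := by
  refine ⟨Real.exp (-a), Real.exp a, (Real.exp_pos _).le, Real.exp_le_exp.2 (by linarith), ?_,
    fun E hE hEc =>
    ⟨(h E hE _).2 fun x hx => (hc x (hEc hx)).1, (h E hE _).1 fun x hx => (hc x (hEc hx)).2⟩⟩
  have h1 := Real.add_one_le_exp (-a)
  have h2 : Real.exp a ≤ 1 + a + a ^ 2 := by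
    have := Real.abs_exp_sub_one_sub_id_le (x := a) (by rw [abs_of_nonneg ha]; linarith)
    linarith [(abs_le.1 this).2]
  have h3 : 1 ≤ Real.exp a := Real.one_le_exp ha
  nlinarith [mul_le_mul_of_nonneg_right hη1 (sub_nonneg.2 h3)]

end Pinched

/-- The number of the cell of `z` among the `N + 1` intervals cut out by `t 0, …, t (N-1)`. -/
noncomputable def cellOf (N : ℕ) (t : ℕ → ℝ) (z : ℝ) : Fin (N + 1) :=
  ⟨((Finset.range N).filter fun k => t k < z).card,
    Nat.lt_succ_of_le ((Finset.card_filter_le _ _).trans (Finset.card_range N).le)⟩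

/-- As the levels increase, those below `z` form an initial segment, so their number is decided by
comparing `z` with a single level. -/
theorem cellOf_le_iff {N : ℕ} {t : ℕ → ℝ} (ht : ∀ j k, j ≤ k → k < N → t j ≤ t k) {j : ℕ}
    (hj : j < N) (z : ℝ) : (cellOf N t z : ℕ) ≤ j ↔ z ≤ t j := by
  constructor
  · intro h
    by_contra! hz
    have : Finset.range (j + 1) ⊆ (Finset.range N).filter fun k => t k < z := by
      intro k hk
      have hkj := Nat.lt_succ_iff.1 (Finset.mem_range.1 hk)
      exact Finset.mem_filter.2 ⟨Finset.mem_range.2 (hkj.trans_lt hj),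
        (ht k j hkj hj).trans_lt hz⟩
    have := Finset.card_le_card this
    rw [Finset.card_range] at this
    have : j + 1 ≤ j := this.trans h
    omega
  · intro hz
    have : (Finset.range N).filter (fun k => t k < z) ⊆ Finset.range j := by
      intro k hk
      rw [Finset.mem_filter, Finset.mem_range] at hk
      rw [Finset.mem_range]
      by_contra! hjk
      linarith [ht j k hjk hk.1]
    have := Finset.card_le_card this
    rwa [Finset.card_range] at this

theorem measurable_cellOf {N : ℕ} (t : ℕ → ℝ) : Measurable (cellOf N t) := by
  have : Measurable fun z => ((Finset.range N).filter fun k => t k < z).card := by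
    simp_rw [Finset.card_filter]
    exact Finset.measurable_sum _ fun k _ =>
      Measurable.ite (measurableSet_lt measurable_const measurable_id) measurable_const
        measurable_const
  refine measurable_to_countable' fun j => ?_
  have e : cellOf N t ⁻¹' {j} =
      (fun z => ((Finset.range N).filter fun k => t k < z).card) ⁻¹' {(j : ℕ)} := by
    ext z
    simp [cellOf, Fin.ext_iff]
  rw [e]
  exact this (measurableSet_singleton _)

/-- Levels `-a, -a/q, …, -a/q^(J-1), a/q^(J-1), …, a`. -/
noncomputable def level (a q : ℝ) (J k : ℕ) : ℝ :=
  if k < J then -(a / q ^ k) else a / q ^ (2 * J - 1 - k)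

theorem level_mono {a q : ℝ} (ha : 0 < a) (hq : 1 ≤ q) (J : ℕ) {j k : ℕ} (h : j ≤ k)
    (hk : k < 2 * J) : level a q J j ≤ level a q J k := by
  have hq0 : 0 < q := one_pos.trans_le hq
  unfold level
  split_ifs with h1 h2 h2
  · exact neg_le_neg (div_le_div_of_nonneg_left ha.le (pow_pos hq0 _)
      (pow_le_pow_right₀ hq h))
  · have : 0 < a / q ^ j := by positivity
    have : 0 < a / q ^ (2 * J - 1 - k) := by positivity
    linarith
  · omega
  · exact div_le_div_of_nonneg_left ha.le (pow_pos hq0 _) (pow_le_pow_right₀ hq (by omega))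

/-- Cell 0 is a tail, cells 1 to J - 1 are bands between consecutive negative levels, and cell J is
the middle one around ratio 1. The cells above J are the mirror images, treated with `P` and `Q`
exchanged and the log-ratio negated. -/
theorem level_cells_pinched {Ω : Type*} [MeasurableSpace Ω] {P Q : Measure Ω} {Z : Ω → ℝ}
    (h : IsLogRatio P Q Z) {η δ : ℝ} {J : ℕ} (hJ : 0 < J) (hη : 0 < η) (hη1 : η ≤ 1)
    (hδ0 : 0 ≤ δ) (hδ : δ ≤ 1 / 20) (hlast : 1 / η / (1 + η) ^ (J - 1) ≤ 2 * δ) (j : Fin (2 * J + 1)) :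
    ((j : ℕ) ≤ J → RatioPinched P Q (fun x => cellOf (2 * J) (level (1 / η) (1 + η) J) (Z x)) η
      (10 * δ) j) ∧
    (J < (j : ℕ) → RatioPinched Q P (fun x => cellOf (2 * J) (level (1 / η) (1 + η) J) (Z x)) η
      (10 * δ) j) := by
  have ha : 0 < 1 / η := by positivity
  have hq : 1 ≤ 1 + η := by linarith
  have hq0 : 0 < 1 + η := by linarith
  have hmono : ∀ j k, j ≤ k → k < 2 * J →
      level (1 / η) (1 + η) J j ≤ level (1 / η) (1 + η) J k :=
    fun j k hjk hk => level_mono ha hq J hjk hk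
  have up : ∀ x, cellOf (2 * J) (level (1 / η) (1 + η) J) (Z x) = j → (j : ℕ) < 2 * J →
      Z x ≤ level (1 / η) (1 + η) J j := fun x hx hj =>
    (cellOf_le_iff hmono hj _).1 (by rw [hx])
  have dn : ∀ x, cellOf (2 * J) (level (1 / η) (1 + η) J) (Z x) = j → 0 < (j : ℕ) →
      level (1 / η) (1 + η) J (j - 1) < Z x := fun x hx hj => by
    by_contra! hz
    have := (cellOf_le_iff hmono (by omega) _).2 hz
    rw [hx] at this
    omega
  have h10 : 0 ≤ 10 * δ := by linarith
  have step : ∀ k : ℕ, 1 / η / (1 + η) ^ (k + 1) * (1 + η) = 1 / η / (1 + η) ^ k := by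
    intro k
    rw [pow_succ]
    field_simp
  refine ⟨fun hj => ?_, fun hj => ?_⟩
  · rcases Nat.eq_zero_or_pos (j : ℕ) with h0 | h0
    · refine h.pinched_tail hη h10 fun x hx => ?_
      have := up x hx (by omega)
      rw [level, if_pos (by omega), h0, pow_zero, div_one] at this
      exact this
    rcases hj.lt_or_eq with hj' | hj'
    · refine h.pinched_band (a := 1 / η / (1 + η) ^ (j : ℕ)) hη.le h10 (by positivity)
        fun x hx => ⟨?_, ?_⟩
      · have := dn x hx h0
        rw [level, if_pos (by omega)] at this
        have s := step ((j : ℕ) - 1)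
        rw [Nat.sub_add_cancel h0] at s
        rw [s]
        exact this.le
      · have := up x hx (by omega)
        rwa [level, if_pos hj'] at this
    · refine h.pinched_middle (a := 1 / η / (1 + η) ^ (J - 1)) hη1 (by positivity) hlast hδ
        fun x hx => ⟨?_, ?_⟩
      · have := dn x hx h0
        rw [level, if_pos (by omega), hj'] at this
        exact this.le
      · have := up x hx (by omega)
        rwa [level, if_neg (by omega), hj', show 2 * J - 1 - J = J - 1 by omega] at this
  · have hjlt := j.isLt
    have low : ∀ x, cellOf (2 * J) (level (1 / η) (1 + η) J) (Z x) = j →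
        1 / η / (1 + η) ^ (2 * J - j) ≤ Z x := fun x hx => by
      have := dn x hx (by omega)
      rw [level, if_neg (by omega), show 2 * J - 1 - (j - 1) = 2 * J - j by omega] at this
      exact this.le
    rcases (Nat.lt_succ_iff.1 hjlt).eq_or_lt with hj' | hj'
    · refine h.symm.pinched_tail hη h10 fun x hx => ?_
      have := low x hx
      rw [hj', Nat.sub_self, pow_zero, div_one] at this
      exact neg_le_neg this
    · refine h.symm.pinched_band (a := 1 / η / (1 + η) ^ (2 * J - j)) hη.le h10 (by positivity)
        fun x hx => ⟨neg_le_neg ?_, neg_le_neg (low x hx)⟩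
      have := up x hx hj'
      rw [level, if_neg (by omega)] at this
      have s := step (2 * J - 1 - j)
      rw [show 2 * J - 1 - (j : ℕ) + 1 = 2 * J - j by omega] at s
      rw [s]
      exact this

end Levels

/-! ### A polynomial substitute for the standard normal law. -/

section TruncatedNormal

/-- The Taylor polynomial of `exp (-t^2/2)` with `K` terms. -/
noncomputable def truncExp (K : ℕ) (t : ℝ) : ℝ :=
  ∑ k ∈ Finset.range K, (-(t ^ 2 / 2)) ^ k / k.factorial

/-- The primitive of `truncExp K` that vanishes at `0`. -/
noncomputable def truncInt (K : ℕ) (x : ℝ) : ℝ :=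
  ∑ k ∈ Finset.range K, x * (-(x ^ 2 / 2)) ^ k / k.factorial / (2 * k + 1)

theorem continuous_truncExp (K : ℕ) : Continuous (truncExp K) := by
  unfold truncExp
  fun_prop

theorem truncInt_neg (K : ℕ) (x : ℝ) : truncInt K (-x) = -truncInt K x := by
  simp [truncInt, neg_mul, neg_div, Finset.sum_neg_distrib]

theorem hasDerivAt_truncInt (K : ℕ) (x : ℝ) : HasDerivAt (truncInt K) (truncExp K x) x := by
  unfold truncInt truncExp
  refine HasDerivAt.fun_sum fun k _ => ?_
  have e : (fun y : ℝ => y * (-(y ^ 2 / 2)) ^ k / k.factorial / (2 * k + 1)) =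
      fun y => (-(1 / 2) : ℝ) ^ k / k.factorial / (2 * k + 1) * y ^ (2 * k + 1) := by
    funext y
    have : -(y ^ 2 / 2) = -(1 / 2) * y ^ 2 := by ring
    rw [this, mul_pow, ← pow_mul, pow_succ]
    ring
  rw [e]
  convert! (hasDerivAt_pow (2 * k + 1) x).const_mul
    ((-(1 / 2) : ℝ) ^ k / k.factorial / (2 * k + 1)) using 1
  have : -(x ^ 2 / 2) = -(1 / 2) * x ^ 2 := by ring
  rw [this, mul_pow, ← pow_mul]
  push_cast
  have h2 : (2 * (k : ℝ) + 1) ≠ 0 := by positivity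
  field_simp

theorem integral_truncExp (K : ℕ) (a b : ℝ) :
    ∫ t in a..b, truncExp K t = truncInt K b - truncInt K a :=
  intervalIntegral.integral_eq_sub_of_hasDerivAt (fun x _ => hasDerivAt_truncInt K x)
    ((continuous_truncExp K).intervalIntegrable _ _)

/-- For u = t²/2 ≤ K/8 the remainder of the exponential series is at most 2u^K/K!. Since (8u)^K/K! ≤
e^(8u) ≤ e^K and e² ≤ 8, this is at most 2e^(-K). -/
theorem abs_truncExp_sub_le {K : ℕ} {t : ℝ} (ht : t ^ 2 ≤ K / 4) :
    |truncExp K t - Real.exp (-(t ^ 2 / 2))| ≤ 2 * Real.exp (-K) := by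
  set u := t ^ 2 / 2 with hu
  have hu0 : 0 ≤ u := by positivity
  have huK : 8 * u ≤ K := by linarith
  have hx : ‖((-u : ℝ) : ℂ)‖ = u := by
    rw [Complex.norm_real, Real.norm_eq_abs, abs_neg, abs_of_nonneg hu0]
  have h := Complex.exp_bound' (x := ((-u : ℝ) : ℂ)) (n := K) (by
    rw [hx, div_le_iff₀ (by positivity)]
    push_cast
    linarith)
  rw [hx] at h
  have e : Complex.exp ((-u : ℝ) : ℂ) - ∑ m ∈ Finset.range K, ((-u : ℝ) : ℂ) ^ m / m.factorial =
      ((Real.exp (-u) - truncExp K t : ℝ) : ℂ) := by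
    rw [truncExp, ← hu]
    push_cast
    rfl
  rw [e, Complex.norm_real, Real.norm_eq_abs, abs_sub_comm] at h
  refine h.trans ?_
  have h1 := Real.pow_div_factorial_le_exp (x := 8 * u) (by linarith) K
  have h2 : Real.exp (8 * u) ≤ Real.exp K := Real.exp_le_exp.2 huK
  have h3 : Real.exp K * Real.exp K ≤ 8 ^ K := by
    rw [← Real.exp_add, ← mul_two, Real.exp_nat_mul]
    refine pow_le_pow_left₀ (Real.exp_pos _).le ?_ K
    rw [show (2 : ℝ) = ((2 : ℕ) : ℝ) * 1 by norm_num, Real.exp_nat_mul]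
    have := Real.exp_one_lt_d9
    nlinarith [Real.exp_pos 1]
  rw [mul_pow] at h1
  rw [mul_comm, Real.exp_neg]
  refine mul_le_mul_of_nonneg_left ?_ zero_le_two
  rw [← one_div, le_div_iff₀ (Real.exp_pos _)]
  have h4 : 8 ^ K * (u ^ K / K.factorial) ≤ Real.exp K := by
    rw [← mul_div_assoc]; exact h1.trans h2
  have h5 : Real.exp K * Real.exp K * (u ^ K / K.factorial) ≤ Real.exp K :=
    (mul_le_mul_of_nonneg_right h3 (by positivity)).trans h4
  have h6 : Real.exp K * (Real.exp K * (u ^ K / K.factorial)) ≤ Real.exp K * 1 := by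
    rw [← mul_assoc, mul_one]; exact h5
  rw [mul_comm]
  exact le_of_mul_le_mul_left h6 (Real.exp_pos _)

/-- On this range exp(-t²/2) ≥ e^(-K/8), which exceeds the error 2e^(-K) as soon as K ≥ 2. So the
polynomial is a genuine density. -/
theorem truncExp_pos {K : ℕ} (hK : 2 ≤ K) {t : ℝ} (ht : t ^ 2 ≤ K / 4) : 0 < truncExp K t := by
  have h1 := (abs_le.1 (abs_truncExp_sub_le ht)).1
  have hK' : (2 : ℝ) ≤ K := by exact_mod_cast hK
  have h2 : Real.exp (-(K / 8)) ≤ Real.exp (-(t ^ 2 / 2)) := Real.exp_le_exp.2 (by linarith)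
  have h3 : Real.exp (-(K / 8)) = Real.exp (-K) * Real.exp (7 * K / 8) := by
    rw [← Real.exp_add]; congr 1; ring
  have h4 := Real.add_one_le_exp (7 * (K : ℝ) / 8)
  nlinarith [Real.exp_pos (-(K : ℝ))]

/-- The cut-off point. -/
noncomputable def cutoff (K : ℕ) : ℝ := √K / 2

theorem cutoff_nonneg (K : ℕ) : 0 ≤ cutoff K := by unfold cutoff; positivity

theorem sq_le_of_mem_cutoff {K : ℕ} {t : ℝ} (ht : t ∈ Set.Icc (-cutoff K) (cutoff K)) :
    t ^ 2 ≤ K / 4 := by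
  have := sq_le_sq' ht.1 ht.2
  rwa [cutoff, div_pow, Real.sq_sqrt (Nat.cast_nonneg K), show (2 : ℝ) ^ 2 = 4 by norm_num] at this

theorem truncInt_cutoff_pos {K : ℕ} (hK : 2 ≤ K) : 0 < truncInt K (cutoff K) := by
  have h0 : truncInt K 0 = 0 := by simp [truncInt]
  have hc : 0 < cutoff K := by
    unfold cutoff
    have : (0 : ℝ) < K := by positivity
    positivity
  have := integral_truncExp K 0 (cutoff K)
  rw [h0, sub_zero] at this
  rw [← this]
  refine intervalIntegral.intervalIntegral_pos_of_pos_on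
    ((continuous_truncExp K).intervalIntegrable _ _) (fun x hx => ?_) hc
  exact truncExp_pos hK (sq_le_of_mem_cutoff ⟨by linarith [hx.1], hx.2.le⟩)

/-- The probability measure on `[-√K/2, √K/2]` with density proportional to `truncExp K`. -/
noncomputable def truncNormal (K : ℕ) : Measure ℝ :=
  (volume.restrict (Set.Icc (-cutoff K) (cutoff K))).withDensity
    fun t => ENNReal.ofReal (truncExp K t / (2 * truncInt K (cutoff K)))

theorem truncNormal_real {K : ℕ} (hK : 2 ≤ K) {A : Set ℝ} (hA : MeasurableSet A) :
    (truncNormal K).real A =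
      (∫ t in A ∩ Set.Icc (-cutoff K) (cutoff K), truncExp K t) / (2 * truncInt K (cutoff K)) := by
  have hT := truncInt_cutoff_pos hK
  rw [measureReal_def, truncNormal, withDensity_apply _ hA, Measure.restrict_restrict hA,
    ← integral_div, integral_eq_lintegral_of_nonneg_ae]
  · refine (ae_restrict_iff' (hA.inter measurableSet_Icc)).2 (Filter.Eventually.of_forall ?_)
    intro t ht
    exact div_nonneg (truncExp_pos hK (sq_le_of_mem_cutoff ht.2)).le (by linarith)
  · exact ((continuous_truncExp K).div_const _).aestronglyMeasurable

theorem setIntegral_Icc_truncExp (K : ℕ) {a b : ℝ} (h : a ≤ b) :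
    ∫ t in Set.Icc a b, truncExp K t = truncInt K b - truncInt K a := by
  rw [integral_Icc_eq_integral_Ioc, ← intervalIntegral.integral_of_le h, integral_truncExp]

theorem isProbabilityMeasure_truncNormal {K : ℕ} (hK : 2 ≤ K) :
    IsProbabilityMeasure (truncNormal K) := by
  have hT := truncInt_cutoff_pos hK
  have h := truncNormal_real hK MeasurableSet.univ
  have hc := cutoff_nonneg K
  rw [Set.univ_inter, setIntegral_Icc_truncExp K (by linarith), truncInt_neg, sub_neg_eq_add,
    ← two_mul, div_self (by positivity), measureReal_def] at h
  exact ⟨(ENNReal.toReal_eq_one_iff _).1 h⟩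

theorem truncNormal_singleton (K : ℕ) (x : ℝ) : truncNormal K {x} = 0 := by
  rw [truncNormal, withDensity_apply _ (measurableSet_singleton x),
    Measure.restrict_restrict (measurableSet_singleton x)]
  refine setLIntegral_measure_zero _ _ (measure_mono_null Set.inter_subset_left ?_)
  simp

/-- The centred distribution function of `truncNormal K`. -/
noncomputable def truncCdf (K : ℕ) (x : ℝ) : ℝ :=
  truncInt K (max (-cutoff K) (min (cutoff K) x)) / (2 * truncInt K (cutoff K))

theorem truncNormal_real_Iic {K : ℕ} (hK : 2 ≤ K) (x : ℝ) :
    (truncNormal K).real (Set.Iic x) = 1 / 2 + truncCdf K x := by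
  have hT := truncInt_cutoff_pos hK
  have hc := cutoff_nonneg K
  have e : ∫ t in Set.Iic x ∩ Set.Icc (-cutoff K) (cutoff K), truncExp K t =
      truncInt K (max (-cutoff K) (min (cutoff K) x)) + truncInt K (cutoff K) := by
    rcases lt_or_ge x (-cutoff K) with h | h
    · have : Set.Iic x ∩ Set.Icc (-cutoff K) (cutoff K) = ∅ := by
        ext t
        simp only [Set.mem_inter_iff, Set.mem_Iic, Set.mem_Icc, Set.mem_empty_iff_false, iff_false]
        rintro ⟨h1, h2, -⟩
        linarith
      rw [this, setIntegral_empty, max_eq_left ((min_le_right _ _).trans h.le), truncInt_neg,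
        neg_add_cancel]
    · have : Set.Iic x ∩ Set.Icc (-cutoff K) (cutoff K) =
          Set.Icc (-cutoff K) (min (cutoff K) x) := by
        ext t
        simp only [Set.mem_inter_iff, Set.mem_Iic, Set.mem_Icc, le_min_iff]
        tauto
      have hm : -cutoff K ≤ min (cutoff K) x := le_min (by linarith) h
      rw [this, max_eq_right hm, setIntegral_Icc_truncExp K hm, truncInt_neg, sub_neg_eq_add]
  rw [truncNormal_real hK measurableSet_Iic, e, truncCdf]
  field_simp
  ring

/-- Inside the cut-off the error is at most 2e^(-K) times the length √K. Outside, t² ≥ K/4 gives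
exp(-t²/2) ≤ e^(-K/16)exp(-t²/4), and the last factor has integral √(4π) ≤ 3.6. -/
theorem abs_setIntegral_truncExp_sub_le {K : ℕ} (hK : 1 ≤ K) {A : Set ℝ} (hA : MeasurableSet A) :
    |(∫ t in A ∩ Set.Icc (-cutoff K) (cutoff K), truncExp K t) -
      ∫ t in A, Real.exp (-(t ^ 2 / 2))| ≤ 6 * Real.exp (-(K / 16)) := by
  set I := Set.Icc (-cutoff K) (cutoff K) with hI
  have hIm : MeasurableSet I := measurableSet_Icc
  have hc := cutoff_nonneg K
  have gint : Integrable fun t : ℝ => Real.exp (-(t ^ 2 / 2)) := by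
    have := integrable_exp_neg_mul_sq (b := 1 / 2) (by norm_num)
    refine this.congr (Filter.Eventually.of_forall fun t => ?_)
    simp only
    congr 1
    ring
  have g4 : Integrable fun t : ℝ => Real.exp (-(1 / 4) * t ^ 2) :=
    integrable_exp_neg_mul_sq (by norm_num)
  have fint : IntegrableOn (truncExp K) I := (continuous_truncExp K).integrableOn_Icc
  have split : ∫ t in A, Real.exp (-(t ^ 2 / 2)) =
      (∫ t in A ∩ I, Real.exp (-(t ^ 2 / 2))) + ∫ t in A \ I, Real.exp (-(t ^ 2 / 2)) :=
    (integral_inter_add_sdiff hIm gint.integrableOn).symm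
  have h1 : |∫ t in A ∩ I, (truncExp K t - Real.exp (-(t ^ 2 / 2)))| ≤
      2 * Real.exp (-K) * (2 * cutoff K) := by
    have hvol : volume (A ∩ I) < ⊤ :=
      (measure_mono Set.inter_subset_right).trans_lt (by rw [hI]; exact measure_Icc_lt_top)
    have := norm_setIntegral_le_of_norm_le_const (μ := volume) (s := A ∩ I)
      (f := fun t => truncExp K t - Real.exp (-(t ^ 2 / 2))) (C := 2 * Real.exp (-K)) hvol
      fun t ht => abs_truncExp_sub_le (sq_le_of_mem_cutoff ht.2)
    refine this.trans (mul_le_mul_of_nonneg_left ?_ (by positivity))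
    have h2 : volume.real (A ∩ I) ≤ volume.real I :=
      measureReal_mono Set.inter_subset_right (by rw [hI]; exact measure_Icc_lt_top.ne)
    rw [hI, Real.volume_real_Icc_of_le (by linarith)] at h2
    rw [hI]
    linarith
  have h2 : ∫ t in A \ I, Real.exp (-(t ^ 2 / 2)) ≤ Real.exp (-(K / 16)) * 3.6 := by
    calc ∫ t in A \ I, Real.exp (-(t ^ 2 / 2))
        ≤ ∫ t in A \ I, Real.exp (-(K / 16)) * Real.exp (-(1 / 4) * t ^ 2) := by
          refine setIntegral_mono_on gint.integrableOn (g4.const_mul _).integrableOn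
            (hA.diff hIm) fun t ht => ?_
          rw [← Real.exp_add]
          refine Real.exp_le_exp.2 ?_
          have ht2 : (K : ℝ) / 4 ≤ t ^ 2 := by
            by_contra! hlt
            refine ht.2 (abs_le.1 (abs_le_of_sq_le_sq ?_ hc))
            rw [cutoff, div_pow, Real.sq_sqrt (Nat.cast_nonneg K)]
            linarith
          linarith
      _ ≤ ∫ t, Real.exp (-(K / 16)) * Real.exp (-(1 / 4) * t ^ 2) :=
          setIntegral_le_integral (g4.const_mul _)
            (Filter.Eventually.of_forall fun t => by positivity)
      _ ≤ Real.exp (-(K / 16)) * 3.6 := by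
          rw [integral_const_mul, integral_gaussian]
          refine mul_le_mul_of_nonneg_left ?_ (Real.exp_pos _).le
          refine Real.sqrt_le_iff.2 ⟨by norm_num, ?_⟩
          have := Real.pi_lt_d2
          norm_num at this ⊢
          linarith
  have h2' : 0 ≤ ∫ t in A \ I, Real.exp (-(t ^ 2 / 2)) :=
    integral_nonneg fun t => (Real.exp_pos _).le
  have h3 : 2 * Real.exp (-K) * (2 * cutoff K) ≤ 2.2 * Real.exp (-(K / 16)) := by
    have hK' : (1 : ℝ) ≤ K := by exact_mod_cast hK
    have hs : √(K : ℝ) ≤ K := Real.sqrt_le_iff.2 ⟨by linarith, by nlinarith⟩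
    have e : Real.exp (-(K / 16)) = Real.exp (-K) * Real.exp (15 * K / 16) := by
      rw [← Real.exp_add]; congr 1; ring
    have h4 := Real.add_one_le_exp (15 * (K : ℝ) / 16)
    rw [e, cutoff]
    nlinarith [Real.exp_pos (-(K : ℝ))]
  rw [split]
  rw [integral_sub (fint.mono_set Set.inter_subset_right) gint.integrableOn] at h1
  have h5 := abs_le.1 h1
  have h6 := Real.exp_pos (-((K : ℝ) / 16))
  exact abs_le.2 ⟨by linarith, by linarith⟩

/-- Both the numerator and the normalization are off by at most 6e^(-K/16). The sum of the two
errors is divided by √(2π) ≥ 2. -/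
theorem tvDist_truncNormal_le {K : ℕ} (hK : 2 ≤ K) :
    tvDist (truncNormal K) (gaussianReal 0 (1 : ℝ).toNNReal) ≤ 6 * Real.exp (-(K / 16)) := by
  have := isProbabilityMeasure_truncNormal hK
  have hT := truncInt_cutoff_pos hK
  have hρ := Real.exp_pos (-((K : ℝ) / 16))
  have hc := cutoff_nonneg K
  have c2 : 2 ≤ √(2 * Real.pi) := Real.le_sqrt_of_sq_le (by
    have := Real.pi_gt_three
    linarith)
  have gauss : ∀ A : Set ℝ, (gaussianReal 0 (1 : ℝ).toNNReal).real A =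
      (∫ t in A, Real.exp (-(t ^ 2 / 2))) / √(2 * Real.pi) := by
    intro A
    rw [measureReal_gaussianReal one_pos, ← integral_div]
    congr 1
    funext t
    rw [gaussianPDFReal, Real.coe_toNNReal _ zero_le_one, inv_mul_eq_div]
    rw [mul_one, sub_zero, mul_one, neg_div]
  have hu := abs_setIntegral_truncExp_sub_le (by omega : 1 ≤ K) MeasurableSet.univ
  rw [Set.univ_inter, setIntegral_Icc_truncExp K (by linarith), truncInt_neg, sub_neg_eq_add,
    ← two_mul] at hu
  have gu := gauss Set.univ
  rw [probReal_univ, eq_div_iff (by positivity), one_mul] at gu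
  rw [← gu] at hu
  refine tvDist_le fun A hA => ?_
  have hAi := abs_setIntegral_truncExp_sub_le (by omega : 1 ≤ K) hA
  have hle := measureReal_le_one (μ := truncNormal K) (s := A)
  have h0 := measureReal_nonneg (μ := truncNormal K) (s := A)
  have hr := truncNormal_real hK hA
  rw [eq_div_iff (by positivity)] at hr
  rw [gauss A]
  set S := ∫ t in A ∩ Set.Icc (-cutoff K) (cutoff K), truncExp K t
  set G := ∫ t in A, Real.exp (-(t ^ 2 / 2))
  set c := √(2 * Real.pi)
  set r := (truncNormal K).real A
  set W := 2 * truncInt K (cutoff K)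
  have cpos : 0 < c := by linarith
  have b1 := (abs_le.1 hAi).2
  have b2 := (abs_le.1 hu).1
  rw [sub_le_iff_le_add, ← sub_le_iff_le_add', le_div_iff₀ cpos]
  nlinarith

end TruncatedNormal

/-! ### Measures of the sublevel sets of the log-ratio. -/

section Tables

instance nullSingletonClass_truncNormal (K : ℕ) : NullSingletonClass (truncNormal K) :=
  ⟨truncNormal_singleton K⟩

/-- For α > 0 the set is the interval between the roots of the quadratic. For α < 0 it is the
outside of that interval and the roots change order, so the difference of values of `F` is negative
and 1 is added. One formula serves all cases, including E < 0. -/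
theorem measureReal_quadratic_le_zero {ν : Measure ℝ} [IsProbabilityMeasure ν]
    [NullSingletonClass ν] {F : ℝ → ℝ} {b : ℝ} (hF : ∀ x, ν.real (Set.Iic x) = b + F x)
    {α β E : ℝ} (hα : α ≠ 0) :
    ν.real {z | ((α * z + β) ^ 2 - E) / α ≤ 0} =
      F ((-β + √E) / α) - F ((-β - √E) / α) + if α < 0 then 1 else 0 := by
  have hIoc : ∀ x y, x ≤ y → ν.real (Set.Ioc x y) = F y - F x := by
    intro x y hxy
    have h : Set.Ioc x y = Set.Iic y \ Set.Iic x := by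
      ext
      simp [and_comm]
    rw [h, measureReal_sdiff (Set.Iic_subset_Iic.2 hxy) measurableSet_Iic, hF, hF]
    ring
  have hw : 0 ≤ √E := Real.sqrt_nonneg E
  rcases hα.lt_or_gt with hα | hα
  · have hle : (-β + √E) / α ≤ (-β - √E) / α :=
      div_le_div_of_nonpos_of_le hα.le (by linarith)
    have e : {z | ((α * z + β) ^ 2 - E) / α ≤ 0} =
        (Set.Ioo ((-β + √E) / α) ((-β - √E) / α))ᶜ := by
      ext z
      rw [Set.mem_ofPred_eq, Set.mem_compl_iff, Set.mem_Ioo, div_lt_iff_of_neg hα,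
        lt_div_iff_of_neg hα, not_and_or, not_lt, not_lt, div_nonpos_iff]
      constructor
      · rintro (⟨h1, -⟩ | ⟨-, h2⟩)
        · have : √E ≤ |α * z + β| := by
            rw [← Real.sqrt_sq_eq_abs]
            exact Real.sqrt_le_sqrt (by linarith)
          rcases le_abs.1 this with h | h
          · left; linarith
          · right; linarith
        · linarith
      · intro h
        left
        refine ⟨?_, hα.le⟩
        have : √E ≤ |α * z + β| := by
          rcases h with h | h
          · exact le_trans (by linarith) (le_abs_self _)
          · exact le_trans (by linarith) (neg_le_abs _)
        have h2 : E ≤ |α * z + β| ^ 2 := (Real.sqrt_le_left (abs_nonneg _)).1 this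
        rw [sq_abs] at h2
        linarith
    rw [e, probReal_compl_eq_one_sub measurableSet_Ioo, measureReal_congr Ioo_ae_eq_Ioc,
      hIoc _ _ hle, if_pos hα]
    ring
  · have hle : (-β - √E) / α ≤ (-β + √E) / α :=
      div_le_div_of_nonneg_right (by linarith) hα.le
    rw [if_neg hα.not_gt, add_zero, ← hIoc _ _ hle]
    by_cases hE : 0 ≤ E
    · have e : {z | ((α * z + β) ^ 2 - E) / α ≤ 0} =
          Set.Icc ((-β - √E) / α) ((-β + √E) / α) := by
        ext z
        rw [Set.mem_ofPred_eq, Set.mem_Icc, div_nonpos_iff, div_le_iff₀ hα, le_div_iff₀ hα]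
        constructor
        · rintro (⟨-, h2⟩ | ⟨h1, -⟩)
          · linarith
          · have := abs_le.1 (Real.abs_le_sqrt (sub_nonpos.1 h1))
            constructor <;> linarith [this.1, this.2]
        · rintro ⟨h1, h2⟩
          right
          refine ⟨?_, hα.le⟩
          have := sq_le_sq' (a := α * z + β) (b := √E) (by linarith) (by linarith)
          rw [Real.sq_sqrt hE] at this
          linarith
      rw [e, measureReal_congr Ioc_ae_eq_Icc]
    · push Not at hE
      -- Without real roots the set is empty. The default value 0 of the square root makes the two
      -- endpoints coincide, so the formula still holds.
      rw [Real.sqrt_eq_zero_of_nonpos hE.le]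
      have e : {z | ((α * z + β) ^ 2 - E) / α ≤ 0} = ∅ := by
        ext z
        simp only [Set.mem_ofPred_eq, Set.mem_empty_iff_false, iff_false, not_le]
        exact div_pos (by nlinarith [sq_nonneg (α * z + β)]) hα
      simp [e]

/-- The discriminant of the equation `logRatio m v x = t`. -/
noncomputable def disc (m v t : ℝ) : ℝ := m ^ 2 + (v - 1) * (Real.log v + 2 * t)

theorem logRatio_le_iff {m v : ℝ} (hv : 0 < v) (hv1 : v ≠ 1) (t x : ℝ) :
    logRatio m v x ≤ t ↔ (((v - 1) * x + m) ^ 2 - v * disc m v t) / (v - 1) ≤ 0 := by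
  have h1 : v - 1 ≠ 0 := sub_ne_zero.2 hv1
  have e : (((v - 1) * x + m) ^ 2 - v * disc m v t) / (v - 1) =
      2 * v * (logRatio m v x - t) := by
    rw [logRatio, disc]
    field_simp
    ring
  rw [e, ← sub_nonpos]
  constructor
  · intro h
    exact mul_nonpos_of_nonneg_of_nonpos (by positivity) h
  · intro h
    by_contra! h'
    have := mul_pos (by positivity : 0 < 2 * v) h'
    linarith

/-- Under x = m + √v z the linear form (v - 1)x + m becomes √v((v - 1)z + m√v). The factor v
cancels, and the same discriminant serves both tables. -/
theorem logRatio_affine_le_iff {m v : ℝ} (hv : 0 < v) (hv1 : v ≠ 1) (t z : ℝ) :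
    logRatio m v (m + √v * z) ≤ t ↔
      (((v - 1) * z + m * √v) ^ 2 - disc m v t) / (v - 1) ≤ 0 := by
  rw [logRatio_le_iff hv hv1]
  have hs : √v ^ 2 = v := Real.sq_sqrt hv.le
  have e : (((v - 1) * (m + √v * z) + m) ^ 2 - v * disc m v t) / (v - 1) =
      v * ((((v - 1) * z + m * √v) ^ 2 - disc m v t) / (v - 1)) := by
    rw [← mul_div_assoc]
    congr 1
    have : (v - 1) * (m + √v * z) + m = √v * ((v - 1) * z + m * √v) := by
      linear_combination (-m) * hs
    rw [this, mul_pow, hs]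
    ring
  rw [e]
  constructor
  · intro h
    by_contra! h'
    linarith [mul_pos hv h']
  · intro h
    exact mul_nonpos_of_nonneg_of_nonpos hv.le h

/-- Difference of the centred distribution function at the two numbers `(-b ± w) / (v - 1)`,
corrected to be the measure of a sublevel set. -/
noncomputable def rootCdf (K : ℕ) (v b w : ℝ) : ℝ :=
  truncCdf K ((-b + w) / (v - 1)) - truncCdf K ((-b - w) / (v - 1)) + if v < 1 then 1 else 0

theorem truncNormal_real_logRatio_le {K : ℕ} (hK : 2 ≤ K) {m v : ℝ} (hv : 0 < v) (hv1 : v ≠ 1)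
    (t : ℝ) : (truncNormal K).real {x | logRatio m v x ≤ t} =
      rootCdf K v m (√v * √(disc m v t)) := by
  have := isProbabilityMeasure_truncNormal hK
  simp_rw [logRatio_le_iff hv hv1]
  rw [measureReal_quadratic_le_zero (truncNormal_real_Iic hK) (sub_ne_zero.2 hv1), rootCdf,
    Real.sqrt_mul hv.le]
  simp only [sub_neg]

theorem truncNormal_real_logRatio_affine_le {K : ℕ} (hK : 2 ≤ K) {m v : ℝ} (hv : 0 < v)
    (hv1 : v ≠ 1) (t : ℝ) : (truncNormal K).real {z | logRatio m v (m + √v * z) ≤ t} =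
      rootCdf K v (m * √v) (√(disc m v t)) := by
  have := isProbabilityMeasure_truncNormal hK
  simp_rw [logRatio_affine_le_iff hv hv1]
  rw [measureReal_quadratic_le_zero (truncNormal_real_Iic hK) (sub_ne_zero.2 hv1), rootCdf]
  simp only [sub_neg]

/-- The table of consecutive differences of `0, f 0, …, f (N-1), 1`. -/
noncomputable def increments (N : ℕ) (f : ℕ → ℝ) (j : ℕ) : ℝ :=
  (if j < N then f j else 1) - if 0 < j then f (j - 1) else 0

/-- A cell is the difference of two consecutive sublevel sets; below the first level and above the
last one their measures are 0 and 1. -/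
theorem map_cellOf_real {Ω : Type*} [MeasurableSpace Ω] (ν : Measure Ω) [IsProbabilityMeasure ν]
    {Z : Ω → ℝ} (hZ : Measurable Z) {N : ℕ} {t : ℕ → ℝ}
    (ht : ∀ j k, j ≤ k → k < N → t j ≤ t k) (j : Fin (N + 1)) :
    (ν.map fun x => cellOf N t (Z x)).real {j} =
      increments N (fun k => ν.real {x | Z x ≤ t k}) j := by
  have hm : Measurable fun x => cellOf N t (Z x) := (measurable_cellOf t).comp hZ
  rw [map_measureReal_apply hm (measurableSet_singleton j)]
  have mk : ∀ k : ℕ, MeasurableSet {x | (cellOf N t (Z x) : ℕ) ≤ k} := fun k =>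
    measurableSet_le (measurable_from_top.comp hm) measurable_const
  have hu : ν.real {x | (cellOf N t (Z x) : ℕ) ≤ j} =
      if (j : ℕ) < N then ν.real {x | Z x ≤ t j} else 1 := by
    split_ifs with h
    · simp_rw [cellOf_le_iff ht h]
    · have : {x | (cellOf N t (Z x) : ℕ) ≤ j} = Set.univ :=
        Set.eq_univ_of_forall fun x => by
          have := (cellOf N t (Z x)).isLt
          have : (cellOf N t (Z x) : ℕ) ≤ j := by omega
          exact this
      rw [this, probReal_univ]
  have hj := j.isLt
  rw [increments, ← hu]
  split_ifs with h0
  · have hd : ν.real {x | Z x ≤ t (j - 1)} = ν.real {x | (cellOf N t (Z x) : ℕ) ≤ (j : ℕ) - 1} := by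
      simp_rw [cellOf_le_iff ht (show (j : ℕ) - 1 < N by omega)]
    have e : (fun x => cellOf N t (Z x)) ⁻¹' {j} =
        {x | (cellOf N t (Z x) : ℕ) ≤ j} \ {x | (cellOf N t (Z x) : ℕ) ≤ (j : ℕ) - 1} := by
      ext x
      simp only [Set.mem_preimage, Set.mem_singleton_iff, Set.mem_sdiff, Set.mem_ofPred_eq,
        Fin.ext_iff]
      omega
    rw [hd, e, measureReal_sdiff (fun x hx => ?_) (mk _)]
    exact le_trans (Set.mem_ofPred_eq.mp hx) (Nat.sub_le _ _)
  · rw [sub_zero]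
    congr 1
    ext x
    simp only [Set.mem_preimage, Set.mem_singleton_iff, Set.mem_ofPred_eq, Fin.ext_iff]
    omega

end Tables

/-! ### Accuracy of the tables. -/

section Accuracy

/-- The table for the coordinate `N(m, v)`: the cells of `m + √v z` with `z` from `truncNormal`. -/
noncomputable def leftLaw (K : ℕ) (m v : ℝ) (N : ℕ) (t : ℕ → ℝ) : Measure (Fin (N + 1)) :=
  (truncNormal K).map fun z => cellOf N t (logRatio m v (m + √v * z))

/-- The table for the coordinate `N(0, 1)`. -/
noncomputable def rightLaw (K : ℕ) (m v : ℝ) (N : ℕ) (t : ℕ → ℝ) : Measure (Fin (N + 1)) :=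
  (truncNormal K).map fun x => cellOf N t (logRatio m v x)

theorem measurable_cellOf_logRatio (m v : ℝ) (N : ℕ) (t : ℕ → ℝ) :
    Measurable fun x => cellOf N t (logRatio m v x) :=
  (measurable_cellOf t).comp (measurable_logRatio m v)

theorem measurable_cellOf_logRatio_affine (m v : ℝ) (N : ℕ) (t : ℕ → ℝ) :
    Measurable fun z => cellOf N t (logRatio m v (m + √v * z)) :=
  (measurable_cellOf_logRatio m v N t).comp (by fun_prop)

theorem isProbabilityMeasure_leftLaw {K : ℕ} (hK : 2 ≤ K) (m v : ℝ) (N : ℕ) (t : ℕ → ℝ) :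
    IsProbabilityMeasure (leftLaw K m v N t) := by
  have := isProbabilityMeasure_truncNormal hK
  exact Measure.isProbabilityMeasure_map (measurable_cellOf_logRatio_affine m v N t).aemeasurable

theorem isProbabilityMeasure_rightLaw {K : ℕ} (hK : 2 ≤ K) (m v : ℝ) (N : ℕ) (t : ℕ → ℝ) :
    IsProbabilityMeasure (rightLaw K m v N t) := by
  have := isProbabilityMeasure_truncNormal hK
  exact Measure.isProbabilityMeasure_map (measurable_cellOf_logRatio m v N t).aemeasurable

/-- Both laws are images, under the same map, of `truncNormal K` and of the standard normal law. -/
theorem tvDist_leftLaw_le {K : ℕ} (hK : 2 ≤ K) (m : ℝ) {v : ℝ} (hv : 0 < v) (N : ℕ) (t : ℕ → ℝ) :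
    tvDist (leftLaw K m v N t)
      ((gaussianReal m v.toNNReal).map fun x => cellOf N t (logRatio m v x)) ≤
      6 * Real.exp (-(K / 16)) := by
  have := isProbabilityMeasure_truncNormal hK
  rw [← map_std_gaussianReal hv.le, Measure.map_map (measurable_cellOf_logRatio m v N t)
    (by fun_prop)]
  exact (tvDist_map_le _ _ (measurable_cellOf_logRatio_affine m v N t)).trans
    (tvDist_truncNormal_le hK)

theorem tvDist_rightLaw_le {K : ℕ} (hK : 2 ≤ K) (m v : ℝ) (N : ℕ) (t : ℕ → ℝ) :
    tvDist (rightLaw K m v N t)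
      ((gaussianReal 0 (1 : ℝ).toNNReal).map fun x => cellOf N t (logRatio m v x)) ≤
      6 * Real.exp (-(K / 16)) := by
  have := isProbabilityMeasure_truncNormal hK
  exact (tvDist_map_le _ _ (measurable_cellOf_logRatio m v N t)).trans (tvDist_truncNormal_le hK)

theorem abs_tvDist_pi_sub_le {n : ℕ} {Ω : Type*} [MeasurableSpace Ω] (P P' Q Q' : Fin n → Measure Ω)
    [∀ i, IsProbabilityMeasure (P i)] [∀ i, IsProbabilityMeasure (P' i)]
    [∀ i, IsProbabilityMeasure (Q i)] [∀ i, IsProbabilityMeasure (Q' i)] {a b : ℝ}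
    (hP : ∀ i, tvDist (P i) (P' i) ≤ a) (hQ : ∀ i, tvDist (Q i) (Q' i) ≤ b) :
    |tvDist (Measure.pi P) (Measure.pi Q) - tvDist (Measure.pi P') (Measure.pi Q')| ≤
      n * (a + b) := by
  have sP := (tvDist_pi_le P P').trans (Finset.sum_le_card_nsmul Finset.univ _ a fun i _ => hP i)
  have sQ := (tvDist_pi_le Q Q').trans (Finset.sum_le_card_nsmul Finset.univ _ b fun i _ => hQ i)
  simp only [Finset.card_univ, Fintype.card_fin, nsmul_eq_mul] at sP sQ
  have t1 := tvDist_triangle (Measure.pi P) (Measure.pi P') (Measure.pi Q)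
  have t2 := tvDist_triangle (Measure.pi P') (Measure.pi Q') (Measure.pi Q)
  have t3 := tvDist_triangle (Measure.pi P') (Measure.pi P) (Measure.pi Q')
  have t4 := tvDist_triangle (Measure.pi P) (Measure.pi Q) (Measure.pi Q')
  rw [tvDist_comm (Measure.pi Q') (Measure.pi Q)] at t2
  rw [tvDist_comm (Measure.pi P') (Measure.pi P)] at t3
  exact abs_le.2 ⟨by linarith, by linarith⟩

/-- Move a variance away from the degenerate value `1`. -/
noncomputable def nudge (δ v : ℝ) : ℝ := if v = 1 then 1 + δ else v

theorem nudge_pos {δ v : ℝ} (hδ : 0 < δ) (hv : 0 < v) : 0 < nudge δ v := by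
  unfold nudge
  split_ifs
  · linarith
  · exact hv

theorem nudge_ne_one {δ v : ℝ} (hδ : 0 < δ) : nudge δ v ≠ 1 := by
  unfold nudge
  split_ifs with h
  · linarith
  · exact h

theorem tvDist_nudge_le (m : ℝ) {δ : ℝ} (v : ℝ) (hδ : 0 < δ) :
    tvDist (gaussianReal m (nudge δ v).toNNReal) (gaussianReal m v.toNNReal) ≤ δ := by
  unfold nudge
  split_ifs with h
  · rw [h, tvDist_comm]
    refine (tvDist_gaussianReal_same_mean_le one_pos (by linarith)).trans ?_
    rw [one_sub_div (by linarith), div_le_iff₀ (by linarith)]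
    nlinarith
  · rw [tvDist_self]
    exact hδ.le

/-- The accuracy of the tables, for levels `level (1/η) (1+η) J` and `K` Taylor terms. -/
theorem abs_tvDist_tables_sub_le {n : ℕ} (μ d : Fin n → ℝ) (hd : ∀ i, 0 < d i) {η δ : ℝ} {J K : ℕ}
    (hJ : 0 < J) (hK : 2 ≤ K) (hη : 0 < η) (hη1 : η ≤ 1) (hδ0 : 0 < δ) (hδ : δ ≤ 1 / 20)
    (hlast : 1 / η / (1 + η) ^ (J - 1) ≤ 2 * δ) (hKδ : 6 * Real.exp (-(K / 16)) ≤ δ) :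
    |tvDist
        (Measure.pi fun i =>
          leftLaw K (μ i) (nudge δ (d i)) (2 * J) (level (1 / η) (1 + η) J))
        (Measure.pi fun i =>
          rightLaw K (μ i) (nudge δ (d i)) (2 * J) (level (1 / η) (1 + η) J)) -
      tvDist (Measure.pi fun i => gaussianReal (μ i) (d i).toNNReal)
        (Measure.pi fun _ : Fin n => gaussianReal 0 (1 : ℝ).toNNReal)| ≤
      2 * n * η * tvDist (Measure.pi fun i => gaussianReal (μ i) (d i).toNNReal)
        (Measure.pi fun _ : Fin n => gaussianReal 0 (1 : ℝ).toNNReal) +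
      (23 * n + 2 * n * η * n) * δ := by
  set t := level (1 / η) (1 + η) J with ht
  set v := fun i => nudge δ (d i) with hv
  have hv0 : ∀ i, 0 < v i := fun i => nudge_pos hδ0 (hd i)
  have iL := fun i => isProbabilityMeasure_leftLaw hK (μ i) (v i) (2 * J) t
  have iR := fun i => isProbabilityMeasure_rightLaw hK (μ i) (v i) (2 * J) t
  have hm := fun i => measurable_cellOf_logRatio (μ i) (v i) (2 * J) t
  have mP := fun i => Measure.isProbabilityMeasure_map (μ := gaussianReal (μ i) (v i).toNNReal)
    (hm i).aemeasurable
  have mQ := fun i => Measure.isProbabilityMeasure_map (μ := gaussianReal 0 (1 : ℝ).toNNReal)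
    (hm i).aemeasurable
  have h1 := abs_tvDist_pi_sub_le _ _ _ _
    (fun i => tvDist_leftLaw_le hK (μ i) (hv0 i) (2 * J) t)
    (fun i => tvDist_rightLaw_le hK (μ i) (v i) (2 * J) t)
  have pinch := fun i => level_cells_pinched (isLogRatio_gaussianReal (m := μ i) (hv0 i)) hJ hη hη1
    hδ0.le hδ hlast
  have h2 := tvDist_pi_le_tvDist_pi_map_add (fun i => gaussianReal (μ i) (v i).toNNReal)
    (fun _ => gaussianReal 0 (1 : ℝ).toNNReal) hm
    (fun _ => Finset.univ.filter fun j : Fin (2 * J + 1) => (j : ℕ) ≤ J) hη.le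
    (by linarith : 0 ≤ 10 * δ) (fun i j hj => (pinch i j).1 (Finset.mem_filter.1 hj).2)
    (fun i j hj => (pinch i j).2 (by simpa using hj))
  have h3 := tvDist_pi_map_le (fun i => gaussianReal (μ i) (v i).toNNReal)
    (fun _ => gaussianReal 0 (1 : ℝ).toNNReal) hm
  have h4 := abs_tvDist_pi_sub_le _ _ (fun _ => gaussianReal 0 (1 : ℝ).toNNReal)
    (fun _ => gaussianReal 0 (1 : ℝ).toNNReal) (fun i => tvDist_nudge_le (μ i) (d i) hδ0)
    (fun _ => (tvDist_self _).le)
  set D' := tvDist (Measure.pi fun i => gaussianReal (μ i) (v i).toNNReal)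
    (Measure.pi fun _ : Fin n => gaussianReal 0 (1 : ℝ).toNNReal)
  set D := tvDist (Measure.pi fun i => gaussianReal (μ i) (d i).toNNReal)
    (Measure.pi fun _ : Fin n => gaussianReal 0 (1 : ℝ).toNNReal)
  have hn : (0 : ℝ) ≤ n := Nat.cast_nonneg n
  have a1 := abs_le.1 h1
  have a4 := abs_le.1 h4
  -- The 23nδ collects 2nδ for the truncated normal law on both sides, 20nδ for the cells and nδ for
  -- the nudged variances. The term with ηn² comes from replacing D' by D + nδ.
  have b1 : (n : ℝ) * (6 * Real.exp (-(K / 16)) + 6 * Real.exp (-(K / 16))) ≤ 2 * (n * δ) := by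
    nlinarith
  have b2 : (n : ℝ) * η * D' ≤ n * η * (D + n * δ) :=
    mul_le_mul_of_nonneg_left (by linarith [a4.2]) (by positivity)
  refine abs_le.2 ⟨?_, ?_⟩
  · linarith [a1.1, a1.2, a4.1, a4.2]
  · have : 0 ≤ tvDist (Measure.pi fun i => gaussianReal (μ i) (d i).toNNReal)
        (Measure.pi fun _ : Fin n => gaussianReal 0 (1 : ℝ).toNNReal) := tvDist_nonneg _ _
    have c1 : 0 ≤ n * η * D := by positivity
    have c2 : 0 ≤ (n : ℝ) * η * n * δ := by positivity
    have c3 : 0 ≤ (n : ℝ) * δ := by positivity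
    linarith [a1.1, a1.2, a4.1, a4.2]

end Accuracy

/-! ### Choice of tolerance, mesh and number of terms. -/

section Parameters

variable {n : ℕ} {μ d : Fin n → ℝ}

/-- The distance of the product of the `N(μ i, d i)` from the standard normal law. -/
noncomputable def gaussDist (μ d : Fin n → ℝ) : ℝ :=
  tvDist (Measure.pi fun i => gaussianReal (μ i) (d i).toNNReal)
    (Measure.pi fun _ : Fin n => gaussianReal 0 (1 : ℝ).toNNReal)

theorem sum_gaussGap_le (hd : ∀ i, 0 < d i) :
    ∑ i, gaussGap (μ i) (d i) ≤ 15 * n * gaussDist μ d := by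
  have := Finset.sum_le_card_nsmul Finset.univ (fun i => gaussGap (μ i) (d i))
    (15 * gaussDist μ d) fun i _ => (gaussGap_le_tvDist (hd i)).trans
      (mul_le_mul_of_nonneg_left (tvDist_le_tvDist_pi
        (fun i => gaussianReal (μ i) (d i).toNNReal)
        (fun _ : Fin n => gaussianReal 0 (1 : ℝ).toNNReal) i) (by norm_num))
  simp only [Finset.card_univ, Fintype.card_fin, nsmul_eq_mul] at this
  linarith

/-- Subadditivity over the coordinates, then Cauchy–Schwarz. -/
theorem sq_gaussDist_le (hd : ∀ i, 0 < d i) :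
    gaussDist μ d ^ 2 ≤ 49 * n * ∑ i, gaussGap (μ i) (d i) := by
  have h1 := tvDist_pi_le (fun i => gaussianReal (μ i) (d i).toNNReal)
    (fun _ : Fin n => gaussianReal 0 (1 : ℝ).toNNReal)
  have h2 := sq_sum_le_card_mul_sum_sq (s := (Finset.univ : Finset (Fin n)))
    (f := fun i => tvDist (gaussianReal (μ i) (d i).toNNReal) (gaussianReal 0 (1 : ℝ).toNNReal))
  have h3 := Finset.sum_le_sum fun i (_ : i ∈ Finset.univ) =>
    sq_tvDist_gaussianReal_std_le (m := μ i) (hd i)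
  rw [← Finset.mul_sum] at h3
  rw [Finset.card_univ, Fintype.card_fin] at h2
  have h4 := pow_le_pow_left₀ (tvDist_nonneg _ _) h1 2
  have h5 := mul_le_mul_of_nonneg_left h3 (Nat.cast_nonneg (α := ℝ) n)
  unfold gaussDist
  linarith

/-- The additive accuracy of the tables. -/
noncomputable def tol (ε : ℝ) (μ d : Fin n → ℝ) : ℝ :=
  ε * (∑ i, gaussGap (μ i) (d i)) / (n * n) / 2000

variable {ε : ℝ}

/-- In dimension 0 both products are the same measure. -/
theorem pos_of_gaussDist_pos (hD : 0 < gaussDist μ d) : 0 < n := by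
  rcases Nat.eq_zero_or_pos n with rfl | h
  · have : gaussDist μ d = 0 := by
      unfold gaussDist
      convert! tvDist_self _ using 2
      exact Measure.ext fun s _ => by congr 2; exact Subsingleton.elim _ _
    linarith
  · exact h

theorem gaussDist_le_one : gaussDist μ d ≤ 1 := tvDist_le_one _ _

/-- The additive errors of all coordinates together stay a small multiple of εD. -/
theorem tol_le (hd : ∀ i, 0 < d i) (hε : 0 < ε) (hD : 0 < gaussDist μ d) :
    n * tol ε μ d ≤ 15 * ε * gaussDist μ d / 2000 := by
  have hn : (0 : ℝ) < n := Nat.cast_pos.2 (pos_of_gaussDist_pos hD)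
  have h := sum_gaussGap_le (μ := μ) hd
  have e : n * tol ε μ d = ε * (∑ i, gaussGap (μ i) (d i)) / n / 2000 := by
    unfold tol
    field_simp
  rw [e]
  refine div_le_div_of_nonneg_right ?_ (by norm_num)
  rw [div_le_iff₀ hn]
  nlinarith

/-- A polynomial lower bound, so that log(1/δ) is of the order of log(2n/(εD)). The constant is
49·2000. -/
theorem le_tol (hd : ∀ i, 0 < d i) (hε : 0 < ε) (hD : 0 < gaussDist μ d) :
    ε * gaussDist μ d ^ 2 / (98000 * n ^ 3) ≤ tol ε μ d := by
  have hn : (0 : ℝ) < n := Nat.cast_pos.2 (pos_of_gaussDist_pos hD)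
  have h := sq_gaussDist_le (μ := μ) hd
  unfold tol
  rw [div_div, div_le_div_iff₀ (by positivity) (by positivity)]
  have := mul_le_mul_of_nonneg_left h (by positivity : 0 ≤ ε * n ^ 2 * 2000)
  linarith

theorem tol_pos (hd : ∀ i, 0 < d i) (hε : 0 < ε) (hD : 0 < gaussDist μ d) : 0 < tol ε μ d := by
  have hn : (0 : ℝ) < n := Nat.cast_pos.2 (pos_of_gaussDist_pos hD)
  exact lt_of_lt_of_le (by positivity) (le_tol hd hε hD)

/-- The logarithmic factor of the bounds. -/
noncomputable def logFactor (ε : ℝ) (μ d : Fin n → ℝ) : ℝ :=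
  Real.log (2 * n / (ε * gaussDist μ d))

theorem two_le_ratio (hε : 0 < ε) (hε1 : ε < 1) (hD : 0 < gaussDist μ d) :
    2 ≤ 2 * n / (ε * gaussDist μ d) := by
  have hn : (1 : ℝ) ≤ n := Nat.one_le_cast.2 (pos_of_gaussDist_pos hD)
  rw [le_div_iff₀ (by positivity)]
  have : ε * gaussDist μ d ≤ 1 := mul_le_one₀ hε1.le hD.le gaussDist_le_one
  linarith

theorem half_le_logFactor (hε : 0 < ε) (hε1 : ε < 1) (hD : 0 < gaussDist μ d) :
    1 / 2 ≤ logFactor ε μ d := by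
  have h := Real.log_le_log two_pos (two_le_ratio (μ := μ) (d := d) hε hε1 hD)
  have := Real.log_two_gt_d9
  unfold logFactor
  norm_num at this
  linarith

/-- With X = 2n/(εD) ≥ 2, constants are absorbed into powers of X: 1/δ ≤ 98000n³/(εD²) ≤ 12250·X³ ≤
2^14·X³ ≤ X^17. -/
theorem log_inv_tol_le (hd : ∀ i, 0 < d i) (hε : 0 < ε) (hε1 : ε < 1) (hD : 0 < gaussDist μ d) :
    Real.log (1 / tol ε μ d) ≤ 17 * logFactor ε μ d := by
  have hn : (0 : ℝ) < n := Nat.cast_pos.2 (pos_of_gaussDist_pos hD)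
  have h2 := two_le_ratio (μ := μ) (d := d) hε hε1 hD
  have hδ := tol_pos hd hε hD
  have e : 17 * logFactor ε μ d = Real.log ((2 * n / (ε * gaussDist μ d)) ^ 17) := by
    rw [Real.log_pow, logFactor]
    norm_num
  rw [e]
  refine Real.log_le_log (by positivity) ?_
  have h3 : 1 / tol ε μ d ≤ 98000 * n ^ 3 / (ε * gaussDist μ d ^ 2) := by
    have := one_div_le_one_div_of_le (by positivity) (le_tol hd hε hD)
    rwa [one_div_div] at this
  refine h3.trans ?_
  have h14 := pow_le_pow_left₀ zero_le_two h2 14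
  have hX3 : 8 * n ^ 3 / (ε * gaussDist μ d ^ 2) ≤ (2 * n / (ε * gaussDist μ d)) ^ 3 := by
    rw [div_pow, mul_pow, mul_pow]
    norm_num
    refine div_le_div_of_nonneg_left (by positivity) (by positivity) ?_
    have a1 : ε ^ 3 ≤ ε := pow_le_of_le_one hε.le hε1.le (by norm_num)
    have a2 : gaussDist μ d ^ 3 ≤ gaussDist μ d ^ 2 :=
      pow_le_pow_of_le_one hD.le gaussDist_le_one (by norm_num)
    exact mul_le_mul a1 a2 (by positivity) hε.le
  calc 98000 * (n : ℝ) ^ 3 / (ε * gaussDist μ d ^ 2)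
      = 12250 * (8 * n ^ 3 / (ε * gaussDist μ d ^ 2)) := by ring
    _ ≤ 2 ^ 14 * (2 * n / (ε * gaussDist μ d)) ^ 3 :=
        mul_le_mul (by norm_num) hX3 (by positivity) (by positivity)
    _ ≤ (2 * n / (ε * gaussDist μ d)) ^ 14 * (2 * n / (ε * gaussDist μ d)) ^ 3 :=
        mul_le_mul_of_nonneg_right h14 (by positivity)
    _ = _ := by rw [← pow_add]

/-- The relative width of the cells. -/
noncomputable def mesh (ε : ℝ) (n : ℕ) : ℝ := ε / n / 24

theorem mesh_pos (hε : 0 < ε) (hn : 0 < n) : 0 < mesh ε n := by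
  have : (0 : ℝ) < n := Nat.cast_pos.2 hn
  unfold mesh; positivity

theorem mesh_le_one (hε : 0 < ε) (hε1 : ε < 1) (hn : 0 < n) : mesh ε n ≤ 1 := by
  have : (1 : ℝ) ≤ n := Nat.one_le_cast.2 hn
  unfold mesh
  rw [div_div, div_le_one (by positivity)]
  linarith

theorem log_inv_mesh_le (hε : 0 < ε) (hε1 : ε < 1) (hD : 0 < gaussDist μ d) :
    Real.log (1 / mesh ε n) ≤ 5 * logFactor ε μ d := by
  have hn : (0 : ℝ) < n := Nat.cast_pos.2 (pos_of_gaussDist_pos hD)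
  have h2 := two_le_ratio (μ := μ) (d := d) hε hε1 hD
  have e : 5 * logFactor ε μ d = Real.log ((2 * n / (ε * gaussDist μ d)) ^ 5) := by
    rw [Real.log_pow, logFactor]
    norm_num
  rw [e]
  refine Real.log_le_log (one_div_pos.2 (mesh_pos hε (pos_of_gaussDist_pos hD))) ?_
  have h4 := pow_le_pow_left₀ zero_le_two h2 4
  have hX : 2 * n / ε ≤ 2 * n / (ε * gaussDist μ d) :=
    div_le_div_of_nonneg_left (by positivity) (by positivity)
      (mul_le_of_le_one_right hε.le gaussDist_le_one)
  calc 1 / mesh ε n = 12 * (2 * n / ε) := by unfold mesh; field_simp; norm_num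
    _ ≤ 2 ^ 4 * (2 * n / (ε * gaussDist μ d)) :=
        mul_le_mul (by norm_num) hX (by positivity) (by positivity)
    _ ≤ (2 * n / (ε * gaussDist μ d)) ^ 4 * (2 * n / (ε * gaussDist μ d)) :=
        mul_le_mul_of_nonneg_right h4 (by positivity)
    _ = _ := by rw [← pow_succ]

/-- The geometric sequence of levels falls below `tol` after few steps. -/
theorem level_count_le (hd : ∀ i, 0 < d i) (hε : 0 < ε) (hε1 : ε < 1) (hD : 0 < gaussDist μ d)
    {k : ℕ} (hk : tol ε μ d < 1 / mesh ε n / (1 + mesh ε n) ^ k) :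
    (k : ℝ) ≤ 1056 * (n / ε * logFactor ε μ d) := by
  have hn0 := pos_of_gaussDist_pos hD
  have hn : (0 : ℝ) < n := Nat.cast_pos.2 hn0
  have hη := mesh_pos hε hn0
  have hη1 := mesh_le_one hε hε1 hn0
  have hδ := tol_pos hd hε hD
  rw [lt_div_iff₀ (by positivity)] at hk
  have h1 : (1 + mesh ε n) ^ k ≤ 1 / mesh ε n * (1 / tol ε μ d) := by
    rw [mul_one_div, le_div_iff₀ hδ]
    linarith
  have h2 := Real.log_le_log (by positivity) h1
  rw [Real.log_pow, Real.log_mul (by positivity) (by positivity)] at h2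
  -- For 0 < η ≤ 1, log(1 + η) ≥ 1 - 1/(1 + η) = η/(1 + η) ≥ η/2.
  have h3 : mesh ε n / 2 ≤ Real.log (1 + mesh ε n) := by
    have := Real.one_sub_inv_le_log_of_pos (x := 1 + mesh ε n) (by positivity)
    refine le_trans ?_ this
    rw [← one_div, one_sub_div (by positivity), le_div_iff₀ (by positivity)]
    nlinarith
  have h4 := log_inv_tol_le hd hε hε1 hD
  have h5 := log_inv_mesh_le hε hε1 hD
  have h6 : (k : ℝ) * (mesh ε n / 2) ≤ 22 * logFactor ε μ d := by
    have := mul_le_mul_of_nonneg_left h3 (Nat.cast_nonneg (α := ℝ) k)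
    linarith
  -- The constant 1056 is 22·48, with 22 = 17 + 5 from the two logarithms and 48 = 2·24 from
  -- inverting half the mesh.
  have e : (k : ℝ) = k * (mesh ε n / 2) * (48 * (n / ε)) := by
    unfold mesh
    field_simp
    ring
  rw [e]
  have := mul_le_mul_of_nonneg_right h6 (by positivity : 0 ≤ 48 * ((n : ℝ) / ε))
  linarith

theorem abs_tables_sub_gaussDist_le (hd : ∀ i, 0 < d i) (hε : 0 < ε) (hε1 : ε < 1)
    (hD : 0 < gaussDist μ d) {J K : ℕ} (hJ : 1 / mesh ε n / (1 + mesh ε n) ^ J ≤ tol ε μ d)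
    (hK : 2 ≤ K) (hK' : 32 * Real.log (1 / tol ε μ d) ≤ K) :
    |tvDist
        (Measure.pi fun i => leftLaw K (μ i) (nudge (tol ε μ d) (d i)) (2 * J)
          (level (1 / mesh ε n) (1 + mesh ε n) J))
        (Measure.pi fun i => rightLaw K (μ i) (nudge (tol ε μ d) (d i)) (2 * J)
          (level (1 / mesh ε n) (1 + mesh ε n) J)) - gaussDist μ d| ≤ ε / 3 * gaussDist μ d := by
  have hn0 := pos_of_gaussDist_pos hD
  have hn : (1 : ℝ) ≤ n := Nat.one_le_cast.2 hn0
  have hη := mesh_pos hε hn0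
  have hη1 := mesh_le_one hε hε1 hn0
  have hδ := tol_pos hd hε hD
  have hnδ := tol_le hd hε hD
  have hεD : ε * gaussDist μ d ≤ 1 := mul_le_one₀ hε1.le hD.le gaussDist_le_one
  have hδ' : tol ε μ d ≤ 3 / 400 := by nlinarith
  -- The outermost level 1/η is at least 1, above the tolerance, so at least one step is needed.
  have hJ0 : 0 < J := by
    rcases Nat.eq_zero_or_pos J with rfl | h
    · rw [pow_zero, div_one, div_le_iff₀ hη] at hJ
      nlinarith
    · exact h
  -- The innermost level has exponent J - 1, one step before the tolerance is reached, and one step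
  -- changes it by the factor 1 + η ≤ 2.
  have hlast : 1 / mesh ε n / (1 + mesh ε n) ^ (J - 1) ≤ 2 * tol ε μ d := by
    have e : 1 / mesh ε n / (1 + mesh ε n) ^ (J - 1) =
        1 / mesh ε n / (1 + mesh ε n) ^ J * (1 + mesh ε n) := by
      obtain ⟨k, rfl⟩ : ∃ k, J = k + 1 := ⟨J - 1, by omega⟩
      rw [Nat.add_sub_cancel, pow_succ]
      field_simp
    rw [e]
    nlinarith
  -- K ≥ 32 log(1/δ) gives e^(-K/16) ≤ δ², and 6δ² ≤ δ for δ ≤ 3/400.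
  have hKδ : 6 * Real.exp (-((K : ℝ) / 16)) ≤ tol ε μ d := by
    have h1 : Real.exp (-((K : ℝ) / 16)) ≤ Real.exp (Real.log (tol ε μ d) * 2) := by
      refine Real.exp_le_exp.2 ?_
      rw [one_div, Real.log_inv] at hK'
      linarith
    rw [show Real.log (tol ε μ d) * 2 = ((2 : ℕ) : ℝ) * Real.log (tol ε μ d) by push_cast; ring,
      Real.exp_nat_mul, Real.exp_log hδ] at h1
    nlinarith
  have h := abs_tvDist_tables_sub_le μ d hd hJ0 hK hη hη1 hδ (by linarith) hlast hKδ
  refine h.trans ?_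
  have e1 : 2 * n * mesh ε n = ε / 12 := by
    unfold mesh
    field_simp
    norm_num
  rw [e1]
  change ε / 12 * gaussDist μ d + _ ≤ _
  -- The cells cost εD/12. The additive part is at most (23 + 1/12)nδ with nδ ≤ 15εD/2000, less than
  -- εD/4.
  nlinarith [mul_nonneg hε.le (mul_nonneg (by linarith : (0 : ℝ) ≤ n) hδ.le), mul_pos hε hD]

end Parameters

/-! ### Program logic, and subroutines for the distribution function. -/

namespace RealRAM

/-- Started in `σ`, the program halts after at most `B` operations in a configuration satisfying
`Post`. -/
def Prog.Reach (p : Prog) (σ : State) (B : ℕ) (Post : State → Prop) : Prop :=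
  ∃ (τ : State) (T : ℕ), p.Runs σ τ T ∧ T ≤ B ∧ Post τ

theorem Prog.Reach.mono {p : Prog} {σ : State} {B B' : ℕ} {Post Post' : State → Prop}
    (h : p.Reach σ B Post) (hB : B ≤ B') (hP : ∀ τ, Post τ → Post' τ) : p.Reach σ B' Post' := by
  obtain ⟨τ, T, hr, hT, hp⟩ := h
  exact ⟨τ, T, hr, hT.trans hB, hP τ hp⟩

theorem reach_skip {σ : State} {Post : State → Prop} (h : Post σ) : Prog.skip.Reach σ 1 Post :=
  ⟨σ, 1, .skip σ, le_rfl, h⟩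

theorem Prog.Reach.seq {p q : Prog} {σ : State} {B B' : ℕ} {Mid Post : State → Prop}
    (hp : p.Reach σ B Mid) (hq : ∀ τ, Mid τ → q.Reach τ B' Post) :
    (Prog.seq p q).Reach σ (B + B') Post := by
  obtain ⟨τ, T, hr, hT, hm⟩ := hp
  obtain ⟨τ', T', hr', hT', hm'⟩ := hq τ hm
  exact ⟨τ', T + T', .seq hr hr', add_le_add hT hT', hm'⟩

theorem reach_ite {b : Test} {p q : Prog} {σ : State} {B : ℕ} {Post : State → Prop}
    (hp : b.Holds σ → p.Reach σ B Post) (hq : ¬ b.Holds σ → q.Reach σ B Post) :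
    (Prog.ite b p q).Reach σ (B + 1) Post := by
  by_cases hb : b.Holds σ
  · obtain ⟨τ, T, hr, hT, hm⟩ := hp hb
    exact ⟨τ, T + 1, .ite_true hb hr, Nat.succ_le_succ hT, hm⟩
  · obtain ⟨τ, T, hr, hT, hm⟩ := hq hb
    exact ⟨τ, T + 1, .ite_false hb hr, Nat.succ_le_succ hT, hm⟩

/-- A loop with invariant `Inv k` after `k` rounds, of which there are at most `N`. -/
theorem reach_while {b : Test} {p : Prog} {B N : ℕ} {Inv : ℕ → State → Prop}
    (body : ∀ k σ, Inv k σ → b.Holds σ → k < N ∧ p.Reach σ B (Inv (k + 1))) {σ : State}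
    (h0 : Inv 0 σ) :
    (Prog.while b p).Reach σ ((B + 1) * N + 1) fun τ => ∃ k ≤ N, Inv k τ ∧ ¬ b.Holds τ := by
  -- Induction on the number of rounds left. When none is left the test must fail, since a further
  -- round would need k < N.
  suffices H : ∀ r k σ, k + r = N → Inv k σ →
      (Prog.while b p).Reach σ ((B + 1) * r + 1) fun τ => ∃ k ≤ N, Inv k τ ∧ ¬ b.Holds τ from
    H N 0 σ (Nat.zero_add N) h0
  intro r
  induction r with
  | zero =>
    intro k σ hk hI
    by_cases hb : b.Holds σ
    · have := (body k σ hI hb).1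
      omega
    · exact ⟨σ, 1, .while_false hb, by omega, k, by omega, hI, hb⟩
  | succ r ih =>
    intro k σ hk hI
    by_cases hb : b.Holds σ
    · obtain ⟨τ, T, hr, hT, hm⟩ := (body k σ hI hb).2
      obtain ⟨τ', T', hr', hT', hm'⟩ := ih (k + 1) τ (by omega) hm
      refine ⟨τ', T + T' + 1, .while_true hb hr hr', ?_, hm'⟩
      rw [Nat.mul_succ]
      omega
    · exact ⟨σ, 1, .while_false hb, by omega, k, by omega, hI, hb⟩

/-- Straight-line programs. -/
def block : List Instr → Prog
  | [] => .skip
  | i :: l => .seq (.instr i) (block l)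

/-- The effect of a straight-line program. -/
noncomputable def runBlock : List Instr → State → State
  | [], σ => σ
  | i :: l, σ => runBlock l (i.next σ)

/-- All instructions of a straight-line program are defined where they are executed. -/
def BlockDefined : List Instr → State → Prop
  | [], _ => True
  | i :: l, σ => i.Defined σ ∧ BlockDefined l (i.next σ)

theorem reach_block {l : List Instr} {σ : State} {Post : State → Prop} (hd : BlockDefined l σ)
    (h : Post (runBlock l σ)) : (block l).Reach σ (l.length + 1) Post := by
  induction l generalizing σ with
  | nil => exact reach_skip h
  | cons i l ih =>
    have h1 : (Prog.instr i).Reach σ 1 fun τ => τ = i.next σ :=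
      ⟨_, 1, .instr i σ hd.1, le_rfl, rfl⟩
    refine (h1.seq (B' := l.length + 1) fun τ hτ => ?_).mono (by rw [List.length_cons]; omega)
      fun _ h => h
    rw [hτ]
    exact ih hd.2 h

/-- The subroutines leave the memory and the named registers alone. -/
structure Frame (b : ℕ) (σ τ : State) : Prop where
  mem : τ.mem = σ.mem
  idx : ∀ x, x ≠ 7 → τ.idx x = σ.idx x
  reg : ∀ r, r < b → τ.reg r = σ.reg r

theorem Frame.trans {b : ℕ} {σ τ υ : State} (h : Frame b σ τ) (h' : Frame b τ υ) : Frame b σ υ :=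
  ⟨h'.mem.trans h.mem, fun x hx => (h'.idx x hx).trans (h.idx x hx),
    fun r hr => (h'.reg r hr).trans (h.reg r hr)⟩

theorem Frame.weaken {b b' : ℕ} {σ τ : State} (h : Frame b σ τ) (hb : b' ≤ b) : Frame b' σ τ :=
  ⟨h.mem, h.idx, fun r hr => h.reg r (hr.trans_le hb)⟩

/-- The instruction writes to index register `7` or to a real register from `b` on. -/
def Instr.Scratch (b : ℕ) : Instr → Prop
  | .idxConst x _ | .idxCopy x _ | .idxAdd x _ _ | .idxSub x _ _ => x = 7
  | .const r _ | .ofIdx r _ | .copy r _ | .add r _ _ | .sub r _ _ | .mul r _ _ | .div r _ _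
  | .log r _ | .sqrt r _ | .load r _ _ => b ≤ r
  | .store _ _ _ => False

theorem Instr.Scratch.frame {b : ℕ} {i : Instr} (h : i.Scratch b) (σ : State) :
    Frame b σ (i.next σ) := by
  cases i <;> simp only [Instr.Scratch] at h
  all_goals
    refine ⟨rfl, fun x hx => ?_, fun r hr => ?_⟩ <;>
      simp only [Instr.next, State.setIdx, State.setReg]
  all_goals exact Function.update_of_ne (by omega) _ _

theorem frame_runBlock {b : ℕ} {l : List Instr} (h : ∀ i ∈ l, i.Scratch b) (σ : State) :
    Frame b σ (runBlock l σ) := by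
  induction l generalizing σ with
  | nil => exact ⟨rfl, fun _ _ => rfl, fun _ _ => rfl⟩
  | cons i l ih =>
    exact ((h i (List.mem_cons_self ..)).frame σ).trans
      (ih (fun k hk => h k (List.mem_cons_of_mem _ hk)) _)

/-- Sum the Taylor polynomial: register `31` becomes `truncInt K` of register `30`, where `K` is in
index register `4`. -/
def taylorProg : Prog :=
  .seq
    -- Register 31 still holds 0 at the last instruction, which therefore negates x²/2.
    (block [.idxConst 7 0, .const 31 0, .copy 32 30, .mul 33 30 30, .const 34 2, .div 33 33 34,
      .sub 33 31 33])
    (.while (.idxLt 7 4)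
      (block [.ofIdx 34 7, .add 35 34 34, .add 35 35 1, .div 35 32 35, .add 31 31 35,
        .add 34 34 1, .mul 32 32 33, .div 32 32 34, .idxAdd 7 7 5]))

theorem reach_taylorProg {σ : State} (h1 : σ.reg 1 = 1) (h5 : σ.idx 5 = 1) :
    taylorProg.Reach σ (11 * σ.idx 4 + 9) fun τ =>
      Frame 31 σ τ ∧ τ.reg 31 = truncInt (σ.idx 4) (σ.reg 30) := by
  set K := σ.idx 4 with hK
  set x := σ.reg 30 with hx
  have init : (block [.idxConst 7 0, .const 31 0, .copy 32 30, .mul 33 30 30, .const 34 2,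
      .div 33 33 34, .sub 33 31 33]).Reach σ 8 fun τ => Frame 31 σ τ ∧ τ.idx 7 = 0 ∧
        τ.reg 31 = 0 ∧ τ.reg 32 = x ∧ τ.reg 33 = -(x ^ 2 / 2) := by
    refine reach_block ?_ ?_
    · simp [BlockDefined, Instr.Defined, Instr.next, State.setIdx, State.setReg]
    · refine ⟨frame_runBlock (by simp [Instr.Scratch]) σ, ?_⟩
      · simp [runBlock, Instr.next, State.setIdx, State.setReg]
        exact ⟨rfl, by rw [hx]; ring⟩
  refine (init.seq fun σ₁ h => ?_).mono (B := 8 + ((10 + 1) * K + 1)) (by omega) fun _ h => h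
  -- Register 32 carries the current term before division by 2k + 1, so each term costs a constant
  -- number of operations.
  refine (reach_while (B := 10) (N := K) (Inv := fun k τ => Frame 31 σ τ ∧ τ.idx 7 = k ∧
    τ.reg 31 = ∑ i ∈ Finset.range k, x * (-(x ^ 2 / 2)) ^ i / i.factorial / (2 * i + 1) ∧
    τ.reg 32 = x * (-(x ^ 2 / 2)) ^ k / k.factorial ∧ τ.reg 33 = -(x ^ 2 / 2)) ?_ ?_).mono le_rfl ?_
  · rintro k τ ⟨hf, hk, h31, h32, h33⟩ hb
    have hb' : τ.idx 7 < τ.idx 4 := hb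
    rw [hk, hf.idx 4 (by norm_num)] at hb'
    refine ⟨hb', reach_block ?_ ?_⟩
    · simp [BlockDefined, Instr.Defined, Instr.next, State.setReg, hf.reg 1 (by norm_num), h1, hk]
      constructor <;> positivity
    · refine ⟨hf.trans (frame_runBlock (by simp [Instr.Scratch]) τ), ?_⟩
      · simp [runBlock, Instr.next, State.setIdx, State.setReg, hf.reg 1 (by norm_num), h1, hk, hf.idx 5 (by norm_num), h5,
          h31, h32, h33]
        refine ⟨?_, ?_⟩
        · rw [Finset.sum_range_succ, two_mul]
        · rw [Nat.factorial_succ, pow_succ (-(x ^ 2 / 2))]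
          push_cast
          rw [mul_comm ((k : ℝ) + 1), ← div_div]
          congr 1
          ring
  · exact ⟨h.1, h.2.1, by simpa using h.2.2.1, by simpa using h.2.2.2.1, h.2.2.2.2⟩
  · rintro τ ⟨k, hkN, ⟨hf, hk, h31, -, -⟩, hb⟩
    have hb' : ¬ τ.idx 7 < τ.idx 4 := hb
    rw [hk, hf.idx 4 (by norm_num)] at hb'
    have : k = K := by omega
    refine ⟨hf, ?_⟩
    rw [h31, this]
    rfl

/-- The registers that hold the parameters of `truncCdf`. -/
structure Consts (K : ℕ) (σ : State) : Prop where
  idx4 : σ.idx 4 = K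
  idx5 : σ.idx 5 = 1
  reg1 : σ.reg 1 = 1
  reg7 : σ.reg 7 = cutoff K
  reg8 : σ.reg 8 = -cutoff K
  reg9 : σ.reg 9 = 2 * truncInt K (cutoff K)

theorem Consts.of_eq {K : ℕ} {σ τ : State} (h : Consts K σ) (h4 : τ.idx 4 = σ.idx 4)
    (h5 : τ.idx 5 = σ.idx 5) (hr : ∀ r, r < 10 → τ.reg r = σ.reg r) : Consts K τ :=
  ⟨h4.trans h.idx4, h5.trans h.idx5, (hr 1 (by norm_num)).trans h.reg1,
    (hr 7 (by norm_num)).trans h.reg7, (hr 8 (by norm_num)).trans h.reg8,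
    (hr 9 (by norm_num)).trans h.reg9⟩

theorem Consts.frame {K b : ℕ} {σ τ : State} (h : Consts K σ) (hf : Frame b σ τ) (hb : 10 ≤ b) :
    Consts K τ :=
  h.of_eq (hf.idx 4 (by norm_num)) (hf.idx 5 (by norm_num)) fun r hr => hf.reg r (hr.trans_le hb)

/-- Register `31` becomes `truncCdf K` of register `30`. -/
def cdfProg : Prog :=
  .seq (.ite (.lt 7 30) (block [.copy 30 7]) .skip)
    (.seq (.ite (.lt 30 8) (block [.copy 30 8]) .skip) (.seq taylorProg (block [.div 31 31 9])))

theorem reach_cdfProg {K : ℕ} (hK : 2 ≤ K) {σ : State} (hc : Consts K σ) :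
    cdfProg.Reach σ (11 * K + 17) fun τ =>
      Frame 30 σ τ ∧ τ.reg 31 = truncCdf K (σ.reg 30) := by
  have hT := truncInt_cutoff_pos hK
  have s1 : (Prog.ite (.lt 7 30) (block [.copy 30 7]) .skip).Reach σ 3 fun τ =>
      Frame 30 σ τ ∧ τ.reg 30 = min (cutoff K) (σ.reg 30) := by
    refine reach_ite (fun hb => ?_) fun hb => ?_
    · have hb' : σ.reg 7 < σ.reg 30 := hb
      rw [hc.reg7] at hb'
      refine reach_block ⟨trivial, trivial⟩ ⟨frame_runBlock (by simp [Instr.Scratch]) _, ?_⟩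
      · simp [runBlock, Instr.next, State.setReg, hc.reg7, min_eq_left hb'.le]
    · have hb' : ¬ σ.reg 7 < σ.reg 30 := hb
      rw [hc.reg7, not_lt] at hb'
      exact (reach_skip ⟨⟨rfl, fun _ _ => rfl, fun _ _ => rfl⟩,
        (min_eq_right hb').symm⟩).mono one_le_two fun _ h => h
  have s2 : ∀ σ₁, Frame 30 σ σ₁ ∧ σ₁.reg 30 = min (cutoff K) (σ.reg 30) →
      (Prog.ite (.lt 30 8) (block [.copy 30 8]) .skip).Reach σ₁ 3 fun τ =>
      Frame 30 σ τ ∧ τ.reg 30 = max (-cutoff K) (min (cutoff K) (σ.reg 30)) := by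
    rintro σ₁ ⟨hf, h30⟩
    have hc₁ := hc.frame hf (by norm_num)
    refine reach_ite (fun hb => ?_) fun hb => ?_
    · have hb' : σ₁.reg 30 < σ₁.reg 8 := hb
      rw [hc₁.reg8, h30] at hb'
      refine reach_block ⟨trivial, trivial⟩
        ⟨hf.trans (frame_runBlock (by simp [Instr.Scratch]) _), ?_⟩
      · simp only [runBlock, Instr.next, State.setReg, Function.update_self, hc₁.reg8,
          max_eq_left hb'.le]
    · have hb' : ¬ σ₁.reg 30 < σ₁.reg 8 := hb
      rw [hc₁.reg8, h30, not_lt] at hb'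
      exact (reach_skip ⟨hf, h30.trans (max_eq_right hb').symm⟩).mono one_le_two fun _ h => h
  refine (s1.seq fun σ₁ h₁ => (s2 σ₁ h₁).seq (B' := 11 * K + 9 + 2) fun σ₂ h₂ => ?_).mono
    (by omega) fun _ h => h
  have hc₂ := hc.frame h₂.1 (by norm_num)
  have s3 := reach_taylorProg hc₂.reg1 hc₂.idx5
  rw [hc₂.idx4] at s3
  refine s3.seq fun σ₃ h₃ => ?_
  have hc₃ := hc₂.frame h₃.1 (by norm_num)
  refine reach_block ⟨?_, trivial⟩ ⟨(h₂.1.trans (h₃.1.weaken (by norm_num))).trans (frame_runBlock (by simp [Instr.Scratch]) _), ?_⟩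
  · have h9 : σ₃.reg 9 ≠ 0 := by rw [hc₃.reg9]; positivity
    exact h9
  · simp only [runBlock, Instr.next, State.setReg, Function.update_self, hc₃.reg9, h₃.2, h₂.2]
    rfl

/-- Register `25` becomes `rootCdf K v b w`, for `b` and `w` in registers `23` and `24`. -/
def rootProg : Prog :=
  .seq (block [.sub 30 24 23, .div 30 30 12])
    (.seq cdfProg
      -- Register 25 keeps the first value during the second call, which writes only to real
      -- registers from 30 on.
      (.seq (block [.copy 25 31, .const 30 0, .sub 30 30 23, .sub 30 30 24, .div 30 30 12])
        (.seq cdfProg (block [.sub 25 25 31, .add 25 25 15]))))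

theorem reach_rootProg {K : ℕ} (hK : 2 ≤ K) {v : ℝ} (hv : v ≠ 1) {σ : State} (hc : Consts K σ)
    (h12 : σ.reg 12 = v - 1) (h15 : σ.reg 15 = if v < 1 then 1 else 0) :
    rootProg.Reach σ (22 * K + 46) fun τ =>
      Frame 25 σ τ ∧ τ.reg 25 = rootCdf K v (σ.reg 23) (σ.reg 24) := by
  have hv0 : v - 1 ≠ 0 := sub_ne_zero.2 hv
  have s1 : (block [.sub 30 24 23, .div 30 30 12]).Reach σ 3 fun τ =>
      Frame 30 σ τ ∧ τ.reg 30 = (-σ.reg 23 + σ.reg 24) / (v - 1) := by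
    refine reach_block ?_ ⟨frame_runBlock (by simp [Instr.Scratch]) _, ?_⟩
    · simp [BlockDefined, Instr.Defined, Instr.next, State.setReg, h12, hv0]
    · simp [runBlock, Instr.next, State.setReg, h12, neg_add_eq_sub]
  refine (s1.seq fun σ₁ h₁ => (reach_cdfProg hK (hc.frame h₁.1 (by norm_num))).seq
    (B' := 6 + (11 * K + 17 + 3)) fun σ₂ h₂ => ?_).mono (by omega) fun _ h => h
  have f₂ := h₁.1.trans h₂.1
  have s3 : (block [.copy 25 31, .const 30 0, .sub 30 30 23, .sub 30 30 24, .div 30 30 12]).Reach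
      σ₂ 6 fun τ => Frame 25 σ τ ∧ τ.reg 30 = (-σ.reg 23 - σ.reg 24) / (v - 1) ∧
        τ.reg 25 = truncCdf K ((-σ.reg 23 + σ.reg 24) / (v - 1)) := by
    refine reach_block ?_ ⟨(f₂.weaken (b' := 25) (by norm_num)).trans (frame_runBlock (by simp [Instr.Scratch]) _),
      ?_⟩
    · simp [BlockDefined, Instr.Defined, Instr.next, State.setReg, f₂.reg, h12, hv0]
    · simp [runBlock, Instr.next, State.setReg, f₂.reg, h12, h₂.2, h₁.2]
  refine s3.seq fun σ₃ h₃ => ?_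
  refine (reach_cdfProg hK (hc.frame h₃.1 (by norm_num))).seq fun σ₄ h₄ => ?_
  refine reach_block ⟨trivial, trivial, trivial⟩ ⟨(h₃.1.trans (h₄.1.weaken (by norm_num))).trans (frame_runBlock (by simp [Instr.Scratch]) _), ?_⟩
  · simp [runBlock, Instr.next, State.setReg, h₄.1.reg, h₄.2, h₃.2.1, h₃.2.2, h₃.1.reg, h15, rootCdf]

end RealRAM

/-! ### Programs writing the tables. -/

namespace RealRAM

/-- The index registers in `I`, the real registers in `R` and the arrays in `A` are the same. -/
structure Keeps (I R A : ℕ → Prop) (σ τ : State) : Prop where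
  idx : ∀ x, I x → τ.idx x = σ.idx x
  reg : ∀ r, R r → τ.reg r = σ.reg r
  mem : ∀ a, A a → τ.mem a = σ.mem a

theorem Keeps.refl (I R A : ℕ → Prop) (σ : State) : Keeps I R A σ σ :=
  ⟨fun _ _ => rfl, fun _ _ => rfl, fun _ _ => rfl⟩

theorem Keeps.trans {I R A : ℕ → Prop} {σ τ υ : State} (h : Keeps I R A σ τ)
    (h' : Keeps I R A τ υ) : Keeps I R A σ υ :=
  ⟨fun x hx => (h'.idx x hx).trans (h.idx x hx), fun x hx => (h'.reg x hx).trans (h.reg x hx),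
    fun x hx => (h'.mem x hx).trans (h.mem x hx)⟩

theorem Keeps.weaken {I R A I' R' A' : ℕ → Prop} {σ τ : State} (h : Keeps I R A σ τ)
    (hI : ∀ x, I' x → I x) (hR : ∀ x, R' x → R x) (hA : ∀ x, A' x → A x) :
    Keeps I' R' A' σ τ :=
  ⟨fun x hx => h.idx x (hI x hx), fun x hx => h.reg x (hR x hx), fun x hx => h.mem x (hA x hx)⟩

theorem Frame.keeps {I R A : ℕ → Prop} {b : ℕ} {σ τ : State} (h : Frame b σ τ)
    (hI : ∀ x, I x → x ≠ 7) (hR : ∀ r, R r → r < b) : Keeps I R A σ τ :=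
  ⟨fun x hx => h.idx x (hI x hx), fun r hr => h.reg r (hR r hr), fun a _ => by rw [h.mem]⟩

/-- The target of the instruction is not among the registers and arrays to be kept. -/
def Instr.Avoids (I R A : ℕ → Prop) : Instr → Prop
  | .idxConst x _ | .idxCopy x _ | .idxAdd x _ _ | .idxSub x _ _ => ¬ I x
  | .const r _ | .ofIdx r _ | .copy r _ | .add r _ _ | .sub r _ _ | .mul r _ _ | .div r _ _
  | .log r _ | .sqrt r _ | .load r _ _ => ¬ R r
  | .store a _ _ => ¬ A a

theorem Instr.Avoids.keeps {I R A : ℕ → Prop} {i : Instr} (h : i.Avoids I R A) (σ : State) :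
    Keeps I R A σ (i.next σ) := by
  cases i <;> simp only [Instr.Avoids] at h
  all_goals
    refine ⟨fun x hx => ?_, fun x hx => ?_, fun x hx => ?_⟩ <;>
      simp only [Instr.next, State.setIdx, State.setReg, State.setMem]
  all_goals exact Function.update_of_ne (fun e => h (by subst e; exact hx)) _ _

theorem keeps_runBlock {I R A : ℕ → Prop} {l : List Instr} (h : ∀ i ∈ l, i.Avoids I R A)
    (σ : State) : Keeps I R A σ (runBlock l σ) := by
  induction l generalizing σ with
  | nil => exact Keeps.refl I R A σ
  | cons i l ih =>
    exact ((h i (List.mem_cons_self ..)).keeps σ).trans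
      (ih (fun k hk => h k (List.mem_cons_of_mem _ hk)) _)

/-- The registers set up for a coordinate with mean `m` and variance `v`. -/
structure Coord (K : ℕ) (m v : ℝ) (σ : State) : Prop where
  consts : Consts K σ
  reg10 : σ.reg 10 = m
  reg11 : σ.reg 11 = v
  reg12 : σ.reg 12 = v - 1
  reg13 : σ.reg 13 = Real.log v
  reg14 : σ.reg 14 = √v
  reg15 : σ.reg 15 = if v < 1 then 1 else 0
  reg20 : σ.reg 20 = m * √v

/-- Index registers kept by the loop over the levels. -/
def StepI (x : ℕ) : Prop := x ≠ 2 ∧ x ≠ 3 ∧ x ≠ 7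
/-- Real registers kept by the loop over the levels. -/
def StepR (r : ℕ) : Prop := r < 16 ∨ r = 20
/-- Arrays kept while the tables are written. -/
def StepA (a : ℕ) : Prop := a ≠ 2 ∧ a ≠ 3

theorem Coord.keeps {K : ℕ} {m v : ℝ} {σ τ : State} (h : Coord K m v σ)
    (hk : Keeps StepI StepR StepA σ τ) : Coord K m v τ := by
  have hr : ∀ r, r < 16 → τ.reg r = σ.reg r := fun r hr => hk.reg r (Or.inl hr)
  refine ⟨h.consts.of_eq (hk.idx 4 (by simp [StepI])) (hk.idx 5 (by simp [StepI]))
    fun r h => hr r (by omega), ?_, ?_, ?_, ?_, ?_, ?_, ?_⟩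
  · rw [hr 10 (by norm_num), h.reg10]
  · rw [hr 11 (by norm_num), h.reg11]
  · rw [hr 12 (by norm_num), h.reg12]
  · rw [hr 13 (by norm_num), h.reg13]
  · rw [hr 14 (by norm_num), h.reg14]
  · rw [hr 15 (by norm_num), h.reg15]
  · rw [hk.reg 20 (Or.inr rfl), h.reg20]

/-- The measure of `logRatio ≤ t` for the tables on the left. -/
noncomputable def leftCdf (K : ℕ) (m v t : ℝ) : ℝ := rootCdf K v (m * √v) (√(disc m v t))

/-- The measure of `logRatio ≤ t` for the tables on the right. -/
noncomputable def rightCdf (K : ℕ) (m v t : ℝ) : ℝ := rootCdf K v m (√v * √(disc m v t))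

/-- Process one level: write the next entry of both tables. -/
def stepProg : Prog :=
  .seq (block [.load 18 4 2, .add 18 18 18, .add 18 18 13, .mul 18 18 12, .mul 19 10 10,
      .add 18 19 18, .const 19 0])
    (.seq (.ite (.lt 18 19) (block [.copy 18 19]) .skip)
      (.seq (block [.sqrt 18 18, .mul 19 14 18, .copy 23 20, .copy 24 18])
        (.seq rootProg
          (.seq (block [.sub 21 25 16, .store 2 3 21, .copy 16 25, .copy 23 10, .copy 24 19])
            (.seq rootProg
              (block [.sub 21 25 17, .store 3 3 21, .copy 17 25, .idxAdd 3 3 5,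
                .idxAdd 2 2 5]))))))

/-- Registers 16 and 17 hold the previous values of the two distribution functions, so every table
entry is a single subtraction. -/
theorem reach_stepProg {K : ℕ} (hK : 2 ≤ K) {m v : ℝ} (hv : v ≠ 1) {σ : State}
    (hc : Coord K m v σ) :
    stepProg.Reach σ (44 * K + 120) fun τ =>
      Keeps StepI StepR StepA σ τ ∧ τ.idx 2 = σ.idx 2 + 1 ∧ τ.idx 3 = σ.idx 3 + 1 ∧
      τ.reg 16 = leftCdf K m v (σ.mem 4 (σ.idx 2)) ∧
      τ.reg 17 = rightCdf K m v (σ.mem 4 (σ.idx 2)) ∧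
      τ.mem 2 = Function.update (σ.mem 2) (σ.idx 3)
        (leftCdf K m v (σ.mem 4 (σ.idx 2)) - σ.reg 16) ∧
      τ.mem 3 = Function.update (σ.mem 3) (σ.idx 3)
        (rightCdf K m v (σ.mem 4 (σ.idx 2)) - σ.reg 17) := by
  set t := σ.mem 4 (σ.idx 2) with ht
  have s1 : (block [.load 18 4 2, .add 18 18 18, .add 18 18 13, .mul 18 18 12, .mul 19 10 10,
      .add 18 19 18, .const 19 0]).Reach σ 8 fun τ =>
      Frame 18 σ τ ∧ τ.reg 20 = σ.reg 20 ∧ τ.reg 18 = disc m v t ∧ τ.reg 19 = 0 := by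
    refine reach_block ?_ ⟨frame_runBlock (by simp [Instr.Scratch]) _, ?_, ?_, ?_⟩
    · simp [BlockDefined, Instr.Defined]
    · simp [runBlock, Instr.next, State.setReg]
    · simp [runBlock, Instr.next, State.setReg, hc.reg10, hc.reg12, hc.reg13, disc, ← ht]
      ring
    · simp [runBlock, Instr.next, State.setReg]
  -- A negative discriminant is clipped to 0 so that the square-root instruction is defined. This
  -- agrees with the value 0 of `Real.sqrt` on negative numbers.
  have s2 : ∀ σ₁, (Frame 18 σ σ₁ ∧ σ₁.reg 20 = σ.reg 20 ∧ σ₁.reg 18 = disc m v t ∧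
      σ₁.reg 19 = 0) → (Prog.ite (.lt 18 19) (block [.copy 18 19]) .skip).Reach σ₁ 3 fun τ =>
      Frame 18 σ τ ∧ τ.reg 20 = σ.reg 20 ∧ 0 ≤ τ.reg 18 ∧ √(τ.reg 18) = √(disc m v t) := by
    rintro σ₁ ⟨hf, h20, h18, h19⟩
    refine reach_ite (fun hb => ?_) fun hb => ?_
    · have hb' : σ₁.reg 18 < σ₁.reg 19 := hb
      rw [h18, h19] at hb'
      refine reach_block ⟨trivial, trivial⟩
        ⟨hf.trans (frame_runBlock (by simp [Instr.Scratch]) _), ?_⟩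
      simp [runBlock, Instr.next, State.setReg, h19, h20, Real.sqrt_eq_zero_of_nonpos hb'.le]
    · have hb' : ¬ σ₁.reg 18 < σ₁.reg 19 := hb
      rw [h18, h19, not_lt] at hb'
      exact (reach_skip ⟨hf, h20, by rw [h18]; exact hb', by rw [h18]⟩).mono one_le_two
        fun _ h => h
  have s3 : ∀ σ₂, (Frame 18 σ σ₂ ∧ σ₂.reg 20 = σ.reg 20 ∧ 0 ≤ σ₂.reg 18 ∧
      √(σ₂.reg 18) = √(disc m v t)) →
      (block [.sqrt 18 18, .mul 19 14 18, .copy 23 20, .copy 24 18]).Reach σ₂ 5 fun τ =>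
      Frame 18 σ τ ∧ τ.reg 20 = σ.reg 20 ∧ τ.reg 19 = √v * √(disc m v t) ∧
        τ.reg 23 = m * √v ∧ τ.reg 24 = √(disc m v t) := by
    rintro σ₂ ⟨hf, h20, h18, hs⟩
    refine reach_block ?_ ⟨hf.trans (frame_runBlock (by simp [Instr.Scratch]) _), ?_⟩
    · simp [BlockDefined, Instr.Defined, h18]
    · simp [runBlock, Instr.next, State.setReg, h20, hs, hf.reg, hc.reg14, hc.reg20]
  refine (s1.seq fun σ₁ h₁ => (s2 σ₁ h₁).seq fun σ₂ h₂ => (s3 σ₂ h₂).seq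
    (B' := 22 * K + 46 + (6 + (22 * K + 46 + 6))) ?_).mono (by omega) fun _ h => h
  rintro σ₃ ⟨f₃, h20, h19, h23, h24⟩
  have k₃ : Keeps StepI StepR StepA σ σ₃ := by
    refine ⟨fun x hx => f₃.idx x hx.2.2, ?_, fun a _ => by rw [f₃.mem]⟩
    rintro r (hr | rfl)
    · exact f₃.reg r (by omega)
    · exact h20
  have c₃ := hc.keeps k₃
  refine (reach_rootProg hK hv c₃.consts c₃.reg12 c₃.reg15).seq ?_
  rintro σ₄ ⟨f₄, h25⟩
  have k₄ : Keeps StepI StepR StepA σ σ₄ :=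
    k₃.trans (f₄.keeps (fun x hx => hx.2.2) fun r hr => by unfold StepR at hr; omega)
  have c₄ := hc.keeps k₄
  rw [h23, h24] at h25
  have s5 : (block [.sub 21 25 16, .store 2 3 21, .copy 16 25, .copy 23 10, .copy 24 19]).Reach
      σ₄ 6 fun τ => Keeps StepI StepR StepA σ τ ∧ τ.idx 2 = σ.idx 2 ∧ τ.idx 3 = σ.idx 3 ∧
        τ.reg 16 = leftCdf K m v t ∧ τ.reg 17 = σ.reg 17 ∧ τ.reg 23 = m ∧
        τ.reg 24 = √v * √(disc m v t) ∧ τ.mem 2 = Function.update (σ.mem 2) (σ.idx 3)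
          (leftCdf K m v t - σ.reg 16) ∧ τ.mem 3 = σ.mem 3 := by
    refine reach_block (by simp [BlockDefined, Instr.Defined])
      ⟨k₄.trans (keeps_runBlock (by simp [Instr.Avoids, StepR, StepA]) _), ?_⟩
    simp [runBlock, Instr.next, State.setReg, State.setMem, f₄.idx, f₃.idx, f₄.reg, f₃.reg,
      f₄.mem, f₃.mem, h25, hc.reg10, h19, leftCdf]
  refine s5.seq ?_
  rintro σ₅ ⟨k₅, i2, i3, h16, h17, h23', h24', m2, m3⟩
  have c₅ := hc.keeps k₅
  refine (reach_rootProg hK hv c₅.consts c₅.reg12 c₅.reg15).seq ?_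
  rintro σ₆ ⟨f₆, h25'⟩
  have k₆ : Keeps StepI StepR StepA σ σ₆ :=
    k₅.trans (f₆.keeps (fun x hx => hx.2.2) fun r hr => by unfold StepR at hr; omega)
  rw [h23', h24'] at h25'
  refine reach_block (by simp [BlockDefined, Instr.Defined])
    ⟨k₆.trans (keeps_runBlock (by simp [Instr.Avoids, StepI, StepR, StepA]) _), ?_⟩
  simp [runBlock, Instr.next, State.setReg, State.setMem, State.setIdx, f₆.idx, f₆.reg,
      f₆.mem, h25', h16, h17, i2, i3, m2, m3, c₅.consts.idx5, rightCdf]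

/-- Overwrite `g` by `h` on the `j` cells from `p` on. -/
def writeRange (g : ℕ → ℝ) (p j : ℕ) (h : ℕ → ℝ) (x : ℕ) : ℝ :=
  if p ≤ x ∧ x < p + j then h (x - p) else g x

theorem writeRange_zero (g : ℕ → ℝ) (p : ℕ) (h : ℕ → ℝ) : writeRange g p 0 h = g := by
  funext x
  rw [writeRange, if_neg (by omega)]

theorem update_writeRange (g : ℕ → ℝ) (p j : ℕ) (h : ℕ → ℝ) :
    Function.update (writeRange g p j h) (p + j) (h j) = writeRange g p (j + 1) h := by
  funext x
  rw [Function.update_apply]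
  unfold writeRange
  split_ifs with h1 h2 h3 h4 h5
  · rw [h1, Nat.add_sub_cancel_left]
  · omega
  · rfl
  · omega
  · omega
  · rfl

/-- Write the tables of one coordinate. -/
def coordProg : Prog :=
  .seq (block [.load 10 0 1, .load 11 1 1])
    -- Two comparisons detect v = 1, the only case in which the variance is nudged.
    (.seq (.ite (.le 11 1) (.ite (.le 1 11) (block [.add 11 1 3]) .skip) .skip)
      (.seq (block [.sub 12 11 1, .log 13 11, .sqrt 14 11, .mul 20 10 14, .const 15 0])
        (.seq (.ite (.lt 11 1) (block [.const 15 1]) .skip)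
          (.seq (block [.const 16 0, .const 17 0, .idxConst 2 0])
            (.seq (.while (.idxLt 2 6) stepProg)
              (block [.sub 21 1 16, .store 2 3 21, .sub 21 1 17, .store 3 3 21, .idxAdd 3 3 5,
                .idxAdd 1 1 5]))))))

theorem reach_levelLoop {K : ℕ} (hK : 2 ≤ K) {m v : ℝ} (hv : v ≠ 1) {σ : State}
    (hc : Coord K m v σ) (h2 : σ.idx 2 = 0) (h16 : σ.reg 16 = 0) (h17 : σ.reg 17 = 0) :
    (Prog.while (.idxLt 2 6) stepProg).Reach σ ((44 * K + 121) * σ.idx 6 + 1) fun τ =>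
      Keeps StepI StepR StepA σ τ ∧ τ.idx 3 = σ.idx 3 + σ.idx 6 ∧
      (τ.reg 16 = if 0 < σ.idx 6 then leftCdf K m v (σ.mem 4 (σ.idx 6 - 1)) else 0) ∧
      (τ.reg 17 = if 0 < σ.idx 6 then rightCdf K m v (σ.mem 4 (σ.idx 6 - 1)) else 0) ∧
      τ.mem 2 = writeRange (σ.mem 2) (σ.idx 3) (σ.idx 6)
        (increments (σ.idx 6) fun k => leftCdf K m v (σ.mem 4 k)) ∧
      τ.mem 3 = writeRange (σ.mem 3) (σ.idx 3) (σ.idx 6)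
        (increments (σ.idx 6) fun k => rightCdf K m v (σ.mem 4 k)) := by
  set N := σ.idx 6 with hN
  refine (reach_while (B := 44 * K + 120) (N := N) (Inv := fun j τ =>
    Keeps StepI StepR StepA σ τ ∧ j ≤ N ∧ τ.idx 2 = j ∧ τ.idx 3 = σ.idx 3 + j ∧
      (τ.reg 16 = if 0 < j then leftCdf K m v (σ.mem 4 (j - 1)) else 0) ∧
      (τ.reg 17 = if 0 < j then rightCdf K m v (σ.mem 4 (j - 1)) else 0) ∧
      τ.mem 2 = writeRange (σ.mem 2) (σ.idx 3) j
        (increments N fun k => leftCdf K m v (σ.mem 4 k)) ∧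
      τ.mem 3 = writeRange (σ.mem 3) (σ.idx 3) j
        (increments N fun k => rightCdf K m v (σ.mem 4 k))) ?_ ?_).mono le_rfl ?_
  · rintro j τ ⟨hk, -, i2, i3, r16, r17, m2, m3⟩ hb
    have hb' : τ.idx 2 < τ.idx 6 := hb
    rw [i2, hk.idx 6 (by simp [StepI]), ← hN] at hb'
    refine ⟨hb', (reach_stepProg hK hv (hc.keeps hk)).mono le_rfl ?_⟩
    rintro υ ⟨hk', i2', i3', r16', r17', m2', m3'⟩
    rw [hk.mem 4 (by simp [StepA]), i2] at r16' r17' m2' m3'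
    refine ⟨hk.trans hk', hb', by rw [i2', i2], by rw [i3', i3, add_assoc], ?_, ?_, ?_, ?_⟩
    · rw [r16', if_pos (Nat.succ_pos j), Nat.add_sub_cancel]
    · rw [r17', if_pos (Nat.succ_pos j), Nat.add_sub_cancel]
    · rw [m2', m2, i3, r16, ← update_writeRange]
      congr 1
      rw [increments, if_pos hb']
    · rw [m3', m3, i3, r17, ← update_writeRange]
      congr 1
      rw [increments, if_pos hb']
  · refine ⟨Keeps.refl _ _ _ _, Nat.zero_le _, h2, rfl, ?_, ?_, ?_, ?_⟩
    · rw [if_neg (lt_irrefl 0), h16]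
    · rw [if_neg (lt_irrefl 0), h17]
    · rw [writeRange_zero]
    · rw [writeRange_zero]
  · rintro τ ⟨j, hj, ⟨hk, -, i2, i3, r16, r17, m2, m3⟩, hb⟩
    have hb' : ¬ τ.idx 2 < τ.idx 6 := hb
    rw [i2, hk.idx 6 (by simp [StepI]), ← hN] at hb'
    have e : j = N := by omega
    rw [e] at i3 r16 r17 m2 m3
    exact ⟨hk, i3, r16, r17, m2, m3⟩

/-- Index registers kept by the loop over the coordinates. -/
def CoordI (x : ℕ) : Prop := x ≠ 1 ∧ x ≠ 2 ∧ x ≠ 3 ∧ x ≠ 7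
/-- Real registers kept by the loop over the coordinates. -/
def CoordR (r : ℕ) : Prop := r < 10

theorem reach_coordProg {K : ℕ} (hK : 2 ≤ K) {σ : State} (hc : Consts K σ) {δ m v : ℝ}
    (hδ : σ.reg 3 = δ) (hδ0 : 0 < δ) (hm : σ.mem 0 (σ.idx 1) = m) (hv : σ.mem 1 (σ.idx 1) = v)
    (hv0 : 0 < v) :
    coordProg.Reach σ ((44 * K + 121) * σ.idx 6 + 31) fun τ =>
      Keeps CoordI CoordR StepA σ τ ∧ τ.idx 1 = σ.idx 1 + 1 ∧
      τ.idx 3 = σ.idx 3 + (σ.idx 6 + 1) ∧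
      τ.mem 2 = writeRange (σ.mem 2) (σ.idx 3) (σ.idx 6 + 1)
        (increments (σ.idx 6) fun k => leftCdf K m (nudge δ v) (σ.mem 4 k)) ∧
      τ.mem 3 = writeRange (σ.mem 3) (σ.idx 3) (σ.idx 6 + 1)
        (increments (σ.idx 6) fun k => rightCdf K m (nudge δ v) (σ.mem 4 k)) := by
  have hw0 := nudge_pos hδ0 hv0
  have hw1 : nudge δ v ≠ 1 := nudge_ne_one hδ0
  set w := nudge δ v with hw
  have s1 : (block [.load 10 0 1, .load 11 1 1]).Reach σ 3 fun τ =>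
      Frame 10 σ τ ∧ τ.reg 10 = m ∧ τ.reg 11 = v := by
    refine reach_block ⟨trivial, trivial, trivial⟩
      ⟨frame_runBlock (by simp [Instr.Scratch]) _, ?_⟩
    simp [runBlock, Instr.next, State.setReg, hm, hv]
  have s2 : ∀ σ₁, (Frame 10 σ σ₁ ∧ σ₁.reg 10 = m ∧ σ₁.reg 11 = v) →
      (Prog.ite (.le 11 1) (.ite (.le 1 11) (block [.add 11 1 3]) .skip) .skip).Reach σ₁ 4 fun τ =>
      Frame 10 σ τ ∧ τ.reg 10 = m ∧ τ.reg 11 = w := by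
    rintro σ₁ ⟨hf, h10, h11⟩
    have r1 : σ₁.reg 1 = 1 := (hc.frame hf le_rfl).reg1
    refine reach_ite (fun hb => reach_ite (fun hb' => ?_) fun hb' => ?_) fun hb => ?_
    · have hb1 : σ₁.reg 11 ≤ σ₁.reg 1 := hb
      have hb2 : σ₁.reg 1 ≤ σ₁.reg 11 := hb'
      rw [h11, r1] at hb1 hb2
      refine reach_block ⟨trivial, trivial⟩
        ⟨hf.trans (frame_runBlock (by simp [Instr.Scratch]) _), ?_⟩
      simp [runBlock, Instr.next, State.setReg, h10, r1, hf.reg, hδ, hw, nudge,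
        le_antisymm hb1 hb2]
    · have hb2 : ¬ σ₁.reg 1 ≤ σ₁.reg 11 := hb'
      rw [h11, r1] at hb2
      exact (reach_skip ⟨hf, h10, by
        rw [h11, hw, nudge, if_neg (fun e => hb2 e.ge)]⟩).mono one_le_two fun _ h => h
    · have hb2 : ¬ σ₁.reg 11 ≤ σ₁.reg 1 := hb
      rw [h11, r1] at hb2
      exact (reach_skip ⟨hf, h10, by
        rw [h11, hw, nudge, if_neg (fun e => hb2 e.le)]⟩).mono (by norm_num) fun _ h => h
  have s3 : ∀ σ₂, (Frame 10 σ σ₂ ∧ σ₂.reg 10 = m ∧ σ₂.reg 11 = w) →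
      (block [.sub 12 11 1, .log 13 11, .sqrt 14 11, .mul 20 10 14, .const 15 0]).Reach σ₂ 6
      fun τ => Frame 10 σ τ ∧ τ.reg 10 = m ∧ τ.reg 11 = w ∧ τ.reg 12 = w - 1 ∧
        τ.reg 13 = Real.log w ∧ τ.reg 14 = √w ∧ τ.reg 20 = m * √w ∧ τ.reg 15 = 0 := by
    rintro σ₂ ⟨hf, h10, h11⟩
    have r1 : σ₂.reg 1 = 1 := (hc.frame hf le_rfl).reg1
    refine reach_block ?_ ⟨hf.trans (frame_runBlock (by simp [Instr.Scratch]) _), ?_⟩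
    · simp [BlockDefined, Instr.Defined, Instr.next, State.setReg, h11, hw0, hw0.le]
    · simp [runBlock, Instr.next, State.setReg, h10, h11, r1]
  have s4 : ∀ σ₃, (Frame 10 σ σ₃ ∧ σ₃.reg 10 = m ∧ σ₃.reg 11 = w ∧ σ₃.reg 12 = w - 1 ∧
        σ₃.reg 13 = Real.log w ∧ σ₃.reg 14 = √w ∧ σ₃.reg 20 = m * √w ∧ σ₃.reg 15 = 0) →
      (Prog.ite (.lt 11 1) (block [.const 15 1]) .skip).Reach σ₃ 3 fun τ =>
        Frame 10 σ τ ∧ Coord K m w τ := by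
    rintro σ₃ ⟨hf, h10, h11, h12, h13, h14, h20, h15⟩
    have r1 : σ₃.reg 1 = 1 := (hc.frame hf le_rfl).reg1
    refine reach_ite (fun hb => ?_) fun hb => ?_
    · have hb1 : σ₃.reg 11 < σ₃.reg 1 := hb
      rw [h11, r1] at hb1
      have hf' := hf.trans (frame_runBlock (l := [.const 15 1]) (by simp [Instr.Scratch]) σ₃)
      refine reach_block ⟨trivial, trivial⟩ ⟨hf', hc.frame hf' le_rfl, ?_, ?_, ?_, ?_, ?_, ?_, ?_⟩
      all_goals simp [runBlock, Instr.next, State.setReg, h10, h11, h12, h13, h14, h20, hb1]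
    · have hb1 : ¬ σ₃.reg 11 < σ₃.reg 1 := hb
      rw [h11, r1] at hb1
      exact (reach_skip ⟨hf, hc.frame hf le_rfl, h10, h11, h12, h13, h14,
        by rw [h15, if_neg hb1], h20⟩).mono one_le_two fun _ h => h
  have s5 : ∀ σ₄, (Frame 10 σ σ₄ ∧ Coord K m w σ₄) →
      (block [.const 16 0, .const 17 0, .idxConst 2 0]).Reach σ₄ 4 fun τ =>
        Keeps CoordI CoordR StepA σ τ ∧ τ.idx 1 = σ.idx 1 ∧ τ.idx 3 = σ.idx 3 ∧
        τ.mem = σ.mem ∧ Coord K m w τ ∧ τ.idx 2 = 0 ∧ τ.reg 16 = 0 ∧ τ.reg 17 = 0 := by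
    rintro σ₄ ⟨hf, hco⟩
    have k1 : Keeps CoordI CoordR StepA σ σ₄ := hf.keeps (fun x hx => hx.2.2.2) fun r hr => hr
    have k2 : Keeps CoordI CoordR StepA σ₄ (runBlock [.const 16 0, .const 17 0, .idxConst 2 0] σ₄) :=
      keeps_runBlock (by simp [Instr.Avoids, CoordR, CoordI]) _
    have k3 : Keeps StepI StepR StepA σ₄ (runBlock [.const 16 0, .const 17 0, .idxConst 2 0] σ₄) :=
      keeps_runBlock (by simp [Instr.Avoids, StepR, StepI]) _
    refine reach_block ⟨trivial, trivial, trivial, trivial⟩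
      ⟨k1.trans k2, ?_, ?_, ?_, hco.keeps k3, ?_, ?_, ?_⟩
    all_goals simp [runBlock, Instr.next, State.setReg, State.setIdx, hf.idx, hf.mem]
  refine (s1.seq fun σ₁ h₁ => (s2 σ₁ h₁).seq fun σ₂ h₂ => (s3 σ₂ h₂).seq fun σ₃ h₃ =>
    (s4 σ₃ h₃).seq fun σ₄ h₄ => (s5 σ₄ h₄).seq
    (B' := (44 * K + 121) * σ.idx 6 + 1 + 7) ?_).mono (by omega) fun _ h => h
  rintro σ₅ ⟨k₅, i1, i3, hmem, hco, i2, r16, r17⟩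
  have i6 : σ₅.idx 6 = σ.idx 6 := k₅.idx 6 (by simp [CoordI])
  have s6 := reach_levelLoop hK hw1 hco i2 r16 r17
  rw [i6, i3, hmem] at s6
  refine s6.seq ?_
  rintro σ₆ ⟨k₆, j3, q16, q17, m2, m3⟩
  have k₆' : Keeps CoordI CoordR StepA σ σ₆ := k₅.trans (k₆.weaken
    (fun x hx => ⟨hx.2.1, hx.2.2.1, hx.2.2.2⟩)
    (fun r hr => by unfold CoordR at hr; unfold StepR; omega) fun _ h => h)
  have hc₆ := (hco.keeps k₆).consts
  have j1 : σ₆.idx 1 = σ.idx 1 := (k₆.idx 1 (by simp [StepI])).trans i1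
  refine reach_block (by simp [BlockDefined, Instr.Defined])
    ⟨k₆'.trans (keeps_runBlock (by simp [Instr.Avoids, CoordI, CoordR, StepA]) _), ?_⟩
  -- The loop writes one entry per level; the remaining cell, above the last level, receives what is
  -- left up to 1.
  have last : ∀ f : ℕ → ℝ, increments (σ.idx 6) f (σ.idx 6) =
      1 - if 0 < σ.idx 6 then f (σ.idx 6 - 1) else 0 := fun f => by
    rw [increments, if_neg (lt_irrefl _)]
  refine ⟨?_, ?_, ?_, ?_⟩
  · simp [runBlock, Instr.next, State.setReg, State.setMem, State.setIdx, j1, hc₆.idx5]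
  · simp [runBlock, Instr.next, State.setReg, State.setMem, State.setIdx, j3, hc₆.idx5, add_assoc]
  · rw [← update_writeRange, last, ← q16, ← m2, ← j3]
    simp [runBlock, Instr.next, State.setReg, State.setMem, State.setIdx, hc₆.reg1]
  · rw [← update_writeRange, last, ← q17, ← m3, ← j3]
    simp [runBlock, Instr.next, State.setReg, State.setMem, State.setIdx, hc₆.reg1]

/-- Write all tables. -/
def tablesProg : Prog := .while (.idxLt 1 0) coordProg

theorem reach_tablesProg {K n N : ℕ} (hK : 2 ≤ K) {σ : State} (hc : Consts K σ) {δ : ℝ}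
    (hδ : σ.reg 3 = δ) (hδ0 : 0 < δ) (hn : σ.idx 0 = n) (hN : σ.idx 6 = N) (h1 : σ.idx 1 = 0)
    (h3 : σ.idx 3 = 0) (hv : ∀ i < n, 0 < σ.mem 1 i) :
    tablesProg.Reach σ (((44 * K + 121) * N + 32) * n + 1) fun τ =>
      Consts K τ ∧ τ.idx 6 = N ∧
      (∀ i < n, ∀ j < N + 1, τ.mem 2 (i * (N + 1) + j) =
        increments N (fun k => leftCdf K (σ.mem 0 i) (nudge δ (σ.mem 1 i)) (σ.mem 4 k)) j) ∧
      (∀ i < n, ∀ j < N + 1, τ.mem 3 (i * (N + 1) + j) =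
        increments N (fun k => rightCdf K (σ.mem 0 i) (nudge δ (σ.mem 1 i)) (σ.mem 4 k)) j) := by
  -- The block of coordinate k starts at k(N + 1), past the ends of all earlier blocks, so these
  -- stay intact.
  have write : ∀ (f : ℕ → ℕ → ℝ) (g g' : ℕ → ℝ) (k : ℕ),
      g' = writeRange g (k * (N + 1)) (N + 1) (f k) →
      (∀ i < k, ∀ j < N + 1, g (i * (N + 1) + j) = f i j) →
      ∀ i < k + 1, ∀ j < N + 1, g' (i * (N + 1) + j) = f i j := by
    intro f g g' k hg' hg i hi j hj
    rw [hg', writeRange]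
    rcases Nat.lt_succ_iff_lt_or_eq.1 hi with hi | rfl
    · have : (i + 1) * (N + 1) ≤ k * (N + 1) := Nat.mul_le_mul_right _ hi
      rw [add_mul, one_mul] at this
      rw [if_neg (by omega), hg i hi j hj]
    · rw [if_pos (by omega), Nat.add_sub_cancel_left]
  refine (reach_while (B := (44 * K + 121) * N + 31) (N := n) (Inv := fun k τ =>
    Keeps CoordI CoordR StepA σ τ ∧ k ≤ n ∧ τ.idx 1 = k ∧ τ.idx 3 = k * (N + 1) ∧
      (∀ i < k, ∀ j < N + 1, τ.mem 2 (i * (N + 1) + j) =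
        increments N (fun k => leftCdf K (σ.mem 0 i) (nudge δ (σ.mem 1 i)) (σ.mem 4 k)) j) ∧
      (∀ i < k, ∀ j < N + 1, τ.mem 3 (i * (N + 1) + j) =
        increments N (fun k => rightCdf K (σ.mem 0 i) (nudge δ (σ.mem 1 i)) (σ.mem 4 k)) j))
    ?_ ?_).mono le_rfl ?_
  · rintro k τ ⟨hk, -, i1, i3, m2, m3⟩ hb
    have hb' : τ.idx 1 < τ.idx 0 := hb
    rw [i1, hk.idx 0 (by simp [CoordI]), hn] at hb'
    have i6 : τ.idx 6 = N := (hk.idx 6 (by simp [CoordI])).trans hN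
    have e0 : τ.mem 0 = σ.mem 0 := hk.mem 0 (by simp [StepA])
    have e1 : τ.mem 1 = σ.mem 1 := hk.mem 1 (by simp [StepA])
    have e4 : τ.mem 4 = σ.mem 4 := hk.mem 4 (by simp [StepA])
    have hc' : Consts K τ := hc.of_eq (hk.idx 4 (by simp [CoordI])) (hk.idx 5 (by simp [CoordI]))
      fun r hr => hk.reg r hr
    have s := reach_coordProg hK hc' (δ := δ) (m := σ.mem 0 k) (v := σ.mem 1 k)
      ((hk.reg 3 (by simp [CoordR])).trans hδ) hδ0 (by rw [e0, i1]) (by rw [e1, i1]) (hv k hb')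
    rw [i6, i3, i1, e4] at s
    refine ⟨hb', s.mono le_rfl ?_⟩
    rintro υ ⟨hk', j1, j3, m2', m3'⟩
    exact ⟨hk.trans hk', hb', j1, by rw [j3]; ring, write _ _ _ k m2' m2, write _ _ _ k m3' m3⟩
  · exact ⟨Keeps.refl _ _ _ _, Nat.zero_le _, h1, by rw [h3, zero_mul],
      fun i hi => absurd hi (Nat.not_lt_zero i), fun i hi => absurd hi (Nat.not_lt_zero i)⟩
  · rintro τ ⟨k, -, ⟨hk, hkn, i1, -, m2, m3⟩, hb⟩
    have hb' : ¬ τ.idx 1 < τ.idx 0 := hb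
    rw [i1, hk.idx 0 (by simp [CoordI]), hn] at hb'
    have e : k = n := by omega
    rw [e] at m2 m3
    exact ⟨hc.of_eq (hk.idx 4 (by simp [CoordI])) (hk.idx 5 (by simp [CoordI]))
      fun r hr => hk.reg r hr, (hk.idx 6 (by simp [CoordI])).trans hN, m2, m3⟩

end RealRAM

/-! ### Programs for the parameters and the levels, and the whole algorithm. -/

namespace RealRAM

/-- Sum the quantities `gaussGap` in register `2`. -/
def gapProg : Prog :=
  .seq (block [.idxConst 5 1, .const 1 1])
    (.while (.idxLt 1 0)
      (block [.load 10 0 1, .load 11 1 1, .mul 12 10 10, .add 13 11 12, .div 12 12 13,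
        .add 2 2 12, .sub 12 11 1, .add 13 11 1, .div 12 12 13, .mul 12 12 12, .add 2 2 12,
        .idxAdd 1 1 5]))

theorem reach_gapProg {n : ℕ} {σ : State} (hn : σ.idx 0 = n) (h1 : σ.idx 1 = 0)
    (h2 : σ.reg 2 = 0) (hv : ∀ i < n, 0 < σ.mem 1 i) :
    gapProg.Reach σ (14 * n + 4) fun τ =>
      τ.idx 0 = n ∧ τ.idx 5 = 1 ∧ τ.reg 0 = σ.reg 0 ∧ τ.reg 1 = 1 ∧ τ.mem = σ.mem ∧
      τ.reg 2 = ∑ i ∈ Finset.range n, gaussGap (σ.mem 0 i) (σ.mem 1 i) := by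
  have init : (block [.idxConst 5 1, .const 1 1]).Reach σ 3 fun τ =>
      τ.idx 0 = n ∧ τ.idx 1 = 0 ∧ τ.idx 5 = 1 ∧ τ.reg 0 = σ.reg 0 ∧ τ.reg 1 = 1 ∧
      τ.reg 2 = 0 ∧ τ.mem = σ.mem := by
    refine reach_block ⟨trivial, trivial, trivial⟩ ?_
    simp [runBlock, Instr.next, State.setIdx, State.setReg, hn, h1, h2]
  refine (init.seq fun σ₁ h => ?_).mono (B := 3 + ((13 + 1) * n + 1)) (by omega) fun _ h => h
  obtain ⟨a0, a1, a5, b0, b1, b2, hm⟩ := h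
  refine (reach_while (B := 13) (N := n) (Inv := fun k τ =>
    τ.idx 0 = n ∧ τ.idx 1 = k ∧ τ.idx 5 = 1 ∧ τ.reg 0 = σ.reg 0 ∧ τ.reg 1 = 1 ∧ τ.mem = σ.mem ∧
    k ≤ n ∧ τ.reg 2 = ∑ i ∈ Finset.range k, gaussGap (σ.mem 0 i) (σ.mem 1 i)) ?_ ?_).mono le_rfl ?_
  · rintro k τ ⟨c0, c1, c5, d0, d1, hmem, -, d2⟩ hb
    have hb' : τ.idx 1 < τ.idx 0 := hb
    rw [c0, c1] at hb'
    have hpos := hv k hb'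
    refine ⟨hb', reach_block ?_ ?_⟩
    · simp [BlockDefined, Instr.Defined, Instr.next, State.setReg, c1, d1, hmem]
      exact ⟨(add_pos_of_pos_of_nonneg hpos (mul_self_nonneg _)).ne', (add_pos hpos one_pos).ne'⟩
    · simp [runBlock, Instr.next, State.setIdx, State.setReg, c0, c1, c5, d0, d1, d2, hmem]
      refine ⟨hb', ?_⟩
      rw [Finset.sum_range_succ, gaussGap, sq, sq]
      ring
  · exact ⟨a0, a1, a5, b0, b1, hm, Nat.zero_le _, by rw [b2, Finset.sum_range_zero]⟩
  · rintro τ ⟨k, -, ⟨c0, c1, c5, d0, d1, hmem, hk, d2⟩, hb⟩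
    have hb' : ¬ τ.idx 1 < τ.idx 0 := hb
    rw [c0, c1] at hb'
    have e : k = n := by omega
    rw [e] at d2
    exact ⟨c0, c5, d0, d1, hmem, d2⟩

/-- Compute the tolerance, the mesh and the number of Taylor terms. -/
def paramProg : Prog :=
  .seq (block [.ofIdx 10 0, .mul 11 10 10, .mul 3 0 2, .div 3 3 11, .const 12 2000, .div 3 3 12,
      .div 4 0 10, .const 12 24, .div 4 4 12, .add 5 1 4, .div 6 1 3, .log 6 6, .const 12 32,
      .mul 6 12 6, .idxConst 4 2, .ofIdx 10 4])
    (.while (.lt 10 6) (block [.idxAdd 4 4 5, .ofIdx 10 4]))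

/-- The machine has no rounding instruction, so K is found by counting up until it reaches 32
log(1/δ). Starting from 2 secures the positivity of the truncated density. -/
theorem reach_paramProg {n N : ℕ} (hn0 : 0 < n) {ε G δ : ℝ} {σ : State} (hn : σ.idx 0 = n)
    (h5 : σ.idx 5 = 1) (hε : σ.reg 0 = ε) (h1 : σ.reg 1 = 1) (hG : σ.reg 2 = G)
    (hδ : δ = ε * G / (n * n) / 2000) (hδ0 : 0 < δ) (hN : 32 * Real.log (1 / δ) ≤ N) :
    paramProg.Reach σ (4 * N + 18) fun τ =>
      ∃ K : ℕ, 2 ≤ K ∧ K ≤ N + 2 ∧ 32 * Real.log (1 / δ) ≤ K ∧ τ.idx 0 = n ∧ τ.idx 4 = K ∧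
        τ.idx 5 = 1 ∧ τ.reg 1 = 1 ∧ τ.reg 3 = δ ∧ τ.reg 4 = mesh ε n ∧ τ.reg 5 = 1 + mesh ε n ∧
        τ.reg 10 = K ∧ τ.mem = σ.mem := by
  have hnR : (n : ℝ) ≠ 0 := Nat.cast_ne_zero.2 hn0.ne'
  have hne : ε * G / (n * n) / 2000 ≠ 0 := by rw [← hδ]; exact hδ0.ne'
  have hpos : 0 < 1 / (ε * G / (n * n) / 2000) := by rw [← hδ]; positivity
  have init : (block [.ofIdx 10 0, .mul 11 10 10, .mul 3 0 2, .div 3 3 11, .const 12 2000,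
      .div 3 3 12, .div 4 0 10, .const 12 24, .div 4 4 12, .add 5 1 4, .div 6 1 3, .log 6 6,
      .const 12 32, .mul 6 12 6, .idxConst 4 2, .ofIdx 10 4]).Reach σ 17 fun τ =>
      τ.idx 0 = n ∧ τ.idx 4 = 2 ∧ τ.idx 5 = 1 ∧ τ.reg 1 = 1 ∧ τ.reg 3 = δ ∧ τ.reg 4 = mesh ε n ∧
        τ.reg 5 = 1 + mesh ε n ∧ τ.reg 6 = 32 * Real.log (1 / δ) ∧ τ.reg 10 = 2 ∧
        τ.mem = σ.mem := by
    refine reach_block ?_ ?_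
    · have e : ¬ ((ε = 0 ∨ G = 0) ∨ n = 0) := by
        rintro ((h | h) | h) <;> simp [h] at hne
      have hG0 : 0 < ε * G / (n * n) := by
        have : ε * G / (n * n) = δ * 2000 := by rw [hδ]; ring
        rw [this]; positivity
      simp [BlockDefined, Instr.Defined, Instr.next, State.setReg, hn, hε, h1, hG, hn0.ne',
        hG0]
      exact ⟨fun h => e (Or.inl (Or.inl h)), fun h => e (Or.inl (Or.inr h))⟩
    · simp only [hδ, mesh]
      simp [runBlock, Instr.next, State.setIdx, State.setReg, hn, h5, hε, h1, hG]
  refine (init.seq fun σ₁ h => ?_).mono (B := 17 + ((3 + 1) * N + 1)) (by omega) fun _ h => h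
  obtain ⟨a0, a4, a5, b1, b3, b4, b5, b6, b10, hm⟩ := h
  refine (reach_while (B := 3) (N := N) (Inv := fun k τ =>
    τ.idx 0 = n ∧ τ.idx 4 = k + 2 ∧ τ.idx 5 = 1 ∧ τ.reg 1 = 1 ∧ τ.reg 3 = δ ∧
      τ.reg 4 = mesh ε n ∧ τ.reg 5 = 1 + mesh ε n ∧ τ.reg 6 = 32 * Real.log (1 / δ) ∧
      τ.reg 10 = ((k + 2 : ℕ) : ℝ) ∧ τ.mem = σ.mem) ?_ ?_).mono le_rfl ?_
  · rintro k τ ⟨c0, c4, c5, d1, d3, d4, d5, d6, d10, hmem⟩ hb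
    have hb' : τ.reg 10 < τ.reg 6 := hb
    rw [d10, d6] at hb'
    refine ⟨?_, reach_block ⟨trivial, trivial, trivial⟩ ?_⟩
    · have : ((k + 2 : ℕ) : ℝ) < N := hb'.trans_le hN
      have := Nat.cast_lt.1 this
      omega
    · simp [runBlock, Instr.next, State.setIdx, State.setReg, c0, c4, c5, d1, d3, d4, d5, d6,
        hmem]
      ring
  · exact ⟨a0, a4, a5, b1, b3, b4, b5, b6, by rw [b10]; norm_num, hm⟩
  · rintro τ ⟨k, hk, ⟨c0, c4, c5, d1, d3, d4, d5, d6, d10, hmem⟩, hb⟩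
    have hb' : ¬ τ.reg 10 < τ.reg 6 := hb
    rw [d10, d6, not_lt] at hb'
    exact ⟨k + 2, by omega, by omega, hb', c0, c4, c5, d1, d3, d4, d5, d10, hmem⟩

/-- Compute the cut-off point and the normalization. -/
def constsProg : Prog :=
  .seq (block [.sqrt 7 10, .const 12 2, .div 7 7 12, .const 12 0, .sub 8 12 7, .copy 30 7])
    (.seq taylorProg (block [.add 9 31 31]))

theorem reach_constsProg {K : ℕ} {σ : State} (h4 : σ.idx 4 = K) (h5 : σ.idx 5 = 1)
    (h1 : σ.reg 1 = 1) (h10 : σ.reg 10 = K) :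
    constsProg.Reach σ (11 * K + 18) fun τ =>
      Consts K τ ∧ τ.idx 0 = σ.idx 0 ∧ τ.reg 3 = σ.reg 3 ∧ τ.reg 4 = σ.reg 4 ∧
        τ.reg 5 = σ.reg 5 ∧ τ.mem = σ.mem := by
  have init : (block [.sqrt 7 10, .const 12 2, .div 7 7 12, .const 12 0, .sub 8 12 7,
      .copy 30 7]).Reach σ 7 fun τ => Frame 7 σ τ ∧ τ.reg 7 = cutoff K ∧ τ.reg 8 = -cutoff K ∧
        τ.reg 30 = cutoff K := by
    refine reach_block ?_ ⟨frame_runBlock (by simp [Instr.Scratch]) _, ?_⟩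
    · simp [BlockDefined, Instr.Defined, Instr.next, State.setReg, h10]
    · simp [runBlock, Instr.next, State.setReg, h10, cutoff]
  refine (init.seq (B' := 11 * K + 9 + 2) fun σ₁ h => ?_).mono (by omega) fun _ h => h
  obtain ⟨f₁, r7, r8, r30⟩ := h
  have s := reach_taylorProg ((f₁.reg 1 (by norm_num)).trans h1)
    ((f₁.idx 5 (by norm_num)).trans h5)
  rw [f₁.idx 4 (by norm_num), h4, r30] at s
  refine s.seq fun σ₂ h₂ => ?_
  obtain ⟨f₂, r31⟩ := h₂
  have f₃ := f₁.trans (f₂.weaken (b' := 7) (by norm_num))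
  refine reach_block ⟨trivial, trivial⟩ ⟨⟨?_, ?_, ?_, ?_, ?_, ?_⟩, ?_⟩
  all_goals simp [runBlock, Instr.next, State.setReg, f₃.idx, f₃.reg, f₃.mem, h4, h5, h1, f₂.reg,
    r7, r8, r31, two_mul]

/-- Write the levels to array `4`. -/
def levelsProg : Prog :=
  .seq (block [.div 10 1 4, .const 12 0, .idxConst 6 0])
    (.seq (.while (.lt 3 10) (block [.sub 11 12 10, .store 4 6 11, .idxAdd 6 6 5, .div 10 10 5]))
      (.seq (block [.idxCopy 2 6, .idxConst 8 0])
        (.seq (.while (.idxLt 8 2)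
            (block [.idxSub 2 2 5, .load 11 4 2, .sub 11 12 11, .store 4 6 11, .idxAdd 6 6 5]))
          (block [.idxConst 1 0, .idxConst 3 0]))))

/-- Index registers kept while the levels are computed. -/
def LevelI (x : ℕ) : Prop := x = 0 ∨ x = 4 ∨ x = 5

/-- The first loop appends the negative levels until the tolerance is reached, which determines J.
The second reads them backwards and appends their negatives, giving the increasing sequence that
`cellOf_le_iff` needs. -/
theorem reach_levelsProg {N : ℕ} {δ η : ℝ} {σ : State} (h5 : σ.idx 5 = 1) (h1 : σ.reg 1 = 1)
    (hδ : σ.reg 3 = δ) (hη : σ.reg 4 = η) (hq : σ.reg 5 = 1 + η) (hη0 : 0 < η)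
    (hN : ∀ k : ℕ, δ < 1 / η / (1 + η) ^ k → k < N) :
    levelsProg.Reach σ (13 * N + 12) fun τ =>
      Keeps LevelI CoordR (· ≠ 4) σ τ ∧ τ.idx 1 = 0 ∧ τ.idx 3 = 0 ∧
      ∃ J : ℕ, J ≤ N ∧ 1 / η / (1 + η) ^ J ≤ δ ∧ τ.idx 6 = 2 * J ∧
        ∀ x < 2 * J, τ.mem 4 x = level (1 / η) (1 + η) J x := by
  have hq0 : (1 + η) ≠ 0 := by positivity
  have init : (block [.div 10 1 4, .const 12 0, .idxConst 6 0]).Reach σ 4 fun τ =>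
      Keeps LevelI CoordR (· ≠ 4) σ τ ∧ τ.reg 10 = 1 / η ∧ τ.reg 12 = 0 ∧ τ.idx 6 = 0 := by
    refine reach_block ?_ ⟨keeps_runBlock (by simp [Instr.Avoids, LevelI, CoordR]) _, ?_⟩
    · simp [BlockDefined, Instr.Defined, hη, hη0.ne']
    · simp [runBlock, Instr.next, State.setIdx, State.setReg, h1, hη]
  have down : ∀ σ₁, (Keeps LevelI CoordR (· ≠ 4) σ σ₁ ∧ σ₁.reg 10 = 1 / η ∧ σ₁.reg 12 = 0 ∧
      σ₁.idx 6 = 0) → (Prog.while (.lt 3 10) (block [.sub 11 12 10, .store 4 6 11, .idxAdd 6 6 5,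
      .div 10 10 5])).Reach σ₁ ((5 + 1) * N + 1) fun τ => ∃ J : ℕ, J ≤ N ∧
        Keeps LevelI CoordR (· ≠ 4) σ τ ∧ 1 / η / (1 + η) ^ J ≤ δ ∧ τ.reg 12 = 0 ∧ τ.idx 6 = J ∧
        ∀ x < J, τ.mem 4 x = -(1 / η / (1 + η) ^ x) := by
    rintro σ₁ ⟨k₁, r10, r12, i6⟩
    refine (reach_while (B := 5) (N := N) (Inv := fun k τ => Keeps LevelI CoordR (· ≠ 4) σ τ ∧
      τ.reg 10 = 1 / η / (1 + η) ^ k ∧ τ.reg 12 = 0 ∧ τ.idx 6 = k ∧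
      ∀ x < k, τ.mem 4 x = -(1 / η / (1 + η) ^ x)) ?_ ?_).mono le_rfl ?_
    · rintro k τ ⟨hk, s10, s12, j6, hm⟩ hb
      have hb' : τ.reg 3 < τ.reg 10 := hb
      rw [hk.reg 3 (by simp [CoordR]), s10, hδ] at hb'
      have e5 : τ.idx 5 = 1 := (hk.idx 5 (by simp [LevelI])).trans h5
      have q5 : τ.reg 5 = 1 + η := (hk.reg 5 (by simp [CoordR])).trans hq
      refine ⟨hN k hb', reach_block ?_
        ⟨hk.trans (keeps_runBlock (by simp [Instr.Avoids, LevelI, CoordR]) _), ?_, ?_, ?_, ?_⟩⟩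
      · simp [BlockDefined, Instr.Defined, Instr.next, State.setReg, State.setMem, State.setIdx,
          q5, hq0]
      · simp only [runBlock, Instr.next, State.setReg, State.setMem, State.setIdx]
        simp only [Function.update_self, Function.update_of_ne, ne_eq, Nat.reduceEqDiff,
          not_false_eq_true, s10, q5]
        rw [div_div, ← pow_succ]
      · simp [runBlock, Instr.next, State.setReg, State.setMem, State.setIdx, s12]
      · simp [runBlock, Instr.next, State.setReg, State.setMem, State.setIdx, j6, e5]
      · intro x hx
        simp only [runBlock, Instr.next, State.setReg, State.setMem, State.setIdx]
        simp only [Function.update_self, s10, s12, j6, zero_sub]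
        rw [Function.update_apply]
        split_ifs with h
        · rw [h]
        · exact hm x (by omega)
    · exact ⟨k₁, by rw [r10, pow_zero, div_one], r12, i6,
        fun x hx => absurd hx (Nat.not_lt_zero x)⟩
    · rintro τ ⟨k, hkN, ⟨hk, s10, s12, j6, hm⟩, hb⟩
      have hb' : ¬ τ.reg 3 < τ.reg 10 := hb
      rw [hk.reg 3 (by simp [CoordR]), s10, hδ, not_lt] at hb'
      exact ⟨k, hkN, hk, hb', s12, j6, hm⟩
  refine (init.seq fun σ₁ h₁ => (down σ₁ h₁).seq (B' := 3 + ((6 + 1) * N + 1 + 3)) ?_).mono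
    (by omega) fun _ h => h
  rintro σ₂ ⟨J, hJN, k₂, hJ, r12, i6, hm⟩
  have mid : (block [.idxCopy 2 6, .idxConst 8 0]).Reach σ₂ 3 fun τ =>
      Keeps LevelI CoordR (· ≠ 4) σ τ ∧ τ.reg 12 = 0 ∧ τ.idx 6 = J ∧ τ.idx 2 = J ∧ τ.idx 8 = 0 ∧
        ∀ x < J, τ.mem 4 x = level (1 / η) (1 + η) J x := by
    refine reach_block ⟨trivial, trivial, trivial⟩
      ⟨k₂.trans (keeps_runBlock (by simp [Instr.Avoids, LevelI]) _), ?_, ?_, ?_, ?_, ?_⟩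
    · simp [runBlock, Instr.next, State.setIdx, r12]
    · simp [runBlock, Instr.next, State.setIdx, i6]
    · simp [runBlock, Instr.next, State.setIdx, i6]
    · simp [runBlock, Instr.next, State.setIdx]
    · intro x hx
      rw [level, if_pos hx]
      exact hm x hx
  refine mid.seq fun σ₃ h₃ => ?_
  obtain ⟨k₃, q12, j6, j2, j8, hm₃⟩ := h₃
  have up : (Prog.while (.idxLt 8 2) (block [.idxSub 2 2 5, .load 11 4 2, .sub 11 12 11,
      .store 4 6 11, .idxAdd 6 6 5])).Reach σ₃ ((6 + 1) * N + 1) fun τ =>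
        Keeps LevelI CoordR (· ≠ 4) σ τ ∧ τ.idx 6 = 2 * J ∧
        ∀ x < 2 * J, τ.mem 4 x = level (1 / η) (1 + η) J x := by
    refine (reach_while (B := 6) (N := N) (Inv := fun k τ => Keeps LevelI CoordR (· ≠ 4) σ τ ∧
      τ.reg 12 = 0 ∧ k ≤ J ∧ τ.idx 2 = J - k ∧ τ.idx 6 = J + k ∧ τ.idx 8 = 0 ∧
      ∀ x < J + k, τ.mem 4 x = level (1 / η) (1 + η) J x) ?_ ?_).mono le_rfl ?_
    · rintro k τ ⟨hk, s12, hkJ, l2, l6, l8, hl⟩ hb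
      have hb' : τ.idx 8 < τ.idx 2 := hb
      rw [l8, l2] at hb'
      have e5 : τ.idx 5 = 1 := (hk.idx 5 (by simp [LevelI])).trans h5
      refine ⟨by omega, reach_block (by simp [BlockDefined, Instr.Defined])
        ⟨hk.trans (keeps_runBlock (by simp [Instr.Avoids, LevelI, CoordR]) _),
          ?_, by omega, ?_, ?_, ?_, ?_⟩⟩
      · simp [runBlock, Instr.next, State.setReg, State.setMem, State.setIdx, s12]
      · simp [runBlock, Instr.next, State.setReg, State.setMem, State.setIdx, l2, e5]
        omega
      · simp [runBlock, Instr.next, State.setReg, State.setMem, State.setIdx, l6, e5, add_assoc]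
      · simp [runBlock, Instr.next, State.setReg, State.setMem, State.setIdx, l8]
      · intro x hx
        simp only [runBlock, Instr.next, State.setReg, State.setMem, State.setIdx]
        simp only [Function.update_self, Function.update_of_ne, ne_eq, Nat.reduceEqDiff,
          not_false_eq_true, s12, l2, l6, e5, zero_sub]
        rw [Function.update_apply]
        split_ifs with h
        -- Entry J + k is minus entry J - k - 1; both have the exponent J - 1 - k.
        · rw [hl _ (by omega), h, level, level, if_pos (by omega), if_neg (by omega), neg_neg,
            show J - k - 1 = 2 * J - 1 - (J + k) by omega]
        · exact hl x (by omega)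
    · exact ⟨k₃, q12, Nat.zero_le _, j2, j6, j8, fun x hx => hm₃ x hx⟩
    · rintro τ ⟨k, -, ⟨hk, s12, hkJ, l2, l6, l8, hl⟩, hb⟩
      have hb' : ¬ τ.idx 8 < τ.idx 2 := hb
      rw [l8, l2] at hb'
      have e : k = J := by omega
      rw [e, ← two_mul] at l6 hl
      exact ⟨hk, l6, hl⟩
  refine up.seq fun σ₄ h₄ => ?_
  obtain ⟨k₄, l6, hl⟩ := h₄
  refine reach_block ⟨trivial, trivial, trivial⟩
    ⟨k₄.trans (keeps_runBlock (by simp [Instr.Avoids, LevelI]) _), ?_, ?_, J, hJN, hJ, ?_, ?_⟩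
  · simp [runBlock, Instr.next, State.setIdx]
  · simp [runBlock, Instr.next, State.setIdx]
  · simp [runBlock, Instr.next, State.setIdx, l6]
  · intro x hx
    simp only [runBlock, Instr.next, State.setIdx]
    exact hl x hx

/-- The whole algorithm. -/
def gaussianTablesProg : Prog :=
  .seq gapProg (.seq paramProg (.seq constsProg (.seq levelsProg (.seq tablesProg
    (block [.idxAdd 0 6 5])))))

theorem reach_gaussianTablesProg {n N NJ : ℕ} (hn0 : 0 < n) {ε δ : ℝ} (hε : 0 < ε) {σ : State}
    (hn : σ.idx 0 = n) (h1 : σ.idx 1 = 0) (hr : σ.reg 0 = ε) (h2 : σ.reg 2 = 0)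
    (hv : ∀ i < n, 0 < σ.mem 1 i)
    (hδ : δ = ε * (∑ i ∈ Finset.range n, gaussGap (σ.mem 0 i) (σ.mem 1 i)) / (n * n) / 2000)
    (hδ0 : 0 < δ) (hN : 32 * Real.log (1 / δ) ≤ N)
    (hNJ : ∀ k : ℕ, δ < 1 / mesh ε n / (1 + mesh ε n) ^ k → k < NJ) :
    gaussianTablesProg.Reach σ
      (14 * n + 15 * N + 13 * NJ + ((44 * (N + 2) + 121) * (2 * NJ) + 32) * n + 77) fun τ =>
      ∃ J K : ℕ, J ≤ NJ ∧ 1 / mesh ε n / (1 + mesh ε n) ^ J ≤ δ ∧ 2 ≤ K ∧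
        32 * Real.log (1 / δ) ≤ K ∧ τ.idx 0 = 2 * J + 1 ∧
        (∀ i < n, ∀ j < 2 * J + 1, τ.mem 2 (i * (2 * J + 1) + j) =
          increments (2 * J) (fun k => leftCdf K (σ.mem 0 i) (nudge δ (σ.mem 1 i))
            (level (1 / mesh ε n) (1 + mesh ε n) J k)) j) ∧
        (∀ i < n, ∀ j < 2 * J + 1, τ.mem 3 (i * (2 * J + 1) + j) =
          increments (2 * J) (fun k => rightCdf K (σ.mem 0 i) (nudge δ (σ.mem 1 i))
            (level (1 / mesh ε n) (1 + mesh ε n) J k)) j) := by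
  have hη := mesh_pos hε hn0
  refine ((reach_gapProg hn h1 h2 hv).seq (B' := 4 * N + 18 + (11 * (N + 2) + 18 + (13 * NJ + 12 +
    (((44 * (N + 2) + 121) * (2 * NJ) + 32) * n + 1 + 2)))) ?_).mono (by omega) fun _ h => h
  rintro σ₁ ⟨a0, a5, b0, b1, hm₁, b2⟩
  refine (reach_paramProg hn0 a0 a5 (b0.trans hr) b1 b2 hδ hδ0 hN).seq ?_
  rintro σ₂ ⟨K, hK2, hKN, hKl, c0, c4, c5, d1, d3, d4, d5, d10, hm₂⟩
  refine ((reach_constsProg c4 c5 d1 d10).mono (B' := 11 * (N + 2) + 18) (by omega)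
    fun _ h => h).seq ?_
  rintro σ₃ ⟨hc, e0, f3, f4, f5, hm₃⟩
  refine (reach_levelsProg (δ := δ) (η := mesh ε n) hc.idx5 hc.reg1 (f3.trans d3) (f4.trans d4)
    (f5.trans d5) hη hNJ).seq ?_
  rintro σ₄ ⟨hk, g1, g3, J, hJN, hJ, g6, hl⟩
  have hc₄ : Consts K σ₄ := hc.of_eq (hk.idx 4 (by simp [LevelI])) (hk.idx 5 (by simp [LevelI]))
    fun r hr => hk.reg r hr
  have hmem : σ₃.mem = σ.mem := by rw [hm₃, hm₂, hm₁]
  have m0 : σ₄.mem 0 = σ.mem 0 := by rw [hk.mem 0 (by norm_num), hmem]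
  have m1 : σ₄.mem 1 = σ.mem 1 := by rw [hk.mem 1 (by norm_num), hmem]
  have s := reach_tablesProg hK2 hc₄ (δ := δ) (n := n) (N := 2 * J)
    ((hk.reg 3 (by simp [CoordR])).trans (f3.trans d3)) hδ0
    ((hk.idx 0 (by simp [LevelI])).trans (e0.trans c0)) g6 g1 g3 (by rw [m1]; exact hv)
  refine (s.mono (B' := ((44 * (N + 2) + 121) * (2 * NJ) + 32) * n + 1) ?_ fun _ h => h).seq ?_
  · gcongr
  rintro σ₅ ⟨hc₅, l6, t2, t3⟩
  -- Array 4 is known to hold the levels only at the first 2J cells, and the tables depend on no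
  -- others.
  have congr_increments : ∀ f g : ℕ → ℝ, (∀ k < 2 * J, f k = g k) → ∀ j < 2 * J + 1,
      increments (2 * J) f j = increments (2 * J) g j := by
    intro f g h j hj
    unfold increments
    congr 1
    · split_ifs with h'
      · exact h j h'
      · rfl
    · split_ifs with h'
      · exact h (j - 1) (by omega)
      · rfl
  refine reach_block ⟨trivial, trivial⟩ ⟨J, K, hJN, hJ, hK2, hKl, ?_, ?_, ?_⟩
  · simp [runBlock, Instr.next, State.setIdx, l6, hc₅.idx5]
  · intro i hi j hj
    simp only [runBlock, Instr.next, State.setIdx]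
    rw [t2 i hi j hj, m0, m1]
    exact congr_increments _ _ (fun k hk => by rw [hl k hk]) j hj
  · intro i hi j hj
    simp only [runBlock, Instr.next, State.setIdx]
    rw [t3 i hi j hj, m0, m1]
    exact congr_increments _ _ (fun k hk => by rw [hl k hk]) j hj

end RealRAM

/-! ### The computed entries are the cell probabilities. -/

section Tables

variable {K J : ℕ} {m v a q : ℝ}

theorem leftLaw_real_singleton (hK : 2 ≤ K) (hv : 0 < v) (hv1 : v ≠ 1) (ha : 0 < a) (hq : 1 ≤ q)
    (j : Fin (2 * J + 1)) :
    (leftLaw K m v (2 * J) (level a q J)).real {j} =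
      increments (2 * J) (fun k => RealRAM.leftCdf K m v (level a q J k)) j := by
  have := isProbabilityMeasure_truncNormal hK
  have hm : Measurable fun z => logRatio m v (m + √v * z) :=
    (measurable_logRatio m v).comp (by fun_prop)
  rw [leftLaw, map_cellOf_real _ hm fun j k h h' => level_mono ha hq J h h']
  simp_rw [truncNormal_real_logRatio_affine_le hK hv hv1]
  rfl

theorem rightLaw_real_singleton (hK : 2 ≤ K) (hv : 0 < v) (hv1 : v ≠ 1) (ha : 0 < a) (hq : 1 ≤ q)
    (j : Fin (2 * J + 1)) :
    (rightLaw K m v (2 * J) (level a q J)).real {j} =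
      increments (2 * J) (fun k => RealRAM.rightCdf K m v (level a q J k)) j := by
  have := isProbabilityMeasure_truncNormal hK
  rw [rightLaw, map_cellOf_real _ (measurable_logRatio m v) fun j k h h' => level_mono ha hq J h h']
  simp_rw [truncNormal_real_logRatio_le hK hv hv1]
  rfl

end Tables

/-! ### Operation count and conclusion. -/

theorem sum_range_inputState {n : ℕ} (μ : EuclideanSpace ℝ (Fin n)) (d : Fin n → ℝ) (ε : ℝ) :
    ∑ i ∈ Finset.range n, gaussGap ((RealRAM.inputState n μ d ε).mem 0 i)
      ((RealRAM.inputState n μ d ε).mem 1 i) = ∑ i, gaussGap (μ i) (d i) := by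
  rw [Finset.sum_range]
  refine Finset.sum_congr rfl fun i _ => ?_
  simp [RealRAM.inputState]

/-- The number of operations is of the order `n² / ε * ℓ³`. -/
theorem operations_le {n N NJ : ℕ} {ε ℓ : ℝ} (hn : 1 ≤ n) (hε : 0 < ε) (hε1 : ε < 1)
    (hℓ : 1 / 2 ≤ ℓ) (hN : (N : ℝ) ≤ 546 * ℓ) (hNJ : (NJ : ℝ) ≤ 1058 * (n / ε * ℓ)) :
    ((14 * n + 15 * N + 13 * NJ + ((44 * (N + 2) + 121) * (2 * NJ) + 32) * n + 77 : ℕ) : ℝ) ≤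
      10 ^ 9 * ((n : ℝ) ^ 2 / ε * ℓ ^ 3) := by
  have hnR : (1 : ℝ) ≤ n := Nat.one_le_cast.2 hn
  set X := (n : ℝ) / ε with hX
  have hnX : (n : ℝ) ≤ X := by
    rw [hX, le_div_iff₀ hε]
    nlinarith
  have eW : (n : ℝ) ^ 2 / ε * ℓ ^ 3 = n * X * ℓ ^ 3 := by rw [hX]; ring
  rw [eW]
  have hℓ0 : 0 < ℓ := by linarith
  have hX1 : 1 ≤ X := hnR.trans hnX
  -- Since ℓ ≥ 1/2, 44(N + 2) + 121 ≤ 44·546ℓ + 418ℓ = 24442ℓ.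
  have h1 : (44 * ((N : ℝ) + 2) + 121) * (2 * NJ) ≤ (24442 * ℓ) * (2 * (1058 * (X * ℓ))) := by
    gcongr
    linarith
  -- The leading term is of order nXℓ². Lower powers of ℓ are raised to ℓ³ at the price of factors
  -- 2.
  have hℓ1 : ℓ ≤ 2 * ℓ ^ 2 := by nlinarith
  have hℓ2 : ℓ ^ 2 ≤ 2 * ℓ ^ 3 := by nlinarith [sq_nonneg ℓ]
  have hnX1 : 1 ≤ n * X := by nlinarith
  have b1 : ℓ ^ 3 ≤ n * X * ℓ ^ 3 := le_mul_of_one_le_left (by positivity) hnX1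
  have b2 : (n : ℝ) * (1 / 8) ≤ n * X * ℓ ^ 3 := by
    rw [mul_assoc]
    gcongr
    nlinarith [mul_nonneg (sub_nonneg.2 hX1) (pow_pos hℓ0 3).le]
  have b3 : X * ℓ ≤ 4 * (n * X * ℓ ^ 3) := by
    have := mul_le_mul_of_nonneg_right hnR (by positivity : 0 ≤ X * ℓ ^ 3)
    nlinarith [mul_le_mul_of_nonneg_left (by linarith : ℓ ≤ 4 * ℓ ^ 3) (by linarith : 0 ≤ X)]
  have b4 : n * (X * ℓ ^ 2) ≤ 2 * (n * X * ℓ ^ 3) := by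
    nlinarith [mul_le_mul_of_nonneg_left hℓ2 (by positivity : 0 ≤ n * X)]
  have h2 := mul_le_mul_of_nonneg_right h1 (by linarith : (0 : ℝ) ≤ n)
  push_cast
  nlinarith

theorem mainTheorem5 :
    ∃ (A : RealRAM.Prog) (C : ℝ), 0 < C ∧
      ∀ (n : ℕ) (μ : EuclideanSpace ℝ (Fin n)) (d : Fin n → ℝ) (ε D : ℝ),
        (∀ i, 0 < d i) → 0 < ε → ε < 1 →
        D = tvDist (multivariateGaussian μ (Matrix.diagonal d))
              (multivariateGaussian 0 (1 : Matrix (Fin n) (Fin n) ℝ)) →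
        0 < D →
        ∃ (M T : ℕ) (P Q : Fin n → PMF (Fin M)) (τ : RealRAM.State),
          A.Runs (RealRAM.inputState n μ d ε) τ T ∧
          τ.Outputs P Q ∧
          (T : ℝ) ≤ C * ((n : ℝ) ^ 2 / ε * Real.log (2 * n / (ε * D)) ^ 3) ∧
          (M : ℝ) ≤ C * ((n : ℝ) / ε * Real.log (2 * n / (ε * D))) ∧
          |tvDist (Measure.pi fun i => (P i).toMeasure)
              (Measure.pi fun i => (Q i).toMeasure) - D| ≤ ε / 3 * D := by
  refine ⟨RealRAM.gaussianTablesProg, 10 ^ 9, by norm_num, ?_⟩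
  intro n μ d ε D hd hε hε1 hDdef hD
  have eD : D = gaussDist (fun i => μ i) d := by
    rw [hDdef, tvDist_multivariateGaussian μ hd, gaussDist, Real.toNNReal_one]
  subst eD
  clear hDdef
  have hn0 : 0 < n := pos_of_gaussDist_pos hD
  have hδ := tol_pos hd hε hD
  have hη := mesh_pos hε hn0
  have hℓ := half_le_logFactor hε hε1 hD
  have hlog := log_inv_tol_le hd hε hε1 hD
  have hX : 1 / 2 ≤ n / ε * logFactor ε (fun i => μ i) d := by
    have : (1 : ℝ) ≤ n / ε := by
      rw [le_div_iff₀ hε]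
      have : (1 : ℝ) ≤ n := Nat.one_le_cast.2 hn0
      linarith
    nlinarith
  rw [show Real.log (2 * n / (ε * gaussDist (fun i => μ i) d)) = logFactor ε (fun i => μ i) d
    from rfl]
  set ℓ := logFactor ε (fun i => μ i) d
  set δ := tol ε (fun i => μ i) d with hδdef
  have hmem0 (i : Fin n) : (RealRAM.inputState n μ d ε).mem 0 i = μ i := by
    simp [RealRAM.inputState]
  have hmem1 (i : Fin n) : (RealRAM.inputState n μ d ε).mem 1 i = d i := by
    simp [RealRAM.inputState]
  -- The bound 544 = 32·17 comes from `log_inv_tol_le`. The number of levels on each side is bounded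
  -- through `level_count_le`; the added 1 makes the inequality strict.
  obtain ⟨τ, T, hrun, hT, J, K, hJN, hJ, hK, hKl, hsize, hleft, hright⟩ :=
    RealRAM.reach_gaussianTablesProg (N := ⌈544 * ℓ⌉₊) (NJ := ⌊1056 * (n / ε * ℓ)⌋₊ + 1) hn0 hε
      (σ := RealRAM.inputState n μ d ε) (δ := δ) (by simp [RealRAM.inputState])
      (by simp [RealRAM.inputState]) (by simp [RealRAM.inputState])
      (by simp [RealRAM.inputState])
      (fun i hi => by rw [hmem1 ⟨i, hi⟩]; exact hd _)
      (by rw [sum_range_inputState, hδdef, tol]) hδ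
      (le_trans (by linarith) (Nat.le_ceil _))
      (fun k hk => Nat.lt_succ_of_le (Nat.le_floor (level_count_le hd hε hε1 hD hk)))
  have hN : (⌈544 * ℓ⌉₊ : ℝ) ≤ 546 * ℓ := by
    have := (Nat.ceil_lt_add_one (by linarith : 0 ≤ 544 * ℓ)).le
    linarith
  have hNJ : ((⌊1056 * (n / ε * ℓ)⌋₊ + 1 : ℕ) : ℝ) ≤ 1058 * (n / ε * ℓ) := by
    have := Nat.floor_le (by linarith : 0 ≤ 1056 * (n / ε * ℓ))
    push_cast
    linarith
  have iL (i : Fin n) := isProbabilityMeasure_leftLaw hK (μ i) (nudge δ (d i)) (2 * J)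
    (level (1 / mesh ε n) (1 + mesh ε n) J)
  have iR (i : Fin n) := isProbabilityMeasure_rightLaw hK (μ i) (nudge δ (d i)) (2 * J)
    (level (1 / mesh ε n) (1 + mesh ε n) J)
  refine ⟨2 * J + 1, T,
    fun i => (leftLaw K (μ i) (nudge δ (d i)) (2 * J)
      (level (1 / mesh ε n) (1 + mesh ε n) J)).toPMF,
    fun i => (rightLaw K (μ i) (nudge δ (d i)) (2 * J)
      (level (1 / mesh ε n) (1 + mesh ε n) J)).toPMF, τ, hrun, ⟨hsize, ?_, ?_⟩, ?_, ?_, ?_⟩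
  · intro i j
    rw [hleft i i.2 j j.2, hmem0, hmem1, Measure.toPMF_apply]
    exact (leftLaw_real_singleton hK (nudge_pos hδ (hd i)) (nudge_ne_one hδ) (by positivity)
      (by linarith) j).symm
  · intro i j
    rw [hright i i.2 j j.2, hmem0, hmem1, Measure.toPMF_apply]
    exact (rightLaw_real_singleton hK (nudge_pos hδ (hd i)) (nudge_ne_one hδ) (by positivity)
      (by linarith) j).symm
  · exact (Nat.cast_le.2 hT).trans (operations_le hn0 hε hε1 hℓ hN hNJ)
  · have : (J : ℝ) ≤ ((⌊1056 * (n / ε * ℓ)⌋₊ + 1 : ℕ) : ℝ) := Nat.cast_le.2 hJN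
    push_cast at this hNJ ⊢
    linarith
  · simp only [Measure.toPMF_toMeasure]
    exact abs_tables_sub_gaussDist_le hd hε hε1 hD hJ hK hKl
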